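/- Let $R$ be a commutative ring with unit and let $\Sigma$ be a smooth oriented surface, possibly with boundary. A *loop* on $\Sigma$ is a generic loop, i.e. a (piecewise smooth) immersion $\alpha:S^1\to\Sigma\setminus\partial\Sigma$ whose only self-crossings are finitely many double transversal ones; corners are allowed at points other than the crossings. Let $\#\alpha$ be the set of self-crossings. A *pointed loop* is a loop $\alpha$ with a base point $*_\alpha\in\alpha(S^1)\setminus\#\alpha$. Pointed loops are considered up to isotopy, the equivalence relation generated by reparametrizations by orientation preserving homeomorphisms of $S^1$ (keeping the base point) and by ambient isotopies of $\Sigma$ (continuous families of homeomorphisms starting at $\mathrm{id}_\Sigma$, carrying the base point along). Let $\mathcal L$ be the free $R$-module on the set of isotopy classes of pointed loops, and let $S(\mathcal L)$ and $T(\mathcal L)$ be its symmetric and tensor algebras. Let $\alpha$ be a pointed loop. For $p\in\#\alpha$ write $\alpha^{-1}(p)=\{p_1,p_2\}$, where, moving counterclockwise along $S^1$ from $\alpha^{-1}(*_\alpha)$, one meets first $p_1$ and then $p_2$; let $\varepsilon_p=+1$ if the tangent directions of $\alpha$ at $p_1,p_2$, in this order, form a positive basis, and $\varepsilon_p=-1$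 otherwise. Let $e_p$ be the straight segment from $p_1$ to $p_2$ in the unit disk $D$. A *cut* is a set $H\subset\#\alpha$ such that the segments $e_p$, $p\in H$, are pairwise disjoint; they split $D$ into regions, the $H$-faces. Let $v(H)$ be the face containing $\alpha^{-1}(*_\alpha)$, and for $p\in H$ let $v(H,p)$ be the face adjacent to $e_p$ and separated from $v(H)$ by the line through $e_p$. For a face $v$ let $\alpha_v$ be the loop obtained by moving counterclockwise along $\partial v$ and applying $\alpha$ while on $S^1$; the base point of $\alpha_{v(H)}$ is $*_\alpha$ and the base point of $\alpha_{v(H,p)}$ is $p$. The cut $H$ is *simple*, written $H\ll\alpha$, if all $e_p$, $p\in H$, are adjacent to $v(H)$. Put $\varepsilon_H=\prod_{p\in H}\varepsilon_p$, $l_H(\alpha)=\prod_{p\in H}\alpha_{v(H,p)}\in S(\mathcal L)$, $r_H(\alpha)=\alpha_{v(H)}\in\mathcal L$, and let $\tilde l_H(\alpha)\in T(\mathcal L)$ be the product of the $\alpha_{v(H,p)}$, $p\in H$, in the order in which the crossings $p \in H$ are first met when moving along $\alpha$ from $*_\alpha$. **Lemma.** For every simple cut $H$ of a pointed loop $\alpha$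 the pointed loops $\alpha_{v(H)}$ and $\alpha_{v(H,p)}$, $p\in H$, exist and are unique up to isotopy. Moreover: 1. There is a unique algebra homomorphism $\Delta:S(\mathcal L)\to S(\mathcal L)\otimes S(\mathcal L)$ such that for all pointed loops $\alpha$ $$\Delta(\alpha)=\alpha\otimes 1+\sum_{H\ll\alpha}\varepsilon_H\,l_H(\alpha)\otimes r_H(\alpha).$$ It is coassociative, and the augmentation $S(\mathcal L)\to R$ is its counit. There is a unique algebra endomorphism $s$ of $S(\mathcal L)$ such that for all pointed loops $\alpha$ $$s(\alpha)=-\alpha-\sum_{H\ll\alpha,\ H\ne\emptyset}\varepsilon_H\,l_H(\alpha)\,s(r_H(\alpha)),$$ and $s$ is an antipode. Thus $S(\mathcal L)$ is a Hopf algebra. 2. There is a unique algebra homomorphism $\tilde\Delta:T(\mathcal L)\to T(\mathcal L)\otimes T(\mathcal L)$ such that for all pointed loops $\alpha$ $$\tilde\Delta(\alpha)=\alpha\otimes 1+\sum_{H\ll\alpha}\varepsilon_H\,\tilde l_H(\alpha)\otimes r_H(\alpha).$$ It is coassociative, the projection $T(\mathcal L)\to R$ along $\bigoplus_{n\ge1}\mathcal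 L^{\otimes n}$ is its counit, and there is an antipode. Thus $T(\mathcal L)$ is a Hopf algebra. -/

import Mathlib

open scoped Manifold ContDiff TensorProduct

noncomputable section

namespace LoopHopf

/-- The model plane. -/
abbrev Plane := EuclideanSpace ℝ (Fin 2)

/-! ### Orientations and velocities -/

/-- An orientation of a smooth surface (possibly with boundary): an orientation of every tangent
plane which is locally constant, i.e. for every point `x`, a coordinate frame of the chart at `x`
represents the orientation at all points near `x` or at none. -/
structure SurfaceOrientation (M : Type*) [TopologicalSpace M]
    [ChartedSpace (EuclideanHalfSpace 2) M] [IsManifold (𝓡∂ 2) ∞ M] where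
  /-- the orientation of the tangent plane at `x` -/
  orient : ∀ x : M, Orientation ℝ (TangentSpace (𝓡∂ 2) x) (Fin 2)
  /-- `tangentCoordChange (𝓡∂ 2) x y y v` is the tangent vector at `y` whose coordinates in the
  chart at `x` are `v`. -/
  locally_constant : ∀ x : M, ∀ᶠ y in nhds x, ∀ v w : Plane,
    (∃ b : Module.Basis (Fin 2) ℝ (TangentSpace (𝓡∂ 2) y),
        b 0 = tangentCoordChange (𝓡∂ 2) x y y v ∧ b 1 = tangentCoordChange (𝓡∂ 2) x y y w ∧
          b.orientation = orient y) ↔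
      ∃ b : Module.Basis (Fin 2) ℝ (TangentSpace (𝓡∂ 2) x),
        b 0 = v ∧ b 1 = w ∧ b.orientation = orient x

variable {M : Type*} [TopologicalSpace M] [ChartedSpace (EuclideanHalfSpace 2) M]

/-- `(v, w)` is a positive basis of the tangent plane at `p`. -/
def SurfaceOrientation.IsPositive [IsManifold (𝓡∂ 2) ∞ M] (o : SurfaceOrientation M) (p : M)
    (v w : Plane) : Prop :=
  ∃ b : Module.Basis (Fin 2) ℝ (TangentSpace (𝓡∂ 2) p),
    b 0 = v ∧ b 1 = w ∧ b.orientation = o.orient p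

/-- The velocity at time `u` of a path `γ`, computed within the set of times `s`. It is a vector
of the tangent plane at `γ u`, which in Mathlib is a copy of the model plane through the
preferred chart at the point `γ u`. -/
def velocity (γ : ℝ → M) (s : Set ℝ) (u : ℝ) : Plane :=
  (mfderivWithin 𝓘(ℝ, ℝ) (𝓡∂ 2) γ s u : ℝ →L[ℝ] Plane) 1

/-! ### Generic loops -/

/-- The points of `M` which `α` passes through at least twice. -/
def selfCrossings (α : Circle → M) : Set M :=
  {p | ∃ z w : Circle, z ≠ w ∧ α z = p ∧ α w = p}

variable (M) in
/-- A generic loop: a piecewise smooth immersion of the circle in the interior of the surface,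
having only finitely many self-crossings, all of them double and transversal. The non-smooth points
look like corners of a broken line (no cusps) and are distinct from the crossing points. Smoothness
is expressed through the parametrization `u ↦ α (exp (i u))`. -/
structure GenericLoop where
  toFun : Circle → M
  continuous : Continuous toFun
  interior : ∀ z, (𝓡∂ 2).IsInteriorPoint (toFun z)
  smooth_right : ∀ u : ℝ, ∃ v, u < v ∧
    ContMDiffOn 𝓘(ℝ, ℝ) (𝓡∂ 2) ∞ (fun t : ℝ => toFun (Circle.exp t)) (Set.Icc u v)
  smooth_left : ∀ u : ℝ, ∃ v, v < u ∧
    ContMDiffOn 𝓘(ℝ, ℝ) (𝓡∂ 2) ∞ (fun t : ℝ => toFun (Circle.exp t)) (Set.Icc v u)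
  immersed_right : ∀ u : ℝ, velocity (fun t : ℝ => toFun (Circle.exp t)) (Set.Ici u) u ≠ 0
  immersed_left : ∀ u : ℝ, velocity (fun t : ℝ => toFun (Circle.exp t)) (Set.Iic u) u ≠ 0
  no_cusp : ∀ u : ℝ, ¬ SameRay ℝ (-velocity (fun t : ℝ => toFun (Circle.exp t)) (Set.Iic u) u)
    (velocity (fun t : ℝ => toFun (Circle.exp t)) (Set.Ici u) u)
  finite_crossings : (selfCrossings toFun).Finite
  double : ∀ p : M, (toFun ⁻¹' {p}).encard ≤ 2
  smooth_at_crossing : ∀ u : ℝ, toFun (Circle.exp u) ∈ selfCrossings toFun →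
    ContMDiffAt 𝓘(ℝ, ℝ) (𝓡∂ 2) ∞ (fun t : ℝ => toFun (Circle.exp t)) u
  transversal : ∀ u v : ℝ, Circle.exp u ≠ Circle.exp v →
    toFun (Circle.exp u) = toFun (Circle.exp v) →
    LinearIndependent ℝ ![velocity (fun t : ℝ => toFun (Circle.exp t)) Set.univ u,
      velocity (fun t : ℝ => toFun (Circle.exp t)) Set.univ v]

variable (M) in
/-- A pointed loop: a generic loop with a base point on it which is not a self-crossing. -/
structure PointedLoop extends GenericLoop M where
  base : M
  base_mem : base ∈ Set.range toFun
  base_not_crossing : base ∉ selfCrossings toFun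

/-! ### Isotopy -/

/-- Orientation preserving self-homeomorphisms of the circle: those which lift to increasing
functions of the angle. -/
def OrientationPreserving (f : Circle ≃ₜ Circle) : Prop :=
  ∃ F : ℝ → ℝ, Continuous F ∧ StrictMono F ∧ ∀ u, f (Circle.exp u) = Circle.exp (F u)

/-- `β` is obtained from `α` by reparametrization. -/
def Reparametrization (α β : PointedLoop M) : Prop :=
  α.base = β.base ∧ ∃ f : Circle ≃ₜ Circle, OrientationPreserving f ∧ β.toFun = α.toFun ∘ f

/-- `β` is obtained from `α` by an ambient isotopy, i.e. a continuous family of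
homeomorphisms of the surface which starts at the identity. -/
def AmbientIsotopic (α β : PointedLoop M) : Prop :=
  ∃ h : unitInterval → M ≃ₜ M, (Continuous fun x : unitInterval × M => h x.1 x.2) ∧
    h 0 = Homeomorph.refl M ∧ β.toFun = h 1 ∘ α.toFun ∧ β.base = h 1 α.base

variable (M) in
/-- Isotopy classes of pointed loops; `Quot` passes to the equivalence relation generated by
reparametrization and ambient isotopy. -/
def LoopClass : Type _ :=
  Quot fun α β : PointedLoop M => Reparametrization α β ∨ AmbientIsotopic α β

namespace PointedLoop

variable (α : PointedLoop M)

/-- The isotopy class of a pointed loop. -/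
def isotopyClass : LoopClass M := Quot.mk _ α

/-! ### Crossings, signs and segments -/

/-- The unique point of the circle that is mapped to the base point. -/
def basePreimage : Circle := Classical.choose α.base_mem

/-- The loop as a path which starts at the base point at time `0` and moves counterclockwise along
the circle, coming back at time `2π`. -/
def path (u : ℝ) : M := α.toFun (α.basePreimage * Circle.exp u)

/-- The set of self-crossings of `α`. -/
def crossings : Set M := selfCrossings α.toFun

/-- The time in `]0, 2π[` at which the path `α.path` meets the crossing `p` first. -/
def time₁ (p : M) : ℝ := sInf {u | u ∈ Set.Ioo 0 (2 * Real.pi) ∧ α.path u = p}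

/-- The time in `]0, 2π[` at which the path `α.path` meets the crossing `p` last, that is, for the
second time. -/
def time₂ (p : M) : ℝ := sSup {u | u ∈ Set.Ioo 0 (2 * Real.pi) ∧ α.path u = p}

/-- The point `p₁` of the circle. -/
def point₁ (p : M) : Circle := α.basePreimage * Circle.exp (α.time₁ p)

/-- The point `p₂` of the circle. -/
def point₂ (p : M) : Circle := α.basePreimage * Circle.exp (α.time₂ p)

open Classical in
/-- The sign of a crossing: `+1` if the tangent directions at `p₁` and `p₂`, in this order, form
a positive basis, and `-1` otherwise. -/
def sign [IsManifold (𝓡∂ 2) ∞ M] (o : SurfaceOrientation M) (p : M) : ℤ :=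
  if o.IsPositive p (velocity α.path Set.univ (α.time₁ p)) (velocity α.path Set.univ (α.time₂ p))
  then 1 else -1

/-- The product of the signs of the crossings in `H`. -/
def cutSign [IsManifold (𝓡∂ 2) ∞ M] (o : SurfaceOrientation M) (H : Finset M) : ℤ :=
  ∏ p ∈ H, α.sign o p

/-- The straight segment `e_p` in the unit disk joining `p₁` and `p₂`. -/
def chord (p : M) : Set ℂ := segment ℝ (α.point₁ p : ℂ) (α.point₂ p : ℂ)

/-! ### Cuts and faces -/

/-- A cut: a set of crossings whose segments are pairwise disjoint. -/
def IsCut (H : Finset M) : Prop :=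
  (H : Set M) ⊆ α.crossings ∧ ∀ p ∈ H, ∀ q ∈ H, p ≠ q → Disjoint (α.chord p) (α.chord q)

/-- The unit disk without the segments `e_p`, `p ∈ H`. -/
def splitDisk (H : Finset M) : Set ℂ := Metric.closedBall 0 1 \ ⋃ p ∈ H, α.chord p

/-- The `H`-faces: the regions into which the segments `e_p`, `p ∈ H`, split the unit disk. -/
def IsFace (H : Finset M) (V : Set ℂ) : Prop :=
  ∃ z ∈ α.splitDisk H, V = connectedComponentIn (α.splitDisk H) z

/-- The root face `v(H)`: the face which contains the preimage of the base point. -/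
def rootFace (H : Finset M) : Set ℂ :=
  connectedComponentIn (α.splitDisk H) (α.basePreimage : ℂ)

/-- The face `V` is adjacent to the segment `e_p`. -/
def Adjacent (p : M) (V : Set ℂ) : Prop := α.chord p ⊆ closure V

/-- `V` is the face `v(H, p)`: it is adjacent to `e_p`, and `V` and the root face lie on different
sides of the line containing `e_p`. -/
def IsOuterFace (H : Finset M) (p : M) (V : Set ℂ) : Prop :=
  α.IsFace H V ∧ α.Adjacent p V ∧ ∀ x ∈ V, ∀ y ∈ α.rootFace H,
    (line[ℝ, (α.point₁ p : ℂ), (α.point₂ p : ℂ)]).SOppSide x y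

/-- A simple cut: all segments `e_p`, `p ∈ H`, are adjacent to the root face. -/
def IsSimpleCut (H : Finset M) : Prop :=
  α.IsCut H ∧ ∀ p ∈ H, α.Adjacent p (α.rootFace H)

open Classical in
/-- The finite set of all simple cuts of `α`. -/
def simpleCuts : Finset (Finset M) :=
  α.finite_crossings.toFinset.powerset.filter fun H => α.IsSimpleCut H

/-! ### The loops associated with the faces -/

/-- `β` is the loop obtained by moving counterclockwise along the boundary of `V` and applying `α`
while on the circle. The angular function `c` collapses precisely the arcs of the circle that do
not bound `V`. -/
def IsBoundaryLoop (V : Set ℂ) (β : GenericLoop M) : Prop :=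
  ∃ c : ℝ → ℝ, Continuous c ∧ Monotone c ∧ (∀ u, c (u + 2 * Real.pi) = c u + 2 * Real.pi) ∧
    (∀ u v, u < v → (c u = c v ↔ ∀ t ∈ Set.Ioo u v, (Circle.exp t : ℂ) ∉ closure V)) ∧
    ∀ u, (Circle.exp u : ℂ) ∈ closure V →
      β.toFun (Circle.exp (c u)) = α.toFun (Circle.exp u)

/-- `β` represents `α_{v(H)}`; its base point is that of `α`. -/
def IsRootLoop (H : Finset M) (β : PointedLoop M) : Prop :=
  α.IsBoundaryLoop (α.rootFace H) β.toGenericLoop ∧ β.base = α.base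

/-- `β` represents `α_{v(H, p)}`; its base point is the crossing `p`. -/
def IsOuterLoop (H : Finset M) (p : M) (β : PointedLoop M) : Prop :=
  ∃ V, α.IsOuterFace H p V ∧ α.IsBoundaryLoop V β.toGenericLoop ∧ β.base = p

/-- The isotopy class of `α_{v(H)}`. -/
def rootClass (H : Finset M) : LoopClass M :=
  @Classical.epsilon _ ⟨α.isotopyClass⟩ fun x => ∃ β, α.IsRootLoop H β ∧ x = β.isotopyClass

/-- The isotopy class of `α_{v(H, p)}`. -/
def outerClass (H : Finset M) (p : M) : LoopClass M :=
  @Classical.epsilon _ ⟨α.isotopyClass⟩ fun x => ∃ β, α.IsOuterLoop H p β ∧ x = β.isotopyClass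

end PointedLoop

/-! ### The symmetric and tensor algebras -/

section Algebras

variable (R : Type*) [CommRing R]

variable (M) in
/-- The free module `𝓛` on the isotopy classes of pointed loops. -/
abbrev LoopModule := LoopClass M →₀ R

variable (M) in
/-- The symmetric algebra `S(𝓛)`. -/
abbrev SymLoops := SymmetricAlgebra R (LoopModule M R)

variable (M) in
/-- The tensor algebra `T(𝓛)`. -/
abbrev TensorLoops := TensorAlgebra R (LoopModule M R)

/-- An isotopy class as an element of `S(𝓛)`. -/
def symGen (x : LoopClass M) : SymLoops M R :=
  SymmetricAlgebra.ι R (LoopModule M R) (Finsupp.single x 1)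

/-- An isotopy class as an element of `T(𝓛)`. -/
def tensorGen (x : LoopClass M) : TensorLoops M R :=
  TensorAlgebra.ι R (Finsupp.single x 1 : LoopModule M R)

namespace PointedLoop

variable (α : PointedLoop M)

/-- The element `l_H(α)` of `S(𝓛)`. -/
def symLeft (H : Finset M) : SymLoops M R := ∏ p ∈ H, symGen R (α.outerClass H p)

open Classical in
/-- The element `l̃_H(α)` of `T(𝓛)`: the product of the classes of `α_{v(H, p)}` over `p ∈ H` in the
order in which the crossings are met when moving along `α` from the base point. -/
def tensorLeft (H : Finset M) : TensorLoops M R :=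
  (((H.image α.time₁).sort).map fun u => tensorGen R (α.outerClass H (α.path u))).prod

variable [IsManifold (𝓡∂ 2) ∞ M] (o : SurfaceOrientation M)

/-- The value of the comultiplication of `S(𝓛)` on a pointed loop. -/
def symDelta : SymLoops M R ⊗[R] SymLoops M R :=
  symGen R α.isotopyClass ⊗ₜ[R] 1 + ∑ H ∈ α.simpleCuts,
    ((α.cutSign o H : ℤ) : R) • (α.symLeft R H ⊗ₜ[R] symGen R (α.rootClass H))

/-- The value of the comultiplication of `T(𝓛)` on a pointed loop. -/
def tensorDelta : TensorLoops M R ⊗[R] TensorLoops M R :=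
  tensorGen R α.isotopyClass ⊗ₜ[R] 1 + ∑ H ∈ α.simpleCuts,
    ((α.cutSign o H : ℤ) : R) • (α.tensorLeft R H ⊗ₜ[R] tensorGen R (α.rootClass H))

open Classical in
/-- The inductive formula for the value of the antipode `s` of `S(𝓛)` on a pointed loop. -/
def symAntipodeValue (s : SymLoops M R →ₐ[R] SymLoops M R) : SymLoops M R :=
  -symGen R α.isotopyClass - ∑ H ∈ α.simpleCuts.erase ∅,
    ((α.cutSign o H : ℤ) : R) • (α.symLeft R H * s (symGen R (α.rootClass H)))

end PointedLoop

/-! ### Hopf algebra axioms for a comultiplication on a given algebra -/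

variable {R} {A : Type*} [Ring A] [Algebra R A]

/-- `(Δ ⊗ id) Δ = (id ⊗ Δ) Δ`. -/
def IsCoassociative (Δ : A →ₐ[R] A ⊗[R] A) : Prop :=
  (TensorProduct.assoc R A A A).toLinearMap ∘ₗ Δ.toLinearMap.rTensor A ∘ₗ Δ.toLinearMap =
    Δ.toLinearMap.lTensor A ∘ₗ Δ.toLinearMap

/-- `(ε ⊗ id) Δ = id` and `(id ⊗ ε) Δ = id`. -/
def IsCounit (Δ : A →ₐ[R] A ⊗[R] A) (ε : A →ₐ[R] R) : Prop :=
  ε.toLinearMap.rTensor A ∘ₗ Δ.toLinearMap = TensorProduct.mk R R A 1 ∧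
    ε.toLinearMap.lTensor A ∘ₗ Δ.toLinearMap = (TensorProduct.mk R A R).flip 1

/-- `m (s ⊗ id) Δ = m (id ⊗ s) Δ = ε · 1`. -/
def IsAntipode (Δ : A →ₐ[R] A ⊗[R] A) (ε : A →ₐ[R] R) (s : A →ₗ[R] A) : Prop :=
  LinearMap.mul' R A ∘ₗ s.rTensor A ∘ₗ Δ.toLinearMap = Algebra.linearMap R A ∘ₗ ε.toLinearMap ∧
    LinearMap.mul' R A ∘ₗ s.lTensor A ∘ₗ Δ.toLinearMap = Algebra.linearMap R A ∘ₗ ε.toLinearMap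

end Algebras

end LoopHopf

end

noncomputable section

namespace LoopHopf

/-! ### Winding numbers of closed curves around the origin -/

/-! The geometry is first turned into combinatorics of time intervals. Starting at the base point, a
crossing p is passed at two times 0 < t₁ < t₂ < 2π. The chord e_p divides the disk according to the
sign of the affine function `side`, and a set of crossings is a simple cut exactly when the
intervals [t₁, t₂] are pairwise disjoint (`isSimpleCut_iff`). The root face then corresponds to the
times outside all the open intervals, and the face v(H, p) to [t₁, t₂] itself. Collapsing the
remaining times at constant speed produces the required loop. Two collapses of the same set of times
differ by a homeomorphism of the circle, which gives uniqueness. Cutting a subloop again only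
enlarges the set of collapsed times, so classes of iterated subloops are compared by comparing sets
of times.

The comultiplication must depend only on the isotopy class. Times and subloops are easily
transported. The delicate point is the sign of a crossing, because an ambient isotopy consists of
mere homeomorphisms. The sign is therefore expressed by a topological local index: in a chart, the
winding number of θ ↦ A(r cos θ) − B(r sin θ) around 0 for the two branches A and B. It equals minus
the sign of the determinant of the velocities (`hasWinding_differenceCurve`) and is invariant under
homotopy. A change of chart multiplies it by the sign of the Jacobian, which the orientation
compensates (`isPositive_iff_of_isotopy`).

For coassociativity it suffices to look at generators. Expanding Δ(l_H), every p in H contributes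
either α_p ⊗ 1 or a simple cut of α_p. Altogether the choices are the simple cuts K whose crossings
belong to H or lie inside crossings of H (`orderedProd_tensorDelta`). On the other side stand a cut
K of α and a cut L of its root loop. The bijection (H, K) ↔ (K, L = H \ K) of `sum_cutsBelow_eq`
matches the two sums; both signs equal the sign of H ∪ K. The order of the factors in T(𝓛) is
respected because disjoint intervals are linearly ordered in time.

Every subloop obtained by a nonempty cut has fewer crossings. Hence the equations for a left and for
a right convolution inverse of the identity can be solved by recursion on the number of crossings,
with antihomomorphisms of T(𝓛) as solutions. By associativity of convolution both inverses agree and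
form the antipode. Everything descends along T(𝓛) → S(𝓛), where an antihomomorphism becomes a
homomorphism. -/

/-- The closed curve `f : [0, 2π] → ℂ` avoids `0` and winds `n` times around it. -/
def HasWinding (f : ℝ → ℂ) (n : ℤ) : Prop :=
  ∃ g : ℝ → ℂ, ContinuousOn g (Set.Icc 0 (2 * Real.pi)) ∧
    (∀ θ ∈ Set.Icc 0 (2 * Real.pi), f θ = Complex.exp (g θ)) ∧
    g (2 * Real.pi) = g 0 + n * (2 * Real.pi * Complex.I)

theorem zero_mem_Icc_two_pi : (0 : ℝ) ∈ Set.Icc 0 (2 * Real.pi) :=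
  ⟨le_rfl, Real.two_pi_pos.le⟩

theorem two_pi_mem_Icc_two_pi : 2 * Real.pi ∈ Set.Icc 0 (2 * Real.pi) :=
  ⟨Real.two_pi_pos.le, le_rfl⟩

/-- Two continuous logarithms of the same curve differ by 2πi times a continuous integer-valued
function. Such a function is constant on the interval, while its values at the two ends differ by n
− m. -/
theorem HasWinding.unique {f : ℝ → ℂ} {n m : ℤ} (hn : HasWinding f n) (hm : HasWinding f m) :
    n = m := by
  obtain ⟨g, hg, hfg, hn⟩ := hn
  obtain ⟨g', hg', hfg', hm⟩ := hm
  set k : ℝ → ℝ := fun θ => ((g θ - g' θ) / (2 * Real.pi * Complex.I)).re with hk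
  have hkc : ContinuousOn k (Set.Icc 0 (2 * Real.pi)) :=
    Complex.continuous_re.comp_continuousOn ((hg.sub hg').div_const _)
  have hkint : Set.MapsTo k (Set.Icc 0 (2 * Real.pi)) (Set.range (Int.cast : ℤ → ℝ)) := by
    intro θ hθ
    have h1 : Complex.exp (g θ) = Complex.exp (g' θ) := by rw [← hfg θ hθ, ← hfg' θ hθ]
    obtain ⟨j, hj⟩ := Complex.exp_eq_exp_iff_exists_int.1 h1
    refine ⟨j, ?_⟩
    have : (g θ - g' θ) / (2 * Real.pi * Complex.I) = j := by
      rw [hj, add_sub_cancel_left, mul_div_assoc, div_self Complex.two_pi_I_ne_zero, mul_one]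
    simp [hk, this]
  have hd : IsDiscrete (Set.range (Int.cast : ℤ → ℝ)) :=
    Int.isClosedEmbedding_coe_real.toIsEmbedding.isDiscrete_range
  have hc := isPreconnected_Icc.constant_of_mapsTo hd hkc hkint zero_mem_Icc_two_pi
    two_pi_mem_Icc_two_pi
  have h2 : (g (2 * Real.pi) - g' (2 * Real.pi)) / (2 * Real.pi * Complex.I) =
      (g 0 - g' 0) / (2 * Real.pi * Complex.I) + (n - m : ℤ) := by
    have := Complex.two_pi_I_ne_zero
    rw [hn, hm]
    push_cast
    field_simp
    ring
  simp only [hk, h2, Complex.add_re, Complex.intCast_re] at hc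
  have : ((n - m : ℤ) : ℝ) = 0 := by linarith
  have := Int.cast_eq_zero.1 this
  omega

/-- Rouché's argument: f'/f stays in the unit disk around 1, hence in the slit plane. Its principal
logarithm is continuous with equal values at both ends and can be added to a logarithm of f. -/
theorem HasWinding.of_norm_sub_lt {f f' : ℝ → ℂ} {n : ℤ} (h : HasWinding f n)
    (hc : ContinuousOn f' (Set.Icc 0 (2 * Real.pi))) (hper : f' (2 * Real.pi) = f' 0)
    (hlt : ∀ θ ∈ Set.Icc 0 (2 * Real.pi), ‖f' θ - f θ‖ < ‖f θ‖) : HasWinding f' n := by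
  obtain ⟨g, hg, hfg, hn⟩ := h
  have hf0 : ∀ θ ∈ Set.Icc 0 (2 * Real.pi), f θ ≠ 0 := fun θ hθ => by
    rw [hfg θ hθ]; exact Complex.exp_ne_zero _
  have hfc : ContinuousOn f (Set.Icc 0 (2 * Real.pi)) :=
    (Complex.continuous_exp.comp_continuousOn hg).congr hfg
  have hslit : ∀ θ ∈ Set.Icc 0 (2 * Real.pi), f' θ / f θ ∈ Complex.slitPlane := by
    intro θ hθ
    have h1 : ‖f' θ / f θ - 1‖ < 1 := by
      rw [div_sub_one (hf0 θ hθ), norm_div, div_lt_one (norm_pos_iff.2 (hf0 θ hθ))]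
      exact hlt θ hθ
    have := Complex.mem_slitPlane_of_norm_lt_one h1
    simpa using this
  refine ⟨fun θ => g θ + Complex.log (f' θ / f θ), hg.add ((hc.div hfc hf0).clog hslit), ?_, ?_⟩
  · intro θ hθ
    rw [Complex.exp_add, Complex.exp_log (Complex.slitPlane_ne_zero (hslit θ hθ)), ← hfg θ hθ,
      mul_div_cancel₀ _ (hf0 θ hθ)]
  · have h1 : f (2 * Real.pi) = f 0 := by
      rw [hfg _ two_pi_mem_Icc_two_pi, hfg _ zero_mem_Icc_two_pi, hn, Complex.exp_add,
        Complex.exp_int_mul_two_pi_mul_I, mul_one]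
    simp only [hn, h1, hper]
    ring

/-- By compactness of [0, 2π], nearby curves of the family satisfy the Rouché inequality in both
directions. The winding number is thus locally constant in the parameter, and the parameter space is
connected. -/
theorem HasWinding.homotopy {P : Type*} [TopologicalSpace P] [PreconnectedSpace P]
    {G : P → ℝ → ℂ} (hG : Continuous (Function.uncurry G)) (h0 : ∀ p θ, G p θ ≠ 0)
    (hper : ∀ p, G p (2 * Real.pi) = G p 0) {n : ℤ} {p : P} (hp : HasWinding (G p) n) (q : P) :
    HasWinding (G q) n := by
  have key : ∀ x : P, ∀ᶠ y in nhds x, (HasWinding (G x) n ↔ HasWinding (G y) n) := by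
    intro x
    have h1 : ∀ᶠ y in nhds x, ∀ θ ∈ Set.Icc 0 (2 * Real.pi),
        ‖G y θ - G x θ‖ < ‖G x θ‖ ∧ ‖G x θ - G y θ‖ < ‖G y θ‖ := by
      refine isCompact_Icc.eventually_forall_of_forall_eventually fun θ _ => ?_
      have c1 : Continuous fun z : P × ℝ => G z.1 z.2 := hG
      have c2 : Continuous fun z : P × ℝ => G x z.2 :=
        hG.comp (continuous_const.prodMk continuous_snd)
      have hx := norm_pos_iff.2 (h0 x θ)
      refine ((c1.sub c2).norm.continuousAt.eventually_lt c2.norm.continuousAt ?_).and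
        ((c2.sub c1).norm.continuousAt.eventually_lt c1.norm.continuousAt ?_) <;>
      simpa using h0 x θ
    filter_upwards [h1] with y hy
    have hcont : ∀ z, ContinuousOn (G z) (Set.Icc 0 (2 * Real.pi)) := fun z =>
      (hG.comp (Continuous.prodMk_right z)).continuousOn
    exact ⟨fun h => h.of_norm_sub_lt (hcont y) (hper y) fun θ hθ => (hy θ hθ).1,
      fun h => h.of_norm_sub_lt (hcont x) (hper x) fun θ hθ => (hy θ hθ).2⟩
  have := isPreconnected_univ.induction₂ (fun x y : P => (HasWinding (G x) n ↔ HasWinding (G y) n))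
    (fun x _ => by simpa using key x) (fun x y z _ _ _ h1 h2 => h1.trans h2)
    (fun x y _ _ h => h.symm) (Set.mem_univ p) (Set.mem_univ q)
  exact this.1 hp

/-- The circle `θ ↦ exp (iθ)` winds once around the origin. -/
theorem hasWinding_exp : HasWinding (fun θ => Complex.exp (θ * Complex.I)) 1 := by
  refine ⟨fun θ => θ * Complex.I, by fun_prop, fun _ _ => rfl, ?_⟩
  push_cast
  ring

theorem HasWinding.const_mul {f : ℝ → ℂ} {n : ℤ} (h : HasWinding f n) {A : ℂ} (hA : A ≠ 0) :
    HasWinding (fun θ => A * f θ) n := by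
  obtain ⟨g, hg, hfg, hn⟩ := h
  refine ⟨fun θ => Complex.log A + g θ, continuousOn_const.add hg, fun θ hθ => ?_, ?_⟩
  · simp only [Complex.exp_add, Complex.exp_log hA, hfg θ hθ]
  · simp only [hn]; ring

theorem HasWinding.conj {f : ℝ → ℂ} {n : ℤ} (h : HasWinding f n) :
    HasWinding (fun θ => (starRingEnd ℂ) (f θ)) (-n) := by
  obtain ⟨g, hg, hfg, hn⟩ := h
  refine ⟨fun θ => (starRingEnd ℂ) (g θ), Complex.continuous_conj.comp_continuousOn hg,
    fun θ hθ => ?_, ?_⟩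
  · simp only [Complex.exp_conj, hfg θ hθ]
  · simp only [hn, map_add, map_mul, Complex.conj_I, Complex.conj_ofReal, map_intCast, map_ofNat]
    push_cast
    ring

/-! ### Real linear maps of the plane and winding numbers -/

/-- The plane as the complex plane. -/
def toC : Plane →L[ℝ] ℂ :=
  (Complex.ofRealCLM.comp (EuclideanSpace.proj (0 : Fin 2))) +
    Complex.I • (Complex.ofRealCLM.comp (EuclideanSpace.proj (1 : Fin 2)))

theorem toC_apply (v : Plane) : toC v = (v 0 : ℂ) + Complex.I * (v 1 : ℂ) := by
  simp [toC]

theorem toC_re (v : Plane) : (toC v).re = v 0 := by simp [toC_apply]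

theorem toC_im (v : Plane) : (toC v).im = v 1 := by simp [toC_apply]

theorem norm_toC (v : Plane) : ‖toC v‖ = ‖v‖ := by
  rw [EuclideanSpace.norm_eq, Complex.norm_def, Complex.normSq_apply, toC_re, toC_im,
    Fin.sum_univ_two]
  simp [sq]

/-- The determinant of a pair of vectors of the plane. -/
def det₂ (v w : Plane) : ℝ := v 0 * w 1 - v 1 * w 0

/-- Real linear combinations of the coordinates of `z` with coefficients `v`, `w` in complex form. -/
theorem toC_smul_add_smul (v w : Plane) (z : ℂ) :
    toC (z.re • v + z.im • w) = ((toC v - Complex.I * toC w) / 2) * z +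
      ((toC v + Complex.I * toC w) / 2) * (starRingEnd ℂ) z := by
  rw [map_add, map_smul, map_smul, toC_apply, toC_apply]
  apply Complex.ext <;> simp <;> ring

/-- For a real linear map z ↦ A z + B z̄ the determinant is |A|² − |B|². Its sign tells which of the
two terms dominates. -/
theorem normSq_sub_normSq (v w : Plane) :
    Complex.normSq ((toC v - Complex.I * toC w) / 2) -
      Complex.normSq ((toC v + Complex.I * toC w) / 2) = det₂ v w := by
  simp only [det₂, map_div₀, Complex.normSq_apply, Complex.sub_re, Complex.sub_im, Complex.add_re,
    Complex.add_im, Complex.mul_re, Complex.mul_im, Complex.I_re, Complex.I_im, toC_re, toC_im]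
  norm_num
  ring

/-- The image curve is A f + B f̄. For positive determinant A f dominates and winds n times; for
negative determinant B f̄ dominates and winds −n times. -/
theorem HasWinding.linear_comb {f : ℝ → ℂ} {n : ℤ} (h : HasWinding f n) {v w : Plane}
    (hd : det₂ v w ≠ 0) :
    HasWinding (fun θ => toC ((f θ).re • v + (f θ).im • w)) (SignType.sign (det₂ v w) * n) := by
  have hfc : ContinuousOn f (Set.Icc 0 (2 * Real.pi)) := by
    obtain ⟨g, hg, hfg, -⟩ := h
    exact (Complex.continuous_exp.comp_continuousOn hg).congr hfg
  have hf0 : ∀ θ ∈ Set.Icc 0 (2 * Real.pi), 0 < ‖f θ‖ := by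
    obtain ⟨g, hg, hfg, -⟩ := h
    intro θ hθ
    rw [hfg θ hθ]; exact norm_pos_iff.2 (Complex.exp_ne_zero _)
  have hper : f (2 * Real.pi) = f 0 := by
    obtain ⟨g, hg, hfg, hn⟩ := h
    rw [hfg _ two_pi_mem_Icc_two_pi, hfg _ zero_mem_Icc_two_pi, hn, Complex.exp_add,
        Complex.exp_int_mul_two_pi_mul_I, mul_one]
  have hsum := normSq_sub_normSq v w
  simp only [toC_smul_add_smul]
  set A := (toC v - Complex.I * toC w) / 2
  set B := (toC v + Complex.I * toC w) / 2
  have hcont : ContinuousOn (fun θ => A * f θ + B * (starRingEnd ℂ) (f θ))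
      (Set.Icc 0 (2 * Real.pi)) :=
    (continuousOn_const.mul hfc).add
      (continuousOn_const.mul (Complex.continuous_conj.comp_continuousOn hfc))
  rw [Complex.normSq_eq_norm_sq, Complex.normSq_eq_norm_sq] at hsum
  rcases lt_or_gt_of_ne hd with hd | hd
  · have hAB : ‖A‖ < ‖B‖ := by
      apply lt_of_pow_lt_pow_left₀ 2 (norm_nonneg _); linarith
    have hB : B ≠ 0 := norm_pos_iff.1 ((norm_nonneg _).trans_lt hAB)
    rw [sign_neg hd]
    refine HasWinding.of_norm_sub_lt (f := fun θ => B * (starRingEnd ℂ) (f θ)) ?_ hcont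
      (by simp only [hper]) fun θ hθ => ?_
    · simpa using h.conj.const_mul hB
    · simp only [add_sub_cancel_right, norm_mul, RCLike.norm_conj]
      exact mul_lt_mul_of_pos_right hAB (hf0 θ hθ)
  · have hAB : ‖B‖ < ‖A‖ := by
      apply lt_of_pow_lt_pow_left₀ 2 (norm_nonneg _); linarith
    have hA : A ≠ 0 := norm_pos_iff.1 ((norm_nonneg _).trans_lt hAB)
    rw [sign_pos hd]
    refine HasWinding.of_norm_sub_lt (f := fun θ => A * f θ) ?_ hcont
      (by simp only [hper]) fun θ hθ => ?_
    · simpa using h.const_mul hA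
    · simp only [add_sub_cancel_left, norm_mul, RCLike.norm_conj]
      exact mul_lt_mul_of_pos_right hAB (hf0 θ hθ)

/-! ### Determinants and orientations -/

/-- The standard basis of the plane. -/
def stdVec (i : Fin 2) : Plane := EuclideanSpace.basisFun (Fin 2) ℝ i

theorem plane_eq_smul_add (v : Plane) : v = v 0 • stdVec 0 + v 1 • stdVec 1 := by
  ext i
  fin_cases i <;> simp [stdVec]

theorem det₂_map (D : Plane →L[ℝ] Plane) (v w : Plane) :
    det₂ (D v) (D w) = det₂ (D (stdVec 0)) (D (stdVec 1)) * det₂ v w := by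
  conv_lhs => rw [plane_eq_smul_add v, plane_eq_smul_add w]
  simp only [map_add, map_smul, det₂, PiLp.add_apply, PiLp.smul_apply, smul_eq_mul]
  ring

theorem det₂_stdVec : det₂ (stdVec 0) (stdVec 1) = 1 := by
  simp [det₂, stdVec]

theorem det₂_swap (v w : Plane) : det₂ w v = -det₂ v w := by
  simp only [det₂]; ring

theorem det₂_smul_smul (r s : ℝ) (v w : Plane) : det₂ (r • v) (s • w) = r * s * det₂ v w := by
  simp only [det₂, PiLp.smul_apply, smul_eq_mul]; ring

/-- The two determinants multiply to 1. -/
theorem sign_det₂_of_leftInverse {D D' : Plane →L[ℝ] Plane} (h : ∀ v, D' (D v) = v) :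
    SignType.sign (det₂ (D' (stdVec 0)) (D' (stdVec 1))) =
      SignType.sign (det₂ (D (stdVec 0)) (D (stdVec 1))) := by
  have h1 := det₂_map D' (D (stdVec 0)) (D (stdVec 1))
  rw [h, h, det₂_stdVec] at h1
  rcases lt_trichotomy (det₂ (D (stdVec 0)) (D (stdVec 1))) 0 with h2 | h2 | h2
  · rw [sign_neg h2, sign_neg]; by_contra h3; nlinarith
  · rw [h2] at h1; simp at h1
  · rw [sign_pos h2, sign_pos]; by_contra h3; nlinarith

theorem stdBasis_det (b : Fin 2 → Plane) :
    (EuclideanSpace.basisFun (Fin 2) ℝ).toBasis.det b = det₂ (b 0) (b 1) := by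
  rw [Module.Basis.det_apply, Matrix.det_fin_two]
  simp [Module.Basis.toMatrix_apply, det₂]
  ring

theorem det₂_ne_zero {v w : Plane} (h : LinearIndependent ℝ ![v, w]) : det₂ v w ≠ 0 := by
  intro hd
  rw [LinearIndependent.pair_iff] at h
  simp only [det₂] at hd
  -- If the determinant vanishes, so do w₁v − v₁w and w₀v − v₀w. Independence then makes all four
  -- coordinates zero.
  have h1 := h (w 1) (-v 1) (by
    ext i; fin_cases i <;> simp <;> linarith)
  have h2 := h (w 0) (-v 0) (by
    ext i; fin_cases i <;> simp <;> linarith)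
  have h3 := h 1 0 (by
    ext i; fin_cases i <;> simp <;> linarith)
  exact one_ne_zero h3.1

variable {M : Type*} [TopologicalSpace M] [ChartedSpace (EuclideanHalfSpace 2) M]
  [IsManifold (𝓡∂ 2) ∞ M]

open Classical in
/-- `1` if the coordinate frame of the preferred chart at `x` is positive at `x`, `-1` otherwise. -/
def SurfaceOrientation.frameSign (o : SurfaceOrientation M) (x : M) : ℤ :=
  if (EuclideanSpace.basisFun (Fin 2) ℝ).toBasis.orientation = o.orient x then 1 else -1

theorem SurfaceOrientation.frameSign_eq (o : SurfaceOrientation M) (x : M) :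
    o.frameSign x = 1 ∨ o.frameSign x = -1 := by
  unfold frameSign; split_ifs <;> simp

/-- A plane has only two orientations. A basis therefore represents the orientation at x precisely
when its determinant in the coordinate frame has the sign which compares that frame with the
orientation. -/
theorem SurfaceOrientation.isPositive_iff (o : SurfaceOrientation M) (x : M) (v w : Plane) :
    o.IsPositive x v w ↔ 0 < o.frameSign x * det₂ v w := by
  have hdet : ∀ b : Module.Basis (Fin 2) ℝ Plane, b 0 = v → b 1 = w →
      (EuclideanSpace.basisFun (Fin 2) ℝ).toBasis.det b = det₂ v w := by
    intro b h0 h1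
    rw [stdBasis_det, h0, h1]
  have hne : ∀ b : Module.Basis (Fin 2) ℝ Plane, b 0 = v → b 1 = w → det₂ v w ≠ 0 := by
    intro b h0 h1
    rw [← hdet b h0 h1]
    exact ((EuclideanSpace.basisFun (Fin 2) ℝ).toBasis.isUnit_det b).ne_zero
  have hex : det₂ v w ≠ 0 → ∃ b : Module.Basis (Fin 2) ℝ Plane, b 0 = v ∧ b 1 = w := by
    intro h
    have := (Module.Basis.is_basis_iff_det (EuclideanSpace.basisFun (Fin 2) ℝ).toBasis (v := ![v, w])).2 (by
      rw [stdBasis_det]; simpa using h)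
    exact ⟨Module.Basis.mk this.1 this.2.ge, by simp, by simp⟩
  constructor
  · rintro ⟨b, h0, h1, hb⟩
    have h2 := (EuclideanSpace.basisFun (Fin 2) ℝ).toBasis.orientation_eq_iff_det_pos b
    have h3 := hdet b h0 h1
    rw [h3] at h2
    have h4 := hne b h0 h1
    unfold frameSign
    split_ifs with h
    · have := h2.1 (h.trans hb.symm)
      simpa using this
    · have : ¬ 0 < det₂ v w := fun h5 => h ((h2.2 h5).trans hb)
      have := lt_of_le_of_ne (not_lt.1 this) h4
      push_cast; linarith
  · intro hpos
    have hd : det₂ v w ≠ 0 := by rintro h; rw [h] at hpos; simp at hpos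
    obtain ⟨b, h0, h1⟩ := hex hd
    refine ⟨b, h0, h1, ?_⟩
    have h2 := (EuclideanSpace.basisFun (Fin 2) ℝ).toBasis.orientation_eq_iff_det_pos b
    rw [hdet b h0 h1] at h2
    unfold frameSign at hpos
    split_ifs at hpos with h
    · rw [← h]; exact (h2.2 (by simpa using hpos)).symm
    · have h3 : ¬ 0 < det₂ v w := by push_cast at hpos; linarith
      have h4 := fun h5 => h3 (h2.1 h5)
      rcases b.orientation_eq_or_eq_neg (o.orient x) with h5 | h5
      · exact h5.symm
      · rcases b.orientation_eq_or_eq_neg (EuclideanSpace.basisFun (Fin 2) ℝ).toBasis.orientation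
          with h6 | h6
        · exact absurd h6 h4
        · exact absurd (h6.trans h5.symm) h

theorem SurfaceOrientation.IsPositive.smul_iff (o : SurfaceOrientation M) (x : M) (v w : Plane)
    {r s : ℝ} (hr : 0 < r) (hs : 0 < s) :
    o.IsPositive x (r • v) (s • w) ↔ o.IsPositive x v w := by
  rw [o.isPositive_iff, o.isPositive_iff, det₂_smul_smul]
  have : 0 < r * s := mul_pos hr hs
  rw [show (o.frameSign x : ℝ) * (r * s * det₂ v w) = r * s * (o.frameSign x * det₂ v w) by ring]
  exact mul_pos_iff_of_pos_left this

/-- Local constancy is applied to the coordinate frame at x in both orders. One order is positive at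
x and the other is not, so the sign of the Jacobian is determined by the two frame signs. -/
theorem SurfaceOrientation.eventually_sign_det (o : SurfaceOrientation M) (x : M) :
    ∀ᶠ y in nhds x, ((SignType.sign (det₂ (tangentCoordChange (𝓡∂ 2) x y y (stdVec 0))
      (tangentCoordChange (𝓡∂ 2) x y y (stdVec 1))) : SignType) : ℤ) =
        o.frameSign x * o.frameSign y := by
  filter_upwards [o.locally_constant x] with y hy
  have h1 := hy (stdVec 0) (stdVec 1)
  have h2 := hy (stdVec 1) (stdVec 0)
  change o.IsPositive y _ _ ↔ o.IsPositive x _ _ at h1 h2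
  rw [o.isPositive_iff, o.isPositive_iff] at h1 h2
  rw [det₂_swap (stdVec 0), det₂_stdVec,
    det₂_swap (tangentCoordChange (𝓡∂ 2) x y y (stdVec 0))] at h2
  rw [det₂_stdVec] at h1
  rcases o.frameSign_eq x with hx | hx <;> rcases o.frameSign_eq y with hy | hy <;>
    rw [hx, hy] at h1 h2 ⊢ <;> norm_num at h1 h2 ⊢
  · rw [sign_pos h1]; rfl
  · rw [sign_neg h1]; rfl
  · rw [sign_neg h2]; rfl
  · rw [sign_pos h2]; rfl

/-! ### The local index of a pair of paths -/

section LocalIndex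

variable {M : Type*} [TopologicalSpace M] [ChartedSpace (EuclideanHalfSpace 2) M]

/-- Changes of charts are strictly differentiable. -/
theorem eventually_coordChange_sub_le [IsManifold (𝓡∂ 2) ∞ M] {x y z : M}
    (hz : z ∈ (extChartAt (𝓡∂ 2) x).source ∩ (extChartAt (𝓡∂ 2) y).source) {c : ℝ} (hc : 0 < c) :
    ∃ U ∈ nhds z, ∀ q ∈ U, ∀ q' ∈ U, ‖extChartAt (𝓡∂ 2) y q - extChartAt (𝓡∂ 2) y q' -
      tangentCoordChange (𝓡∂ 2) x y z (extChartAt (𝓡∂ 2) x q - extChartAt (𝓡∂ 2) x q')‖ ≤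
        c * ‖extChartAt (𝓡∂ 2) x q - extChartAt (𝓡∂ 2) x q'‖ := by
  set φ := extChartAt (𝓡∂ 2) x
  set ψ := extChartAt (𝓡∂ 2) y
  set D := tangentCoordChange (𝓡∂ 2) x y
  have hsrc : φ.source ∩ ψ.source ∈ nhds z :=
    ((isOpen_extChartAt_source x).inter (isOpen_extChartAt_source y)).mem_nhds hz
  have hV : {q | ‖D q - D z‖ ≤ c} ∩ (φ.source ∩ ψ.source) ∈ nhds z := by
    refine Filter.inter_mem ?_ hsrc
    have h1 : ContinuousAt D z := (continuousOn_tangentCoordChange x y).continuousAt hsrc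
    have h2 : Filter.Tendsto (fun q => ‖D q - D z‖) (nhds z) (nhds 0) := by
      have := (h1.sub (continuousAt_const (y := D z))).norm
      simpa [ContinuousAt] using this
    exact (h2.eventually_lt_const hc).mono fun q hq => hq.le
  have hsymm : φ.symm ⁻¹' ({q | ‖D q - D z‖ ≤ c} ∩ (φ.source ∩ ψ.source)) ∈
      nhdsWithin (φ z) (Set.range (𝓡∂ 2)) := by
    refine mem_nhdsWithin_of_mem_nhds ((continuousAt_extChartAt_symm' hz.1).preimage_mem_nhds ?_)
    rw [(extChartAt (𝓡∂ 2) x).left_inv hz.1]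
    exact hV
  have htarget : φ.target ∈ nhdsWithin (φ z) (Set.range (𝓡∂ 2)) :=
    extChartAt_target_mem_nhdsWithin' hz.1
  obtain ⟨ρ, hρ, hball⟩ := Metric.mem_nhdsWithin_iff.1 (Filter.inter_mem hsymm htarget)
  refine ⟨φ.source ∩ φ ⁻¹' Metric.ball (φ z) ρ, Filter.inter_mem
    ((isOpen_extChartAt_source x).mem_nhds hz.1) ((continuousAt_extChartAt' hz.1).preimage_mem_nhds
      (Metric.ball_mem_nhds _ hρ)), ?_⟩
  rintro q ⟨hq1, hq2⟩ q' ⟨hq1', hq2'⟩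
  have hrange : ∀ q ∈ φ.source, φ q ∈ Set.range (𝓡∂ 2) := fun q hq =>
    extChartAt_target_subset_range (I := 𝓡∂ 2) x (φ.map_source hq)
  -- A ball intersected with the range of the model is convex. The mean value inequality within it
  -- covers boundary points of the surface as well.
  have hconv : Convex ℝ (Metric.ball (φ z) ρ ∩ Set.range (𝓡∂ 2)) :=
    (convex_ball _ _).inter (𝓡∂ 2).convex_range
  have key := hconv.norm_image_sub_le_of_norm_hasFDerivWithin_le' (f := ψ ∘ φ.symm)
    (f' := fun u => D (φ.symm u)) (φ := D z) (C := c) ?_ ?_ ⟨hq2', hrange q' hq1'⟩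
    ⟨hq2, hrange q hq1⟩
  · simpa only [Function.comp, φ.left_inv hq1, φ.left_inv hq1'] using key
  · intro u hu
    obtain ⟨⟨hu1, hu2⟩, hu3⟩ := hball hu
    have := hasFDerivWithinAt_tangentCoordChange (I := 𝓡∂ 2) (x := x) (y := y) (z := φ.symm u) hu2
    rw [φ.right_inv hu3] at this
    exact this.mono Set.inter_subset_right
  · intro u hu
    exact (hball hu).1.1

/-- The closed curve `θ ↦ φ (A (r cos θ)) - φ (B (r sin θ))`, with `φ` the chart at `x`. -/
def differenceCurve (x : M) (A B : ℝ → M) (r θ : ℝ) : ℂ :=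
  toC (extChartAt (𝓡∂ 2) x (A (r * Real.cos θ)) - extChartAt (𝓡∂ 2) x (B (r * Real.sin θ)))

theorem differenceCurve_two_pi (x : M) (A B : ℝ → M) (r : ℝ) :
    differenceCurve x A B r (2 * Real.pi) = differenceCurve x A B r 0 := by
  simp [differenceCurve]

/-- The paths `A` and `B` meet only at time `0`, as far as times smaller than `δ` are concerned. -/
def MeetOnlyAtZero (A B : ℝ → M) (δ : ℝ) : Prop :=
  ∀ s t, |s| < δ → |t| < δ → A s = B t → s = 0 ∧ t = 0

theorem abs_mul_cos_lt {r δ : ℝ} (hr : 0 < r) (hδ : r < δ) (θ : ℝ) : |r * Real.cos θ| < δ := by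
  rw [abs_mul, abs_of_pos hr]
  nlinarith [Real.abs_cos_le_one θ, abs_nonneg (Real.cos θ)]

theorem abs_mul_sin_lt {r δ : ℝ} (hr : 0 < r) (hδ : r < δ) (θ : ℝ) : |r * Real.sin θ| < δ := by
  rw [abs_mul, abs_of_pos hr]
  nlinarith [Real.abs_sin_le_one θ, abs_nonneg (Real.sin θ)]

theorem MeetOnlyAtZero.ne {X : Type*} {A B : ℝ → X} {δ : ℝ} (h : MeetOnlyAtZero A B δ) {r : ℝ} (hr : 0 < r)
    (hδ : r < δ) (θ : ℝ) : A (r * Real.cos θ) ≠ B (r * Real.sin θ) := by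
  intro heq
  obtain ⟨h1, h2⟩ := h _ _ (abs_mul_cos_lt hr hδ θ) (abs_mul_sin_lt hr hδ θ) heq
  have := Real.cos_sq_add_sin_sq θ
  rw [(mul_eq_zero.1 h1).resolve_left hr.ne', (mul_eq_zero.1 h2).resolve_left hr.ne'] at this
  norm_num at this

theorem chart_sub_ne_zero {x p q : M} (hp : p ∈ (extChartAt (𝓡∂ 2) x).source)
    (hq : q ∈ (extChartAt (𝓡∂ 2) x).source) (hpq : p ≠ q) :
    extChartAt (𝓡∂ 2) x p - extChartAt (𝓡∂ 2) x q ≠ 0 := fun h =>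
  hpq ((extChartAt (𝓡∂ 2) x).injOn hp hq (sub_eq_zero.1 h))

theorem continuousOn_differenceCurve {x : M} {A B : ℝ → M} (hA : Continuous A) (hB : Continuous B)
    {r δ : ℝ} (hr : 0 < r) (hδ : r < δ)
    (hs : ∀ s, |s| < δ → A s ∈ (extChartAt (𝓡∂ 2) x).source ∧ B s ∈ (extChartAt (𝓡∂ 2) x).source)
    (S : Set ℝ) : ContinuousOn (differenceCurve x A B r) S := by
  have c1 : Continuous fun θ => extChartAt (𝓡∂ 2) x (A (r * Real.cos θ)) :=
    (continuousOn_extChartAt x).comp_continuous (by fun_prop)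
      fun θ => (hs _ (abs_mul_cos_lt hr hδ θ)).1
  have c2 : Continuous fun θ => extChartAt (𝓡∂ 2) x (B (r * Real.sin θ)) :=
    (continuousOn_extChartAt x).comp_continuous (by fun_prop)
      fun θ => (hs _ (abs_mul_sin_lt hr hδ θ)).2
  exact (toC.continuous.comp (c1.sub c2)).continuousOn

theorem exists_sources {X : Type*} [TopologicalSpace X] {A B : ℝ → X} (hA : Continuous A) (hB : Continuous B) (hAB : A 0 = B 0)
    {U : Set X} (hU : U ∈ nhds (A 0)) : ∃ δ > 0, ∀ s, |s| < δ → A s ∈ U ∧ B s ∈ U := by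
  have h1 := hA.continuousAt.preimage_mem_nhds hU
  have h2 := hB.continuousAt.preimage_mem_nhds (hAB ▸ hU)
  obtain ⟨δ, hδ, h⟩ := Metric.mem_nhds_iff.1 (Filter.inter_mem h1 h2)
  exact ⟨δ, hδ, fun s hs => h (by simpa using hs)⟩

/-- The effect of a change of charts on the winding number of `differenceCurve`. -/
theorem HasWinding.change_chart [IsManifold (𝓡∂ 2) ∞ M] {x y : M} {A B : ℝ → M}
    (hA : Continuous A) (hB : Continuous B) (hAB : A 0 = B 0) {δ : ℝ} (hδ : 0 < δ)
    (hmeet : MeetOnlyAtZero A B δ)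
    (hz : A 0 ∈ (extChartAt (𝓡∂ 2) x).source ∩ (extChartAt (𝓡∂ 2) y).source) :
    ∃ ε > 0, ∀ r, 0 < r → r < ε → ∀ n, HasWinding (differenceCurve x A B r) n →
      HasWinding (differenceCurve y A B r) ((SignType.sign
        (det₂ (tangentCoordChange (𝓡∂ 2) x y (A 0) (stdVec 0))
          (tangentCoordChange (𝓡∂ 2) x y (A 0) (stdVec 1))) : SignType) * n) := by
  set D := tangentCoordChange (𝓡∂ 2) x y (A 0)
  set D' := tangentCoordChange (𝓡∂ 2) y x (A 0)
  have hinv : ∀ v, D' (D v) = v := fun v => by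
    rw [tangentCoordChange_comp ⟨⟨hz.1, hz.2⟩, hz.1⟩, tangentCoordChange_self hz.1]
  have hdet : det₂ (D (stdVec 0)) (D (stdVec 1)) ≠ 0 := fun h => by
    have h1 := det₂_map D' (D (stdVec 0)) (D (stdVec 1))
    rw [hinv, hinv, det₂_stdVec, h] at h1
    simp at h1
  have hK : 0 < ‖D'‖ + 1 := by positivity
  have hlow : ∀ v, ‖v‖ ≤ (‖D'‖ + 1) * ‖D v‖ := fun v => by
    calc ‖v‖ = ‖D' (D v)‖ := by rw [hinv]
      _ ≤ ‖D'‖ * ‖D v‖ := D'.le_opNorm _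
      _ ≤ _ := by nlinarith [norm_nonneg (D v)]
  -- With this constant the error of the linear approximation is at most ‖D w‖/2, because ‖w‖ ≤
  -- (‖D'‖ + 1)‖D w‖. The added 1 only keeps the constant positive.
  have hc : 0 < (2 * (‖D'‖ + 1))⁻¹ := by positivity
  obtain ⟨U, hU, hstrict⟩ := eventually_coordChange_sub_le hz hc
  have hsrc : (extChartAt (𝓡∂ 2) x).source ∩ (extChartAt (𝓡∂ 2) y).source ∈ nhds (A 0) :=
    ((isOpen_extChartAt_source x).inter (isOpen_extChartAt_source y)).mem_nhds hz
  obtain ⟨ε, hε, hs⟩ := exists_sources hA hB hAB (Filter.inter_mem hU hsrc)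
  refine ⟨min ε δ, lt_min hε hδ, fun r hr hrlt n hn => ?_⟩
  have hrε : r < ε := hrlt.trans_le (min_le_left _ _)
  have hrδ : r < δ := hrlt.trans_le (min_le_right _ _)
  refine (hn.linear_comb hdet).of_norm_sub_lt
    (continuousOn_differenceCurve hA hB hr hrε (fun s hs' => ⟨(hs s hs').1.2.2, (hs s hs').2.2.2⟩) _)
    (differenceCurve_two_pi _ _ _ _) fun θ _ => ?_
  have h1 := hs _ (abs_mul_cos_lt hr hrε θ)
  have h2 := hs _ (abs_mul_sin_lt hr hrε θ)
  have h3 := chart_sub_ne_zero h1.1.2.1 h2.2.2.1 (hmeet.ne hr hrδ θ)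
  have h4 := hstrict _ h1.1.1 _ h2.2.1
  simp only [differenceCurve, toC_re, toC_im]
  set w := extChartAt (𝓡∂ 2) x (A (r * Real.cos θ)) - extChartAt (𝓡∂ 2) x (B (r * Real.sin θ))
  rw [show w 0 • D (stdVec 0) + w 1 • D (stdVec 1) = D w by
    conv_rhs => rw [plane_eq_smul_add w]
    rw [map_add, map_smul, map_smul], ← map_sub, norm_toC, norm_toC]
  have h5 := hlow w
  have h6 : 0 < ‖w‖ := norm_pos_iff.2 h3
  refine h4.trans_lt ?_
  rw [inv_mul_lt_iff₀ (by positivity)]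
  nlinarith

/-- The winding number of `differenceCurve` for a family of pairs of paths does not depend on the
parameter and on the radius. -/
theorem HasWinding.family {A B : ℝ → ℝ → M} (hA : Continuous (Function.uncurry A))
    (hB : Continuous (Function.uncurry B)) (hAB : ∀ τ, A τ 0 = B τ 0) {δ : ℝ} (hδ : 0 < δ)
    (hmeet : ∀ τ, MeetOnlyAtZero (A τ) (B τ) δ) {x : M} {τ₀ : ℝ}
    (hx : A τ₀ 0 ∈ (extChartAt (𝓡∂ 2) x).source) :
    ∃ ε > 0, ∀ τ τ' r r', |τ - τ₀| < ε → |τ' - τ₀| < ε → 0 < r → r < ε → 0 < r' → r' < ε →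
      ∀ n, HasWinding (differenceCurve x (A τ) (B τ) r) n →
        HasWinding (differenceCurve x (A τ') (B τ') r') n := by
  have h1 : Function.uncurry A ⁻¹' (extChartAt (𝓡∂ 2) x).source ∩
      Function.uncurry B ⁻¹' (extChartAt (𝓡∂ 2) x).source ∈ nhds (τ₀, (0 : ℝ)) := by
    refine (((isOpen_extChartAt_source x).preimage hA).inter
      ((isOpen_extChartAt_source x).preimage hB)).mem_nhds ⟨hx, ?_⟩
    change B τ₀ 0 ∈ (extChartAt (𝓡∂ 2) x).source
    rw [← hAB]; exact hx
  obtain ⟨ε, hε, hball⟩ := Metric.mem_nhds_iff.1 h1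
  have hs : ∀ τ s, |τ - τ₀| < ε → |s| < ε → A τ s ∈ (extChartAt (𝓡∂ 2) x).source ∧
      B τ s ∈ (extChartAt (𝓡∂ 2) x).source := fun τ s h2 h3 => by
    have : (τ, s) ∈ Metric.ball (τ₀, (0 : ℝ)) ε := by
      rw [Metric.mem_ball, Prod.dist_eq]
      simpa [Real.dist_eq] using ⟨h2, h3⟩
    exact hball this
  refine ⟨min ε δ, lt_min hε hδ, fun τ τ' r r' hτ hτ' hr hrε hr' hrε' n hn => ?_⟩
  -- The pair (τ, r) runs through a product of two intervals, so moving the parameter and shrinking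
  -- the radius form a single homotopy.
  have : PreconnectedSpace (Set.Ioo (τ₀ - ε) (τ₀ + ε)) :=
    Subtype.preconnectedSpace isPreconnected_Ioo
  have : PreconnectedSpace (Set.Ioo (0 : ℝ) (min ε δ)) :=
    Subtype.preconnectedSpace isPreconnected_Ioo
  let G : (Set.Ioo (τ₀ - ε) (τ₀ + ε) × Set.Ioo (0 : ℝ) (min ε δ)) → ℝ → ℂ := fun p θ => differenceCurve x (A p.1) (B p.1) p.2 θ
  have hmem : ∀ p : (Set.Ioo (τ₀ - ε) (τ₀ + ε) × Set.Ioo (0 : ℝ) (min ε δ)), |(p.1 : ℝ) - τ₀| < ε := fun p => by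
    have := p.1.2; rw [abs_lt]; constructor <;> linarith [this.1, this.2]
  have hr1 : ∀ p : (Set.Ioo (τ₀ - ε) (τ₀ + ε) × Set.Ioo (0 : ℝ) (min ε δ)), (p.2 : ℝ) < ε := fun p => p.2.2.2.trans_le (min_le_left _ _)
  have hr2 : ∀ p : (Set.Ioo (τ₀ - ε) (τ₀ + ε) × Set.Ioo (0 : ℝ) (min ε δ)), (p.2 : ℝ) < δ := fun p => p.2.2.2.trans_le (min_le_right _ _)
  have hG : Continuous (Function.uncurry G) := by
    have c1 : Continuous fun q : (Set.Ioo (τ₀ - ε) (τ₀ + ε) × Set.Ioo (0 : ℝ) (min ε δ)) × ℝ =>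
        extChartAt (𝓡∂ 2) x (A q.1.1 (q.1.2 * Real.cos q.2)) :=
      (continuousOn_extChartAt x).comp_continuous
        (hA.comp (f := fun q : (Set.Ioo (τ₀ - ε) (τ₀ + ε) × Set.Ioo (0 : ℝ) (min ε δ)) × ℝ => ((q.1.1 : ℝ), (q.1.2 : ℝ) * Real.cos q.2)) (by fun_prop))
        fun q => (hs _ _ (hmem q.1) (abs_mul_cos_lt q.1.2.2.1 (hr1 q.1) q.2)).1
    have c2 : Continuous fun q : (Set.Ioo (τ₀ - ε) (τ₀ + ε) × Set.Ioo (0 : ℝ) (min ε δ)) × ℝ =>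
        extChartAt (𝓡∂ 2) x (B q.1.1 (q.1.2 * Real.sin q.2)) :=
      (continuousOn_extChartAt x).comp_continuous
        (hB.comp (f := fun q : (Set.Ioo (τ₀ - ε) (τ₀ + ε) × Set.Ioo (0 : ℝ) (min ε δ)) × ℝ => ((q.1.1 : ℝ), (q.1.2 : ℝ) * Real.sin q.2)) (by fun_prop))
        fun q => (hs _ _ (hmem q.1) (abs_mul_sin_lt q.1.2.2.1 (hr1 q.1) q.2)).2
    exact toC.continuous.comp (c1.sub c2)
  have hG0 : ∀ p θ, G p θ ≠ 0 := fun p θ => by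
    have h3 := chart_sub_ne_zero (hs _ _ (hmem p) (abs_mul_cos_lt p.2.2.1 (hr1 p) θ)).1
      (hs _ _ (hmem p) (abs_mul_sin_lt p.2.2.1 (hr1 p) θ)).2 ((hmeet p.1).ne p.2.2.1 (hr2 p) θ)
    rw [← norm_pos_iff]
    simp only [G, differenceCurve]
    rw [norm_toC]
    exact norm_pos_iff.2 h3
  have e1 : τ ∈ Set.Ioo (τ₀ - ε) (τ₀ + ε) := by
    have := abs_lt.1 (hτ.trans_le (min_le_left _ _)); constructor <;> linarith [this.1, this.2]
  have e2 : τ' ∈ Set.Ioo (τ₀ - ε) (τ₀ + ε) := by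
    have := abs_lt.1 (hτ'.trans_le (min_le_left _ _)); constructor <;> linarith [this.1, this.2]
  exact HasWinding.homotopy (p := ((⟨τ, e1⟩, ⟨r, hr, hrε⟩) : Set.Ioo (τ₀ - ε) (τ₀ + ε) × Set.Ioo (0 : ℝ) (min ε δ))) hG hG0
    (fun p => differenceCurve_two_pi _ _ _ _) hn (⟨τ', e2⟩, ⟨r', hr', hrε'⟩)

/-- The ellipse θ ↦ cos θ v − sin θ w misses the origin by linear independence. Compactness of one
period provides a positive distance. -/
theorem exists_pos_le_norm_comb {v w : Plane} (h : det₂ v w ≠ 0) :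
    ∃ k > 0, ∀ θ, k ≤ ‖Real.cos θ • v - Real.sin θ • w‖ := by
  have hc : Continuous fun θ : ℝ => ‖Real.cos θ • v - Real.sin θ • w‖ := by fun_prop
  obtain ⟨θ₀, -, hmin⟩ := isCompact_Icc.exists_isMinOn ⟨0, zero_mem_Icc_two_pi⟩ hc.continuousOn
  refine ⟨‖Real.cos θ₀ • v - Real.sin θ₀ • w‖, norm_pos_iff.2 fun h0 => ?_, fun θ => ?_⟩
  · have h1 := congrFun (congrArg WithLp.ofLp h0) 0
    have h2 := congrFun (congrArg WithLp.ofLp h0) 1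
    simp at h1 h2
    have h3 : Real.cos θ₀ * det₂ v w = 0 := by
      simp only [det₂]; linear_combination w 1 * h1 - w 0 * h2
    have h4 : Real.sin θ₀ * det₂ v w = 0 := by
      simp only [det₂]; linear_combination v 1 * h1 - v 0 * h2
    have := Real.cos_sq_add_sin_sq θ₀
    rw [(mul_eq_zero.1 h3).resolve_right h, (mul_eq_zero.1 h4).resolve_right h] at this
    norm_num at this
  · have hper : Function.Periodic (fun θ : ℝ => ‖Real.cos θ • v - Real.sin θ • w‖)
      (2 * Real.pi) := fun θ => by simp
    obtain ⟨y, hy, hy'⟩ := hper.exists_mem_Ico₀ Real.two_pi_pos θ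
    rw [hy']
    exact hmin ⟨hy.1, hy.2.le⟩

/-- The winding number of `differenceCurve` for two transversal differentiable paths. -/
theorem hasWinding_differenceCurve {A B : ℝ → M} (hA : Continuous A) (hB : Continuous B)
    (hAB : A 0 = B 0) {v w : Plane} (hv : HasDerivAt (extChartAt (𝓡∂ 2) (A 0) ∘ A) v 0)
    (hw : HasDerivAt (extChartAt (𝓡∂ 2) (A 0) ∘ B) w 0) (hd : det₂ v w ≠ 0) :
    ∃ ε > 0, ∀ r, 0 < r → r < ε →
      HasWinding (differenceCurve (A 0) A B r) (-(SignType.sign (det₂ v w) : SignType)) := by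
  obtain ⟨k, hk, hlow⟩ := exists_pos_le_norm_comb hd
  obtain ⟨ε₁, hε₁, hs⟩ := exists_sources hA hB hAB (extChartAt_source_mem_nhds (I := 𝓡∂ 2) (A 0))
  -- Each branch deviates from its tangent by at most kr/4. Together the errors stay below kr, the
  -- lower bound for the linearized curve.
  have hv' := (hasDerivAt_iff_isLittleO_nhds_zero.1 hv).def (c := k / 4) (by positivity)
  have hw' := (hasDerivAt_iff_isLittleO_nhds_zero.1 hw).def (c := k / 4) (by positivity)
  obtain ⟨ε₂, hε₂, h2⟩ := Metric.eventually_nhds_iff.1 (hv'.and hw')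
  refine ⟨min ε₁ ε₂, lt_min hε₁ hε₂, fun r hr hrlt => ?_⟩
  have hr1 : r < ε₁ := hrlt.trans_le (min_le_left _ _)
  have hr2 : r < ε₂ := hrlt.trans_le (min_le_right _ _)
  -- The linearized curve is cos θ · rv + sin θ · (−rw), and the minus sign in front of w is
  -- responsible for the negative sign in the conclusion.
  have hdet : det₂ (r • v) ((-r) • w) ≠ 0 := by
    rw [det₂_smul_smul]; exact mul_ne_zero (by nlinarith) hd
  have hsign : SignType.sign (det₂ (r • v) ((-r) • w)) = -SignType.sign (det₂ v w) := by
    rw [det₂_smul_smul, sign_mul, show r * -r = -(r * r) by ring, Left.sign_neg,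
      sign_pos (mul_pos hr hr), neg_one_mul]
  have hlin := hasWinding_exp.linear_comb hdet
  rw [hsign, mul_one, SignType.coe_neg] at hlin
  refine hlin.of_norm_sub_lt (continuousOn_differenceCurve hA hB hr hr1 hs _)
    (differenceCurve_two_pi _ _ _ _) fun θ _ => ?_
  rw [Complex.exp_ofReal_mul_I_re, Complex.exp_ofReal_mul_I_im]
  have e1 := (h2 (y := r * Real.cos θ) (by simpa using abs_mul_cos_lt hr hr2 θ)).1
  have e2 := (h2 (y := r * Real.sin θ) (by simpa using abs_mul_sin_lt hr hr2 θ)).2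
  simp only [zero_add, Function.comp] at e1 e2
  rw [differenceCurve, ← map_sub, norm_toC, norm_toC]
  have e3 : ‖Real.cos θ • r • v + Real.sin θ • (-r) • w‖ =
      r * ‖Real.cos θ • v - Real.sin θ • w‖ := by
    rw [← Real.norm_of_nonneg hr.le, ← norm_smul, Real.norm_of_nonneg hr.le]
    congr 1
    module
  rw [e3]
  have e4 : extChartAt (𝓡∂ 2) (A 0) (A (r * Real.cos θ)) -
      extChartAt (𝓡∂ 2) (A 0) (B (r * Real.sin θ)) -
        (Real.cos θ • r • v + Real.sin θ • (-r) • w) =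
      (extChartAt (𝓡∂ 2) (A 0) (A (r * Real.cos θ)) - extChartAt (𝓡∂ 2) (A 0) (A 0) -
        (r * Real.cos θ) • v) - (extChartAt (𝓡∂ 2) (A 0) (B (r * Real.sin θ)) -
          extChartAt (𝓡∂ 2) (A 0) (B 0) - (r * Real.sin θ) • w) := by
    rw [hAB]; module
  rw [e4]
  have e5 : ‖r * Real.cos θ‖ ≤ r := by
    rw [norm_mul, Real.norm_of_nonneg hr.le]
    exact mul_le_of_le_one_right hr.le (Real.abs_cos_le_one θ)
  have e6 : ‖r * Real.sin θ‖ ≤ r := by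
    rw [norm_mul, Real.norm_of_nonneg hr.le]
    exact mul_le_of_le_one_right hr.le (Real.abs_sin_le_one θ)
  calc _ ≤ k / 4 * ‖r * Real.cos θ‖ + k / 4 * ‖r * Real.sin θ‖ :=
        (norm_sub_le _ _).trans (add_le_add e1 e2)
    _ ≤ k / 4 * r + k / 4 * r := by gcongr
    _ < r * k := by nlinarith [mul_pos hr hk]
    _ ≤ _ := by gcongr; exact hlow θ

/-- Homeomorphisms isotopic to the identity preserve the sign of a transversal intersection. -/
theorem isPositive_iff_of_isotopy [IsManifold (𝓡∂ 2) ∞ M] (o : SurfaceOrientation M)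
    {h : unitInterval → M ≃ₜ M} (hh : Continuous fun x : unitInterval × M => h x.1 x.2)
    {A B : ℝ → M} (hA : Continuous A) (hB : Continuous B) (hAB : A 0 = B 0) {δ : ℝ} (hδ : 0 < δ)
    (hmeet : MeetOnlyAtZero A B δ) {v w v' w' : Plane}
    (hv : HasDerivAt (extChartAt (𝓡∂ 2) (h 0 (A 0)) ∘ h 0 ∘ A) v 0)
    (hw : HasDerivAt (extChartAt (𝓡∂ 2) (h 0 (A 0)) ∘ h 0 ∘ B) w 0) (hd : det₂ v w ≠ 0)
    (hv' : HasDerivAt (extChartAt (𝓡∂ 2) (h 1 (A 0)) ∘ h 1 ∘ A) v' 0)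
    (hw' : HasDerivAt (extChartAt (𝓡∂ 2) (h 1 (A 0)) ∘ h 1 ∘ B) w' 0) (hd' : det₂ v' w' ≠ 0) :
    o.IsPositive (h 0 (A 0)) v w ↔ o.IsPositive (h 1 (A 0)) v' w' := by
  -- The isotopy is extended by constants to all real parameters, so that neighbourhoods of the end
  -- times need no special treatment.
  let k : ℝ → M ≃ₜ M := fun τ => h (Set.projIcc (0 : ℝ) 1 zero_le_one τ)
  have hk : Continuous fun x : ℝ × M => k x.1 x.2 :=
    hh.comp (f := fun x : ℝ × M => (Set.projIcc (0 : ℝ) 1 zero_le_one x.1, x.2))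
      ((continuous_projIcc.comp continuous_fst).prodMk continuous_snd)
  have hkA : Continuous (Function.uncurry fun τ s => k τ (A s)) :=
    hk.comp (f := fun q : ℝ × ℝ => (q.1, A q.2)) (by fun_prop)
  have hkB : Continuous (Function.uncurry fun τ s => k τ (B s)) :=
    hk.comp (f := fun q : ℝ × ℝ => (q.1, B q.2)) (by fun_prop)
  have hkmeet : ∀ τ, MeetOnlyAtZero (fun s => k τ (A s)) (fun s => k τ (B s)) δ :=
    fun τ s t hs ht hst => hmeet s t hs ht ((k τ).injective hst)
  have hkAB : ∀ τ, k τ (A 0) = k τ (B 0) := fun τ => by rw [hAB]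
  have hkcA : ∀ τ, Continuous fun s => k τ (A s) := fun τ => (k τ).continuous.comp hA
  have hkcB : ∀ τ, Continuous fun s => k τ (B s) := fun τ => (k τ).continuous.comp hB
  -- The chart follows the moving point. Correcting the winding number by the frame sign of that
  -- chart gives the quantity N to be kept constant.
  let Q : ℤ → ℝ → Prop := fun N τ => ∃ ε > 0, ∀ r, 0 < r → r < ε →
    HasWinding (differenceCurve (k τ (A 0)) (fun s => k τ (A s)) (fun s => k τ (B s)) r)
      (o.frameSign (k τ (A 0)) * N)
  -- Within one chart the winding number is constant by `HasWinding.family`. Passing to the chart at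
  -- the moved point multiplies it by the product of the two frame signs, which replaces one frame
  -- sign by the other in front of N.
  have hstep : ∀ N τ₀, ∀ᶠ τ in nhds τ₀, (Q N τ₀ ↔ Q N τ) := by
    intro N τ₀
    have hcont : Continuous fun τ => k τ (A 0) := hk.comp (f := fun τ : ℝ => (τ, A 0)) (by fun_prop)
    obtain ⟨ε, hε, hfam⟩ := HasWinding.family hkA hkB hkAB hδ hkmeet (x := k τ₀ (A 0)) (τ₀ := τ₀)
      (mem_extChartAt_source _)
    filter_upwards [hcont.continuousAt.eventually (o.eventually_sign_det (k τ₀ (A 0))),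
      hcont.continuousAt.eventually (extChartAt_source_mem_nhds (I := 𝓡∂ 2) (k τ₀ (A 0))),
      Metric.ball_mem_nhds τ₀ hε] with τ hsign hsrc hτ
    have hτ' : |τ - τ₀| < ε := by simpa [Real.dist_eq] using hτ
    have hτ₀ : |τ₀ - τ₀| < ε := by simpa using hε
    have hy := mem_extChartAt_source (I := 𝓡∂ 2) (k τ (A 0))
    obtain ⟨ε₁, hε₁, h1⟩ := HasWinding.change_chart (hkcA τ) (hkcB τ) (hkAB τ) hδ (hkmeet τ)
      ⟨hsrc, hy⟩
    obtain ⟨ε₂, hε₂, h2⟩ := HasWinding.change_chart (hkcA τ) (hkcB τ) (hkAB τ) hδ (hkmeet τ)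
      ⟨hy, hsrc⟩
    have hinv := sign_det₂_of_leftInverse
      (D := tangentCoordChange (𝓡∂ 2) (k τ₀ (A 0)) (k τ (A 0)) (k τ (A 0)))
      (D' := tangentCoordChange (𝓡∂ 2) (k τ (A 0)) (k τ₀ (A 0)) (k τ (A 0))) fun v => by
        rw [tangentCoordChange_comp ⟨⟨hsrc, hy⟩, hsrc⟩, tangentCoordChange_self hsrc]
    rw [hinv] at h2
    rw [hsign] at h1 h2
    have hsq : ∀ x, o.frameSign x * o.frameSign x = 1 := fun x => by
      rcases o.frameSign_eq x with h | h <;> simp [h]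
    constructor
    · rintro ⟨ε', hε', h3⟩
      refine ⟨min ε ε₁, lt_min hε hε₁, fun r hr hrlt => ?_⟩
      have hm : 0 < min ε ε' := lt_min hε hε'
      have h4 := hfam τ₀ τ (min ε ε' / 2) r hτ₀ hτ' (by positivity)
        (by linarith [min_le_left ε ε']) hr (hrlt.trans_le (min_le_left _ _)) _
        (h3 (min ε ε' / 2) (by positivity) (by linarith [min_le_right ε ε']))
      have h5 := h1 r hr (hrlt.trans_le (min_le_right _ _)) _ h4
      convert h5 using 1
      linear_combination (-o.frameSign (k τ (A 0)) * N) * hsq (k τ₀ (A 0))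
    · rintro ⟨ε', hε', h3⟩
      refine ⟨ε, hε, fun r hr hrlt => ?_⟩
      have hm : 0 < min (min ε ε') ε₂ := lt_min (lt_min hε hε') hε₂
      set r' := min (min ε ε') ε₂ / 2
      have hr' : 0 < r' := by positivity
      have hr1 : r' < min (min ε ε') ε₂ := by simp only [r']; linarith
      have h5 := h2 r' hr' (hr1.trans_le (min_le_right _ _)) _
        (h3 r' hr' (hr1.trans_le ((min_le_left _ _).trans (min_le_right _ _))))
      have h4 := hfam τ τ₀ r' r hτ' hτ₀ hr'
        (hr1.trans_le ((min_le_left _ _).trans (min_le_left _ _))) hr hrlt _ h5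
      convert h4 using 1
      linear_combination (-o.frameSign (k τ₀ (A 0)) * N) * hsq (k τ (A 0))
  have hQ : ∀ N, Q N 0 → Q N 1 := fun N h0 => by
    have := isPreconnected_univ.induction₂ (fun τ τ' : ℝ => (Q N τ ↔ Q N τ'))
      (fun τ _ => by simpa using hstep N τ) (fun x y z _ _ _ h1 h2 => h1.trans h2)
      (fun x y _ _ h => h.symm) (Set.mem_univ 0) (Set.mem_univ 1)
    exact this.1 h0
  have hk0 : k 0 = h 0 := by simp only [k]; congr 1; ext; simp
  have hk1 : k 1 = h 1 := by simp only [k]; congr 1; ext; simp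
  obtain ⟨ε, hε, e1⟩ := hasWinding_differenceCurve (A := fun s => h 0 (A s))
    (B := fun s => h 0 (B s)) ((h 0).continuous.comp hA) ((h 0).continuous.comp hB)
    (by rw [hAB]) hv hw hd
  obtain ⟨ε', hε', e2⟩ := hasWinding_differenceCurve (A := fun s => h 1 (A s))
    (B := fun s => h 1 (B s)) ((h 1).continuous.comp hA) ((h 1).continuous.comp hB)
    (by rw [hAB]) hv' hw' hd'
  -- N is chosen as frame sign times winding number at time 0; a frame sign has square 1.
  obtain ⟨ε'', hε'', e3⟩ := hQ (o.frameSign (h 0 (A 0)) * -(SignType.sign (det₂ v w) : SignType))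
    ⟨ε, hε, fun r hr hrlt => by
      rw [hk0, ← mul_assoc]
      have : o.frameSign (h 0 (A 0)) * o.frameSign (h 0 (A 0)) = 1 := by
        rcases o.frameSign_eq (h 0 (A 0)) with h | h <;> simp [h]
      rw [this, one_mul]
      exact e1 r hr hrlt⟩
  rw [hk1] at e3
  have hm : 0 < min ε' ε'' := lt_min hε' hε''
  have hfin := (e3 (min ε' ε'' / 2) (by positivity) (by linarith [min_le_right ε' ε''])).unique
    (e2 (min ε' ε'' / 2) (by positivity) (by linarith [min_le_left ε' ε'']))
  rw [o.isPositive_iff, o.isPositive_iff]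
  rcases o.frameSign_eq (h 0 (A 0)) with h1 | h1 <;> rcases o.frameSign_eq (h 1 (A 0)) with h2 | h2 <;>
    rcases lt_or_gt_of_ne hd with h3 | h3 <;> rcases lt_or_gt_of_ne hd' with h4 | h4 <;>
    simp only [h1, h2, sign_neg, sign_pos, h3, h4] at hfin ⊢ <;>
    first
    | (exfalso; revert hfin; decide)
    | (push_cast; constructor <;> intro _ <;> linarith)

end LocalIndex

/-! ### Velocities -/

section Velocity

variable {M : Type*} [TopologicalSpace M] [ChartedSpace (EuclideanHalfSpace 2) M]

theorem hasDerivWithinAt_of_mdifferentiable {γ : ℝ → M} {s : Set ℝ} {u : ℝ}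
    (h : MDifferentiableWithinAt 𝓘(ℝ, ℝ) (𝓡∂ 2) γ s u) :
    HasDerivWithinAt (extChartAt (𝓡∂ 2) (γ u) ∘ γ) (velocity γ s u) s u := by
  have h1 := h.hasMFDerivWithinAt.2
  let D : ℝ →L[ℝ] Plane := mfderivWithin 𝓘(ℝ, ℝ) (𝓡∂ 2) γ s u
  have h2 : HasFDerivWithinAt (extChartAt (𝓡∂ 2) (γ u) ∘ γ) D s u := by
    simpa [writtenInExtChartAt] using! h1
  exact (h2.hasDerivWithinAt : HasDerivWithinAt _ (D 1) s u)

/-- The derivative has default value 0 where it does not exist, so a nonzero velocity certifies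
differentiability. -/
theorem mdifferentiable_of_velocity_ne_zero {γ : ℝ → M} {s : Set ℝ} {u : ℝ}
    (h : velocity γ s u ≠ 0) : MDifferentiableWithinAt 𝓘(ℝ, ℝ) (𝓡∂ 2) γ s u := by
  by_contra h1
  apply h
  unfold velocity
  rw [mfderivWithin_zero_of_not_mdifferentiableWithinAt h1]
  rfl

theorem velocity_eq_of_hasDerivWithinAt {γ : ℝ → M} {s : Set ℝ} {u : ℝ} {v : Plane}
    (hc : ContinuousWithinAt γ s u)
    (h : HasDerivWithinAt (extChartAt (𝓡∂ 2) (γ u) ∘ γ) v s u) (hs : UniqueDiffWithinAt ℝ s u) :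
    velocity γ s u = v := by
  have h1 : HasMFDerivWithinAt 𝓘(ℝ, ℝ) (𝓡∂ 2) γ s u
      (ContinuousLinearMap.toSpanSingleton ℝ v : ℝ →L[ℝ] Plane) := by
    refine ⟨hc, ?_⟩
    simpa [writtenInExtChartAt] using! h.hasFDerivWithinAt
  have h2 := hasDerivWithinAt_of_mdifferentiable h1.mdifferentiableWithinAt
  exact hs.eq_deriv s h2 h

/-- The velocity of a path which is an affine reparametrization of another path near a point. -/
theorem velocity_eq_smul {γ β : ℝ → M} {s s' : Set ℝ} {x b κ : ℝ}
    (hmaps : ∀ y ∈ s, b + κ * (y - x) ∈ s')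
    (heq : ∀ᶠ y in nhdsWithin x s, β y = γ (b + κ * (y - x))) (hx : β x = γ b)
    (hs : UniqueDiffWithinAt ℝ s x) (h : velocity γ s' b ≠ 0) :
    velocity β s x = κ • velocity γ s' b := by
  have hm := mdifferentiable_of_velocity_ne_zero h
  have h1 := hasDerivWithinAt_of_mdifferentiable hm
  have haff : HasDerivWithinAt (fun y : ℝ => b + κ * (y - x)) κ s x := by
    simpa using ((((hasDerivAt_id x).sub_const x).const_mul κ).const_add b).hasDerivWithinAt
  have hb : b + κ * (x - x) = b := by simp
  have hcont : ContinuousWithinAt β s x := by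
    have h2 : ContinuousWithinAt (γ ∘ fun y : ℝ => b + κ * (y - x)) s x :=
      ContinuousWithinAt.comp (t := s') (by simpa only [hb] using hm.continuousWithinAt)
        haff.continuousWithinAt hmaps
    refine h2.congr_of_eventuallyEq heq ?_
    simp [hx]
  refine velocity_eq_of_hasDerivWithinAt hcont ?_ hs
  have h3 : HasDerivWithinAt ((extChartAt (𝓡∂ 2) (γ b) ∘ γ) ∘ fun y : ℝ => b + κ * (y - x))
      (κ • velocity γ s' b) s x :=
    HasDerivWithinAt.scomp (t' := s') x (by simpa only [hb] using h1) haff hmaps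
  refine h3.congr_of_eventuallyEq ?_ ?_
  · filter_upwards [heq] with y hy
    simp [hy, hx]
  · simp [hx]

/-- The velocity of a path keeps its direction under increasing changes of parameter. -/
theorem velocity_comp_eq_smul {γ β : ℝ → M} {F : ℝ → ℝ} {u : ℝ} (hF : Continuous F)
    (hF' : StrictMono F) (heq : ∀ y, β y = γ (F y)) (hβ : velocity β Set.univ u ≠ 0)
    (hγ : velocity γ Set.univ (F u) ≠ 0) :
    ∃ r : ℝ, 0 < r ∧ velocity β Set.univ u = r • velocity γ Set.univ (F u) := by
  have h1 := (hasDerivWithinAt_of_mdifferentiable (mdifferentiable_of_velocity_ne_zero hβ)).hasDerivAt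
    Filter.univ_mem
  have h2 := (hasDerivWithinAt_of_mdifferentiable (mdifferentiable_of_velocity_ne_zero hγ)).hasDerivAt
    Filter.univ_mem
  set w := velocity β Set.univ u
  set v := velocity γ Set.univ (F u)
  rw [heq u] at h1
  set φ := extChartAt (𝓡∂ 2) (γ (F u))
  rw [hasDerivAt_iff_tendsto_slope] at h1 h2
  have hFt : Filter.Tendsto F (nhdsWithin u {u}ᶜ) (nhdsWithin (F u) {F u}ᶜ) :=
    tendsto_nhdsWithin_of_tendsto_nhds_of_eventually_within _
      (hF.continuousAt.tendsto.mono_left nhdsWithin_le_nhds)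
      (by filter_upwards [self_mem_nhdsWithin] with y hy using hF'.injective.ne hy)
  have h3 := h2.comp hFt
  set q : ℝ → ℝ := fun y => (F y - F u) / (y - u)
  have hq : ∀ y ∈ ({u}ᶜ : Set ℝ), 0 < q y := fun y hy => by
    rcases lt_or_gt_of_ne hy with h | h
    · exact div_pos_of_neg_of_neg (sub_neg.2 (hF' h)) (sub_neg.2 h)
    · exact div_pos (sub_pos.2 (hF' h)) (sub_pos.2 h)
  have hslope : ∀ y ∈ ({u}ᶜ : Set ℝ), slope (φ ∘ β) u y = q y • slope (φ ∘ γ) (F u) (F y) := by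
    intro y hy
    have e1 : F y - F u ≠ 0 := sub_ne_zero.2 (hF'.injective.ne hy)
    simp only [slope, Function.comp, heq, vsub_eq_sub, smul_smul, q]
    congr 1
    field_simp
  -- Differentiability of F is not assumed. The norms of the slopes of both paths converge to
  -- nonzero limits, which forces the positive difference quotient q of F to converge.
  have hnorm : Filter.Tendsto q (nhdsWithin u {u}ᶜ) (nhds (‖w‖ / ‖v‖)) := by
    refine (h1.norm.div h3.norm (norm_ne_zero_iff.2 hγ)).congr' ?_
    have hne : ∀ᶠ y in nhdsWithin u {u}ᶜ, ‖slope (φ ∘ γ) (F u) (F y)‖ ≠ 0 :=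
      (h3.norm.eventually_ne (norm_ne_zero_iff.2 hγ))
    filter_upwards [self_mem_nhdsWithin, hne] with y hy hne
    rw [Pi.div_apply, hslope y hy, norm_smul, Real.norm_of_nonneg (hq y hy).le]
    exact mul_div_cancel_right₀ _ hne
  refine ⟨‖w‖ / ‖v‖, div_pos (norm_pos_iff.2 hβ) (norm_pos_iff.2 hγ), ?_⟩
  refine tendsto_nhds_unique h1 ((hnorm.smul h3).congr' ?_)
  filter_upwards [self_mem_nhdsWithin] with y hy
  exact (hslope y hy).symm

end Velocity

/-! ### Pointed loops as periodic paths -/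

section Paths

variable {M : Type*} [TopologicalSpace M] [ChartedSpace (EuclideanHalfSpace 2) M]

namespace PointedLoop

variable (α : PointedLoop M)

theorem toFun_basePreimage : α.toFun α.basePreimage = α.base :=
  Classical.choose_spec α.base_mem

theorem eq_basePreimage {z : Circle} (h : α.toFun z = α.base) : z = α.basePreimage := by
  by_contra hne
  exact α.base_not_crossing ⟨z, α.basePreimage, hne, h, α.toFun_basePreimage⟩

/-- The angle of the preimage of the base point. -/
def baseAngle : ℝ := Complex.arg α.basePreimage

theorem exp_baseAngle : Circle.exp α.baseAngle = α.basePreimage := Circle.exp_arg _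

theorem path_eq (u : ℝ) : α.path u = α.toFun (Circle.exp (α.baseAngle + u)) := by
  rw [path, Circle.exp_add, exp_baseAngle]

theorem angular_eq_path (u : ℝ) : α.toFun (Circle.exp u) = α.path (u - α.baseAngle) := by
  rw [path_eq, add_sub_cancel]

theorem path_zero : α.path 0 = α.base := by
  rw [path, Circle.exp_zero, mul_one, toFun_basePreimage]

theorem path_congr {u v : ℝ} (h : Circle.exp u = Circle.exp v) : α.path u = α.path v := by
  rw [path, path, h]

theorem path_periodic : Function.Periodic α.path (2 * Real.pi) := fun u =>
  α.path_congr (Circle.periodic_exp u)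

theorem continuous_path : Continuous α.path :=
  α.continuous.comp (continuous_const.mul Circle.exp.continuous)

theorem path_mem_crossings {u v : ℝ} (h : α.path u = α.path v)
    (hne : Circle.exp u ≠ Circle.exp v) : α.path u ∈ α.crossings :=
  ⟨α.basePreimage * Circle.exp u, α.basePreimage * Circle.exp v,
    fun h' => hne (mul_left_cancel h'), rfl, h.symm⟩

theorem exp_eq_of_path_eq {u v w : ℝ} (h : α.path u = α.path v) (h' : α.path u = α.path w) :
    Circle.exp u = Circle.exp v ∨ Circle.exp u = Circle.exp w ∨ Circle.exp v = Circle.exp w := by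
  by_contra! hne
  obtain ⟨h1, h2, h3⟩ := hne
  have h4 := α.double (α.path u)
  have h5 : ({α.basePreimage * Circle.exp u, α.basePreimage * Circle.exp v,
      α.basePreimage * Circle.exp w} : Set Circle) ⊆ α.toFun ⁻¹' {α.path u} := by
    rintro z (rfl | rfl | rfl)
    · rfl
    · exact h.symm
    · exact h'.symm
  have h6 := (Set.encard_le_encard h5).trans h4
  rw [Set.encard_insert_of_notMem, Set.encard_pair] at h6
  · norm_num at h6
  · simpa using h3
  · simpa using ⟨h1, h2⟩

theorem path_mem_interior (u : ℝ) : (𝓡∂ 2).IsInteriorPoint (α.path u) := α.interior _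

theorem exists_exp_eq (u : ℝ) : ∃ v ∈ Set.Ico 0 (2 * Real.pi), Circle.exp u = Circle.exp v := by
  obtain ⟨v, hv, h⟩ := Circle.periodic_exp.exists_mem_Ico₀ Real.two_pi_pos u
  exact ⟨v, hv, h⟩

theorem exp_injOn : Set.InjOn Circle.exp (Set.Ico 0 (2 * Real.pi)) :=
  Circle.exp_injOn_Ico (by simp)

/-- A self-crossing is met at exactly two times in `]0, 2π[`. -/
theorem time_spec {p : M} (hp : p ∈ α.crossings) :
    0 < α.time₁ p ∧ α.time₁ p < α.time₂ p ∧ α.time₂ p < 2 * Real.pi ∧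
      α.path (α.time₁ p) = p ∧ α.path (α.time₂ p) = p := by
  obtain ⟨z, w, hzw, hz, hw⟩ := hp
  have hpar : ∀ z : Circle, α.toFun z = p →
      ∃ u ∈ Set.Ioo 0 (2 * Real.pi), α.basePreimage * Circle.exp u = z := by
    intro z' hz'
    obtain ⟨t, ht⟩ := Circle.exp_surjective (α.basePreimage⁻¹ * z')
    obtain ⟨v, hv, hv'⟩ := exists_exp_eq t
    have h1 : α.basePreimage * Circle.exp v = z' := by rw [← hv', ht, mul_inv_cancel_left]
    -- Time 0 is excluded because the base point is not a crossing.
    refine ⟨v, ⟨lt_of_le_of_ne hv.1 ?_, hv.2⟩, h1⟩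
    rintro rfl
    rw [Circle.exp_zero, mul_one] at h1
    apply α.base_not_crossing
    rw [← α.toFun_basePreimage, h1, hz']
    exact ⟨z, w, hzw, hz, hw⟩
  obtain ⟨s, hs, hs'⟩ := hpar z hz
  obtain ⟨t, ht, ht'⟩ := hpar w hw
  have hst : s ≠ t := by rintro rfl; exact hzw (hs'.symm.trans ht')
  have hps : α.path s = p := by rw [path, hs', hz]
  have hpt : α.path t = p := by rw [path, ht', hw]
  -- The set in the definitions of `time₁` and `time₂` consists of exactly two times, so its infimum
  -- and supremum are attained.
  have hset : {u | u ∈ Set.Ioo 0 (2 * Real.pi) ∧ α.path u = p} = {s, t} := by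
    ext u
    constructor
    · rintro ⟨hu, hup⟩
      rcases α.exp_eq_of_path_eq (hup.trans hps.symm) (hup.trans hpt.symm) with h | h | h
      · exact Or.inl (exp_injOn ⟨hu.1.le, hu.2⟩ ⟨hs.1.le, hs.2⟩ h)
      · exact Or.inr (exp_injOn ⟨hu.1.le, hu.2⟩ ⟨ht.1.le, ht.2⟩ h)
      · exact absurd (exp_injOn ⟨hs.1.le, hs.2⟩ ⟨ht.1.le, ht.2⟩ h) hst
    · rintro (rfl | rfl)
      · exact ⟨hs, hps⟩
      · exact ⟨ht, hpt⟩
  rw [time₁, time₂, hset, csInf_pair, csSup_pair]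
  rcases lt_or_gt_of_ne hst with h | h
  · rw [inf_eq_left.2 h.le, sup_eq_right.2 h.le]
    exact ⟨hs.1, h, ht.2, hps, hpt⟩
  · rw [inf_eq_right.2 h.le, sup_eq_left.2 h.le]
    exact ⟨ht.1, h, hs.2, hpt, hps⟩

theorem exp_eq_time {p : M} (hp : p ∈ α.crossings) {u : ℝ} (hu : α.path u = p) :
    Circle.exp u = Circle.exp (α.time₁ p) ∨ Circle.exp u = Circle.exp (α.time₂ p) := by
  obtain ⟨h1, h2, h3, h4, h5⟩ := α.time_spec hp
  rcases α.exp_eq_of_path_eq (hu.trans h4.symm) (hu.trans h5.symm) with h | h | h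
  · exact Or.inl h
  · exact Or.inr h
  · exact absurd (exp_injOn ⟨h1.le, h2.trans h3⟩ ⟨(h1.trans h2).le, h3⟩ h) h2.ne

/-- Double points leave no third passage, so any two ordered times in ]0, 2π[ with the same image
are the two times of a crossing. Times of subloops and of transformed loops are recognized in this
way. -/
theorem time_eq {s t : ℝ} (hs : 0 < s) (hst : s < t) (ht : t < 2 * Real.pi)
    (h : α.path s = α.path t) : α.path s ∈ α.crossings ∧ α.time₁ (α.path s) = s ∧
      α.time₂ (α.path s) = t := by
  have hp : α.path s ∈ α.crossings := α.path_mem_crossings h fun h' =>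
    hst.ne (exp_injOn ⟨hs.le, hst.trans ht⟩ ⟨(hs.trans hst).le, ht⟩ h')
  obtain ⟨h1, h2, h3, h4, h5⟩ := α.time_spec hp
  refine ⟨hp, ?_⟩
  have e1 := α.exp_eq_time hp (u := s) rfl
  have e2 := α.exp_eq_time hp (u := t) h.symm
  have m1 : s ∈ Set.Ico 0 (2 * Real.pi) := ⟨hs.le, hst.trans ht⟩
  have m2 : t ∈ Set.Ico 0 (2 * Real.pi) := ⟨(hs.trans hst).le, ht⟩
  have m3 : α.time₁ (α.path s) ∈ Set.Ico 0 (2 * Real.pi) := ⟨h1.le, h2.trans h3⟩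
  have m4 : α.time₂ (α.path s) ∈ Set.Ico 0 (2 * Real.pi) := ⟨(h1.trans h2).le, h3⟩
  rcases e1 with e1 | e1 <;> rcases e2 with e2 | e2
  · have := exp_injOn m1 m3 e1
    have := exp_injOn m2 m3 e2
    linarith
  · exact ⟨(exp_injOn m1 m3 e1).symm, (exp_injOn m2 m4 e2).symm⟩
  · have := exp_injOn m1 m4 e1
    have := exp_injOn m2 m3 e2
    linarith
  · have := exp_injOn m1 m4 e1
    have := exp_injOn m2 m4 e2
    linarith

theorem path_eq_angular : α.path = fun u => α.toFun (Circle.exp (α.baseAngle + u)) :=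
  funext α.path_eq

theorem contMDiffOn_shift {s : Set ℝ} {t : Set ℝ}
    (h : ContMDiffOn 𝓘(ℝ, ℝ) (𝓡∂ 2) ∞ (fun t : ℝ => α.toFun (Circle.exp t)) s)
    (hst : ∀ u ∈ t, α.baseAngle + u ∈ s) : ContMDiffOn 𝓘(ℝ, ℝ) (𝓡∂ 2) ∞ α.path t := by
  rw [α.path_eq_angular]
  refine h.comp (f := fun u : ℝ => α.baseAngle + u) ?_ hst
  exact (contDiff_const.add contDiff_id).contMDiff.contMDiffOn

theorem path_smooth_right (u : ℝ) : ∃ v, u < v ∧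
    ContMDiffOn 𝓘(ℝ, ℝ) (𝓡∂ 2) ∞ α.path (Set.Icc u v) := by
  obtain ⟨v, hv, h⟩ := α.smooth_right (α.baseAngle + u)
  refine ⟨v - α.baseAngle, by linarith, α.contMDiffOn_shift h fun t ht => ?_⟩
  exact ⟨by linarith [ht.1], by linarith [ht.2]⟩

theorem path_smooth_left (u : ℝ) : ∃ v, v < u ∧
    ContMDiffOn 𝓘(ℝ, ℝ) (𝓡∂ 2) ∞ α.path (Set.Icc v u) := by
  obtain ⟨v, hv, h⟩ := α.smooth_left (α.baseAngle + u)
  refine ⟨v - α.baseAngle, by linarith, α.contMDiffOn_shift h fun t ht => ?_⟩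
  exact ⟨by linarith [ht.1], by linarith [ht.2]⟩

theorem path_velocity {s s' : Set ℝ} {u : ℝ} (hs : UniqueDiffWithinAt ℝ s u)
    (hmaps : ∀ y ∈ s, α.baseAngle + y ∈ s')
    (h : velocity (fun t : ℝ => α.toFun (Circle.exp t)) s' (α.baseAngle + u) ≠ 0) :
    velocity α.path s u =
      velocity (fun t : ℝ => α.toFun (Circle.exp t)) s' (α.baseAngle + u) := by
  have := velocity_eq_smul (γ := fun t : ℝ => α.toFun (Circle.exp t)) (β := α.path) (s := s)
    (s' := s') (x := u) (b := α.baseAngle + u) (κ := 1)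
    (fun y hy => by convert hmaps y hy using 1; ring)
    (Filter.Eventually.of_forall fun y => by rw [path_eq]; congr 2; ring) (α.path_eq u) hs h
  rwa [one_smul] at this

theorem path_velocity_right (u : ℝ) : velocity α.path (Set.Ici u) u =
    velocity (fun t : ℝ => α.toFun (Circle.exp t)) (Set.Ici (α.baseAngle + u))
      (α.baseAngle + u) :=
  α.path_velocity (uniqueDiffOn_Ici u u Set.self_mem_Ici)
    (fun y hy => by simpa using hy) (α.immersed_right _)

theorem path_velocity_left (u : ℝ) : velocity α.path (Set.Iic u) u =
    velocity (fun t : ℝ => α.toFun (Circle.exp t)) (Set.Iic (α.baseAngle + u))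
      (α.baseAngle + u) :=
  α.path_velocity (uniqueDiffOn_Iic u u Set.self_mem_Iic)
    (fun y hy => by simpa using hy) (α.immersed_left _)

theorem path_immersed_right (u : ℝ) : velocity α.path (Set.Ici u) u ≠ 0 := by
  rw [path_velocity_right]; exact α.immersed_right _

theorem path_immersed_left (u : ℝ) : velocity α.path (Set.Iic u) u ≠ 0 := by
  rw [path_velocity_left]; exact α.immersed_left _

theorem path_no_cusp (u : ℝ) : ¬ SameRay ℝ (-velocity α.path (Set.Iic u) u)
    (velocity α.path (Set.Ici u) u) := by
  rw [path_velocity_left, path_velocity_right]; exact α.no_cusp _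

theorem path_smooth_at_crossing {u : ℝ} (h : α.path u ∈ α.crossings) :
    ContMDiffAt 𝓘(ℝ, ℝ) (𝓡∂ 2) ∞ α.path u := by
  have h1 := α.smooth_at_crossing (α.baseAngle + u) (by rw [← path_eq]; exact h)
  rw [α.path_eq_angular]
  exact ContMDiffAt.comp (f := fun u : ℝ => α.baseAngle + u) u h1
    (contDiff_const.add contDiff_id).contMDiff.contMDiffAt

theorem path_transversal {u v : ℝ} (hne : Circle.exp u ≠ Circle.exp v)
    (h : α.path u = α.path v) : LinearIndependent ℝ
      ![velocity α.path Set.univ u, velocity α.path Set.univ v] := by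
  have h1 := α.transversal (α.baseAngle + u) (α.baseAngle + v)
    (by rw [Circle.exp_add, Circle.exp_add]; exact fun h' => hne (mul_left_cancel h'))
    (by rw [← path_eq, ← path_eq, h])
  rwa [α.path_velocity (s' := Set.univ) uniqueDiffWithinAt_univ (fun _ _ => trivial)
    (h1.ne_zero (0 : Fin 2)), α.path_velocity (s' := Set.univ) uniqueDiffWithinAt_univ
    (fun _ _ => trivial) (h1.ne_zero (1 : Fin 2))]

theorem det₂_velocity_ne_zero {p : M} (hp : p ∈ α.crossings) :
    det₂ (velocity α.path Set.univ (α.time₁ p)) (velocity α.path Set.univ (α.time₂ p)) ≠ 0 := by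
  obtain ⟨h1, h2, h3, h4, h5⟩ := α.time_spec hp
  exact det₂_ne_zero (α.path_transversal (fun h => h2.ne
    (exp_injOn ⟨h1.le, h2.trans h3⟩ ⟨(h1.trans h2).le, h3⟩ h)) (h4.trans h5.symm))

theorem velocity_ne_zero_of_crossing {u : ℝ} (h : α.path u ∈ α.crossings) :
    velocity α.path Set.univ u ≠ 0 := by
  obtain ⟨h1, h2, h3, h4, h5⟩ := α.time_spec h
  have hne : Circle.exp (α.time₁ (α.path u)) ≠ Circle.exp (α.time₂ (α.path u)) := fun h' =>
    h2.ne (exp_injOn ⟨h1.le, h2.trans h3⟩ ⟨(h1.trans h2).le, h3⟩ h')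
  rcases α.exp_eq_time h rfl with h6 | h6
  · exact (α.path_transversal (u := u) (v := α.time₂ (α.path u)) (h6 ▸ hne) h5.symm).ne_zero
      (0 : Fin 2)
  · exact (α.path_transversal (u := u) (v := α.time₁ (α.path u)) (h6 ▸ hne.symm) h4.symm).ne_zero
      (0 : Fin 2)

end PointedLoop

end Paths

/-! ### Collapsing arcs of the circle -/

theorem isQuotientMap_exp : Topology.IsQuotientMap Circle.exp :=
  isLocalHomeomorph_circleExp.isOpenMap.isQuotientMap Circle.exp.continuous Circle.exp_surjective

theorem exp_eq_iff {u v : ℝ} :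
    Circle.exp u = Circle.exp v ↔ ∃ k : ℤ, u = v + k * (2 * Real.pi) := Circle.exp_eq_exp

/-- An angular function `c` of degree one which collapses precisely the intervals contained in
`J`. -/
structure IsCollapse (J : Set ℝ) (c : ℝ → ℝ) : Prop where
  continuous : Continuous c
  monotone : Monotone c
  add_period : ∀ u, c (u + 2 * Real.pi) = c u + 2 * Real.pi
  eq_iff : ∀ u v, u < v → (c u = c v ↔ Set.Ioo u v ⊆ J)

namespace IsCollapse

variable {J J' : Set ℝ} {c c' d : ℝ → ℝ}

theorem add_int (hc : IsCollapse J c) (u : ℝ) (k : ℤ) :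
    c (u + k * (2 * Real.pi)) = c u + k * (2 * Real.pi) := by
  have h : Function.Periodic (fun u => c u - u) (2 * Real.pi) := fun u => by
    simp only [hc.add_period]; ring
  have := h.int_mul k u
  linarith

theorem exp_congr (hc : IsCollapse J c) {u v : ℝ} (h : Circle.exp u = Circle.exp v) :
    Circle.exp (c u) = Circle.exp (c v) := by
  obtain ⟨k, rfl⟩ := exp_eq_iff.1 h
  exact exp_eq_iff.2 ⟨k, hc.add_int v k⟩

theorem surjective (hc : IsCollapse J c) : Function.Surjective c := by
  intro x
  have hp := Real.two_pi_pos
  set k := ⌊(x - c 0) / (2 * Real.pi)⌋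
  have h1 := Int.floor_le ((x - c 0) / (2 * Real.pi))
  have h2 := Int.lt_floor_add_one ((x - c 0) / (2 * Real.pi))
  rw [le_div_iff₀ hp] at h1
  rw [div_lt_iff₀ hp] at h2
  have h3 := hc.add_int 0 k
  have h4 := hc.add_int 0 (k + 1)
  push_cast at h4
  have h5 := intermediate_value_Icc (a := 0 + k * (2 * Real.pi))
    (b := 0 + (k + 1) * (2 * Real.pi)) (by nlinarith) hc.continuous.continuousOn
  rw [h3, h4] at h5
  have h6 : x ∈ Set.Icc (c 0 + k * (2 * Real.pi)) (c 0 + (k + 1) * (2 * Real.pi)) :=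
    ⟨by linarith, by linarith⟩
  obtain ⟨u, -, hu⟩ := h5 h6
  exact ⟨u, hu⟩

theorem lt_of_lt (hc : IsCollapse J c) {u v : ℝ} (h : c u < c v) : u < v := by
  by_contra h'
  exact absurd (hc.monotone (not_lt.1 h')) (not_le.2 h)

theorem abs_sub_le (hc : IsCollapse J c) {u v : ℝ} (h : c u = c v) : |u - v| ≤ 2 * Real.pi := by
  have hp := Real.two_pi_pos
  by_contra! h'
  rcases lt_abs.1 h' with h1 | h1
  · have := hc.monotone (show v + 2 * Real.pi ≤ u by linarith)
    rw [hc.add_period] at this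
    linarith
  · have := hc.monotone (show u + 2 * Real.pi ≤ v by linarith)
    rw [hc.add_period] at this
    linarith

theorem isCompact_fiber (hc : IsCollapse J c) (x : ℝ) : IsCompact (c ⁻¹' {x}) := by
  obtain ⟨u, hu⟩ := hc.surjective x
  refine (isCompact_Icc (a := u - 2 * Real.pi) (b := u + 2 * Real.pi)).of_isClosed_subset
    (isClosed_singleton.preimage hc.continuous) fun v hv => ?_
  have := abs_le.1 (hc.abs_sub_le (hu.trans (Set.mem_singleton_iff.1 hv).symm))
  constructor <;> linarith [this.1, this.2]

/-- The fibre is compact. Its greatest element cannot lie in the open set J, because `c` would then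
remain constant slightly beyond it. -/
theorem exists_max (hc : IsCollapse J c) (hJ : IsOpen J) (x : ℝ) :
    ∃ b, b ∉ J ∧ c b = x ∧ ∀ u, c u = x → u ≤ b := by
  obtain ⟨b, hb, hmax⟩ := (hc.isCompact_fiber x).exists_isGreatest (hc.surjective x)
  refine ⟨b, fun hbJ => ?_, hb, fun u hu => hmax hu⟩
  obtain ⟨ε, hε, h⟩ := Metric.isOpen_iff.1 hJ b hbJ
  have h1 : c b = c (b + ε) := (hc.eq_iff b (b + ε) (by linarith)).2 fun t ht => h (by
    rw [Real.ball_eq_Ioo]; exact ⟨by linarith [ht.1], ht.2⟩)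
  have := hmax (show c (b + ε) = x from h1.symm.trans hb)
  linarith

theorem exists_min (hc : IsCollapse J c) (hJ : IsOpen J) (x : ℝ) :
    ∃ a, a ∉ J ∧ c a = x ∧ ∀ u, c u = x → a ≤ u := by
  obtain ⟨a, ha, hmin⟩ := (hc.isCompact_fiber x).exists_isLeast (hc.surjective x)
  refine ⟨a, fun haJ => ?_, ha, fun u hu => hmin hu⟩
  obtain ⟨ε, hε, h⟩ := Metric.isOpen_iff.1 hJ a haJ
  have h1 : c (a - ε) = c a := (hc.eq_iff (a - ε) a (by linarith)).2 fun t ht => h (by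
    rw [Real.ball_eq_Ioo]; exact ⟨ht.1, by linarith [ht.2]⟩)
  have := hmin (show c (a - ε) = x from h1.trans ha)
  linarith

theorem exists_notMem (hc : IsCollapse J c) (hJ : IsOpen J) (x : ℝ) : ∃ u, u ∉ J ∧ c u = x :=
  let ⟨b, h, h', _⟩ := hc.exists_max hJ x
  ⟨b, h, h'⟩

theorem eq_iff_eq (hc : IsCollapse J c) (hc' : IsCollapse J c') (u v : ℝ) :
    c u = c v ↔ c' u = c' v := by
  rcases lt_trichotomy u v with h | h | h
  · rw [hc.eq_iff u v h, hc'.eq_iff u v h]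
  · simp [h]
  · rw [eq_comm, hc.eq_iff v u h, eq_comm, hc'.eq_iff v u h]

/-- Two collapses of the same set differ by a change of the angle. -/
theorem exists_comp_eq (hc : IsCollapse J c) (hc' : IsCollapse J c') :
    ∃ F : ℝ → ℝ, Continuous F ∧ StrictMono F ∧ (∀ x, F (x + 2 * Real.pi) = F x + 2 * Real.pi) ∧
      ∀ u, c' u = F (c u) := by
  -- F is `c'` composed with a section of `c`. The choice of the section is irrelevant since both
  -- maps have the same fibres, and continuity follows from monotonicity and surjectivity.
  choose r hr using hc.surjective
  have hF : ∀ u, c' u = c' (r (c u)) := fun u => ((hc.eq_iff_eq hc' _ _).1 (hr (c u))).symm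
  have hmono : StrictMono fun x => c' (r x) := by
    intro x y hxy
    have h1 : r x < r y := hc.lt_of_lt (by rwa [hr, hr])
    refine lt_of_le_of_ne (hc'.monotone h1.le) fun h2 => hxy.ne ?_
    rw [← hr x, ← hr y]
    exact (hc.eq_iff_eq hc' _ _).2 h2
  refine ⟨fun x => c' (r x), ?_, hmono, fun x => ?_, hF⟩
  · refine hmono.monotone.continuous_of_surjective fun y => ?_
    obtain ⟨u, rfl⟩ := hc'.surjective y
    exact ⟨c u, (hF u).symm⟩
  · have h1 := hF (r x + 2 * Real.pi)
    rw [hc'.add_period, hc.add_period, hr] at h1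
    exact h1.symm

/-- The composition of two collapses. -/
theorem comp (hc : IsCollapse J c) (hd : IsCollapse J' d) (hJ : IsOpen J)
    (hsingle : ∀ u v, u < v → c u = c v → c u ∉ J' → (∀ y, c u < y → ¬ Set.Ioo (c u) y ⊆ J') ∧
      ∀ y, y < c u → ¬ Set.Ioo y (c u) ⊆ J') :
    IsCollapse (J ∪ c ⁻¹' J') (d ∘ c) where
  continuous := hd.continuous.comp hc.continuous
  monotone := hd.monotone.comp hc.monotone
  add_period u := by simp only [Function.comp, hc.add_period, hd.add_period]
  eq_iff u v huv := by
    simp only [Function.comp]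
    rcases (hc.monotone huv.le).eq_or_lt with h | h
    · refine ⟨fun _ => ?_, fun _ => by rw [h]⟩
      exact ((hc.eq_iff u v huv).1 h).trans Set.subset_union_left
    · rw [hd.eq_iff _ _ h]
      constructor
      · intro hsub t ht
        by_cases htJ : t ∈ J
        · exact Or.inl htJ
        right
        -- The hypothesis `hsingle` excludes a collapsed interval whose image is an endpoint of an
        -- arc of J'. Such an interval would merge with the arc, although its own endpoints might
        -- not belong to the union.
        rcases (hc.monotone ht.1.le).eq_or_lt with h1 | h1
        · by_contra h2
          have h2' : c u ∉ J' := by rw [h1]; exact h2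
          exact (hsingle u t ht.1 h1 h2').1 _ h hsub
        rcases (hc.monotone ht.2.le).eq_or_lt with h3 | h3
        · by_contra h2
          rw [← h3] at h hsub
          exact (hsingle t v ht.2 h3 h2).2 _ h hsub
        · exact hsub ⟨h1, h3⟩
      · intro hsub x hx
        obtain ⟨t, htJ, rfl⟩ := hc.exists_notMem hJ x
        exact (hsub ⟨hc.lt_of_lt hx.1, hc.lt_of_lt hx.2⟩).resolve_left htJ

end IsCollapse

/-! ### Uniqueness of subloops -/

section Subloop

variable {M : Type*} [TopologicalSpace M] [ChartedSpace (EuclideanHalfSpace 2) M]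

/-- An increasing change of time of degree one, corrected by the angles of the base points, descends
to a homeomorphism of the circle. -/
theorem PointedLoop.isotopyClass_eq_of_path {β β' : PointedLoop M} (hbase : β.base = β'.base)
    {F : ℝ → ℝ} (hF : Continuous F) (hmono : StrictMono F)
    (hper : ∀ x, F (x + 2 * Real.pi) = F x + 2 * Real.pi) (h : ∀ x, β.path x = β'.path (F x)) :
    β.isotopyClass = β'.isotopyClass := by
  refine (Quot.sound (Or.inl ⟨hbase.symm, ?_⟩) : β'.isotopyClass = β.isotopyClass).symm
  set G : ℝ → ℝ := fun x => β'.baseAngle + F (x - β.baseAngle)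
  have hG : Continuous G := by fun_prop
  have hGmono : StrictMono G := fun x y hxy => by
    have := hmono (show x - β.baseAngle < y - β.baseAngle by linarith)
    simp only [G]; linarith
  have hGper : ∀ x, G (x + 2 * Real.pi) = G x + 2 * Real.pi := fun x => by
    simp only [G]
    rw [show x + 2 * Real.pi - β.baseAngle = x - β.baseAngle + 2 * Real.pi by ring, hper]
    ring
  -- A strictly increasing function of degree one is a collapse of the empty set, so surjectivity
  -- and integral periodicity come for free.
  have hGc : IsCollapse ∅ G := ⟨hG, hGmono.monotone, hGper, fun u v huv => by
    refine ⟨fun h => absurd h (hGmono huv).ne, fun h => ?_⟩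
    exact absurd (h (⟨by linarith, by linarith⟩ : (u + v) / 2 ∈ Set.Ioo u v)) (by simp)⟩
  let f : Circle → Circle := fun z => Circle.exp (G (Complex.arg z))
  have hf : ∀ u, f (Circle.exp u) = Circle.exp (G u) := fun u =>
    hGc.exp_congr (Circle.exp_arg _)
  have hfc : Continuous f := by
    rw [isQuotientMap_exp.continuous_iff]
    have : f ∘ Circle.exp = Circle.exp ∘ G := funext hf
    rw [this]
    exact Circle.exp.continuous.comp hG
  have hbij : Function.Bijective f := by
    constructor
    · intro z w hzw
      obtain ⟨u, rfl⟩ := Circle.exp_surjective z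
      obtain ⟨v, rfl⟩ := Circle.exp_surjective w
      rw [hf, hf] at hzw
      obtain ⟨k, hk⟩ := exp_eq_iff.1 hzw
      rw [← hGc.add_int] at hk
      exact exp_eq_iff.2 ⟨k, hGmono.injective hk⟩
    · intro z
      obtain ⟨u, rfl⟩ := Circle.exp_surjective z
      obtain ⟨v, rfl⟩ := hGc.surjective u
      exact ⟨Circle.exp v, hf v⟩
  let e : Circle ≃ₜ Circle :=
    Continuous.homeoOfEquivCompactToT2 (f := Equiv.ofBijective f hbij) hfc
  refine ⟨e, ⟨G, hG, hGmono, hf⟩, ?_⟩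
  funext z
  obtain ⟨u, rfl⟩ := Circle.exp_surjective z
  change _ = β'.toFun (f (Circle.exp u))
  rw [hf, β.angular_eq_path, β'.angular_eq_path, h]
  congr 1
  simp [G]

/-- `β` is the pointed loop obtained from `α` by removing the times in `J` and starting at time
`a`. -/
def IsSubloop (α : PointedLoop M) (J : Set ℝ) (a : ℝ) (β : PointedLoop M) : Prop :=
  ∃ c, IsCollapse J c ∧ c a = 0 ∧ ∀ u, u ∉ J → β.path (c u) = α.path u

/-- Two collapses of the same open set differ by an increasing change of time which matches the
paths. Both send a to 0, so the base points agree too. -/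
theorem IsSubloop.isotopyClass_eq {α : PointedLoop M} {J : Set ℝ} {a : ℝ} {β β' : PointedLoop M}
    (h : IsSubloop α J a β) (h' : IsSubloop α J a β') (hJ : IsOpen J) :
    β.isotopyClass = β'.isotopyClass := by
  obtain ⟨c, hc, hca, hβ⟩ := h
  obtain ⟨c', hc', hca', hβ'⟩ := h'
  obtain ⟨F, hF, hmono, hper, hcomp⟩ := hc.exists_comp_eq hc'
  have hpath : ∀ x, β.path x = β'.path (F x) := fun x => by
    obtain ⟨u, hu, rfl⟩ := hc.exists_notMem hJ x
    rw [← hcomp, hβ u hu, hβ' u hu]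
  refine PointedLoop.isotopyClass_eq_of_path ?_ hF hmono hper hpath
  rw [← β.path_zero, ← β'.path_zero, hpath, ← hca, ← hcomp, hca, hca']

theorem IsSubloop.comp {α β γ : PointedLoop M} {J J' : Set ℝ} {a : ℝ} {c : ℝ → ℝ}
    (hc : IsCollapse J c) (hJ : IsOpen J) (hβ : ∀ u, u ∉ J → β.path (c u) = α.path u)
    (h : IsSubloop β J' (c a) γ)
    (hsingle : ∀ u v, u < v → c u = c v → c u ∉ J' → (∀ y, c u < y → ¬ Set.Ioo (c u) y ⊆ J') ∧
      ∀ y, y < c u → ¬ Set.Ioo y (c u) ⊆ J') :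
    IsSubloop α (J ∪ c ⁻¹' J') a γ := by
  obtain ⟨d, hd, hda, hγ⟩ := h
  refine ⟨d ∘ c, hc.comp hd hJ hsingle, hda, fun u hu => ?_⟩
  rw [Function.comp, hγ _ fun h => hu (Or.inr h), hβ _ fun h => hu (Or.inl h)]

/-- Subloops are compatible with reparametrizations. -/
theorem IsSubloop.reparam {α α' β : PointedLoop M} {J : Set ℝ} {a : ℝ} {F : ℝ → ℝ}
    (h : IsSubloop α J (F a) β) (hF : Continuous F) (hmono : StrictMono F)
    (hsurj : Function.Surjective F)
    (hper : ∀ x, F (x + 2 * Real.pi) = F x + 2 * Real.pi) (hα : ∀ x, α'.path x = α.path (F x)) :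
    IsSubloop α' (F ⁻¹' J) a β := by
  obtain ⟨c, hc, hca, hβ⟩ := h
  refine ⟨c ∘ F, ⟨hc.continuous.comp hF, hc.monotone.comp hmono.monotone, fun u => ?_,
    fun u v huv => ?_⟩, hca, fun u hu => ?_⟩
  · simp only [Function.comp, hper, hc.add_period]
  · simp only [Function.comp, hc.eq_iff _ _ (hmono huv)]
    constructor
    · intro h t ht
      exact h ⟨hmono ht.1, hmono ht.2⟩
    · intro h x hx
      obtain ⟨t, rfl⟩ := hsurj x
      exact h ⟨hmono.lt_iff_lt.1 hx.1, hmono.lt_iff_lt.1 hx.2⟩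
  · rw [Function.comp, hβ _ hu, hα]

end Subloop

/-! ### Existence of collapses -/

/-- A periodic open set of angles which is, together with its complement, a locally finite union
of nondegenerate intervals. -/
structure IsArcSet (J : Set ℝ) : Prop where
  isOpen : IsOpen J
  periodic : ∀ u, u + 2 * Real.pi ∈ J ↔ u ∈ J
  right : ∀ u, ∃ v, u < v ∧ (Set.Ioo u v ⊆ J ∨ Disjoint (Set.Ioo u v) J)
  left : ∀ u, ∃ v, v < u ∧ (Set.Ioo v u ⊆ J ∨ Disjoint (Set.Ioo v u) J)
  thick : ∀ u, u ∉ J → ∀ v w, v < u → u < w → Set.Ioo v u ⊆ J → ¬ Set.Ioo u w ⊆ J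

/-- The length of the complement of `J` on the circle. -/
def remainingLength (J : Set ℝ) : ℝ :=
  ∫ t in (0 : ℝ)..(2 * Real.pi), Set.indicator Jᶜ (fun _ => (1 : ℝ)) t

/-- The piecewise linear angular function which collapses `J` and maps `a` to `0`. -/
def collapseMap (J : Set ℝ) (a u : ℝ) : ℝ :=
  2 * Real.pi / remainingLength J * ∫ t in a..u, Set.indicator Jᶜ (fun _ => (1 : ℝ)) t

theorem collapseMap_self (J : Set ℝ) (a : ℝ) : collapseMap J a a = 0 := by simp [collapseMap]

namespace IsArcSet

variable {J : Set ℝ}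

theorem intervalIntegrable (hJ : IsArcSet J) (u v : ℝ) :
    IntervalIntegrable (Set.indicator Jᶜ fun _ => (1 : ℝ)) MeasureTheory.volume u v := by
  rw [intervalIntegrable_iff]
  have h : MeasureTheory.IntegrableOn (fun _ : ℝ => (1 : ℝ)) (Set.uIoc u v)
      MeasureTheory.volume := by
    rw [← intervalIntegrable_iff]
    exact intervalIntegrable_const
  exact MeasureTheory.Integrable.indicator h hJ.isOpen.measurableSet.compl

theorem integral_eq {u v : ℝ} (huv : u ≤ v) (h : Disjoint (Set.Ioo u v) J) :
    ∫ t in u..v, Set.indicator Jᶜ (fun _ => (1 : ℝ)) t = v - u := by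
  have : ∫ t in u..v, Set.indicator Jᶜ (fun _ => (1 : ℝ)) t = ∫ t in u..v, (1 : ℝ) := by
    rw [intervalIntegral.integral_of_le huv, intervalIntegral.integral_of_le huv,
      MeasureTheory.integral_Ioc_eq_integral_Ioo, MeasureTheory.integral_Ioc_eq_integral_Ioo]
    refine MeasureTheory.setIntegral_congr_fun measurableSet_Ioo fun t ht => ?_
    exact Set.indicator_of_mem (s := Jᶜ) (Set.disjoint_left.1 h ht) _
  rw [this]
  simp

theorem integral_eq_zero {u v : ℝ} (huv : u ≤ v) (h : Set.Ioo u v ⊆ J) :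
    ∫ t in u..v, Set.indicator Jᶜ (fun _ => (1 : ℝ)) t = 0 := by
  rw [intervalIntegral.integral_of_le huv, MeasureTheory.integral_Ioc_eq_integral_Ioo]
  rw [← MeasureTheory.integral_zero ℝ ℝ (μ := MeasureTheory.volume.restrict (Set.Ioo u v))]
  refine MeasureTheory.setIntegral_congr_fun measurableSet_Ioo fun t ht => ?_
  exact Set.indicator_of_notMem (s := Jᶜ) (fun h' => h' (h ht)) _

theorem integral_nonneg (J : Set ℝ) {u v : ℝ} (huv : u ≤ v) :
    0 ≤ ∫ t in u..v, Set.indicator Jᶜ (fun _ => (1 : ℝ)) t :=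
  intervalIntegral.integral_nonneg huv fun t _ => Set.indicator_nonneg (fun _ _ => zero_le_one) t

/-- The condition `thick` leaves a nondegenerate interval free of J on at least one side of a point
outside J. -/
theorem integral_pos (hJ : IsArcSet J) {u v x : ℝ} (hx : x ∈ Set.Ioo u v) (hxJ : x ∉ J) :
    0 < ∫ t in u..v, Set.indicator Jᶜ (fun _ => (1 : ℝ)) t := by
  have hle : ∀ s t, u ≤ s → s < t → t ≤ v → Disjoint (Set.Ioo s t) J →
      0 < ∫ t in u..v, Set.indicator Jᶜ (fun _ => (1 : ℝ)) t := by
    intro s t hus hst htv hd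
    rw [← intervalIntegral.integral_add_adjacent_intervals (hJ.intervalIntegrable u t)
      (hJ.intervalIntegrable t v), ← intervalIntegral.integral_add_adjacent_intervals
      (hJ.intervalIntegrable u s) (hJ.intervalIntegrable s t), integral_eq hst.le hd]
    linarith [integral_nonneg J hus, integral_nonneg J htv]
  obtain ⟨w, hw, h1⟩ := hJ.right x
  obtain ⟨w', hw', h2⟩ := hJ.left x
  rcases h1 with h1 | h1
  · rcases h2 with h2 | h2
    · exact absurd h1 (hJ.thick x hxJ w' w hw' hw h2)
    · refine hle (max w' u) x (le_max_right _ _) (max_lt hw' hx.1) hx.2.le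
        (h2.mono_left (Set.Ioo_subset_Ioo_left (le_max_left _ _)))
  · exact hle x (min w v) hx.1.le (lt_min hw hx.2) (min_le_right _ _)
      (h1.mono_left (Set.Ioo_subset_Ioo_right (min_le_left _ _)))

theorem indicator_periodic (hJ : IsArcSet J) :
    Function.Periodic (Set.indicator Jᶜ fun _ => (1 : ℝ)) (2 * Real.pi) := fun u => by
  by_cases h : u ∈ J
  · have h1 : u ∉ Jᶜ := fun h' => h' h
    have h2 : u + 2 * Real.pi ∉ Jᶜ := fun h' => h' ((hJ.periodic u).2 h)
    rw [Set.indicator_of_notMem h1, Set.indicator_of_notMem h2]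
  · have h1 : u ∈ Jᶜ := h
    have h2 : u + 2 * Real.pi ∈ Jᶜ := fun h' => h ((hJ.periodic u).1 h')
    rw [Set.indicator_of_mem h1, Set.indicator_of_mem h2]

theorem remainingLength_pos (hJ : IsArcSet J) {a : ℝ} (ha : a ∉ J) : 0 < remainingLength J := by
  have hp := Real.two_pi_pos
  have h1 := hJ.indicator_periodic.intervalIntegral_add_eq 0 (a - Real.pi)
  rw [zero_add] at h1
  rw [remainingLength, h1]
  exact hJ.integral_pos (x := a) ⟨by linarith, by linarith⟩ ha

theorem collapseMap_sub (hJ : IsArcSet J) (a u v : ℝ) : collapseMap J a v - collapseMap J a u =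
    2 * Real.pi / remainingLength J * ∫ t in u..v, Set.indicator Jᶜ (fun _ => (1 : ℝ)) t := by
  rw [collapseMap, collapseMap, ← mul_sub, intervalIntegral.integral_interval_sub_left
    (hJ.intervalIntegrable a v) (hJ.intervalIntegrable a u)]

theorem collapseMap_slope_pos (hJ : IsArcSet J) {a : ℝ} (ha : a ∉ J) :
    0 < 2 * Real.pi / remainingLength J :=
  div_pos Real.two_pi_pos (hJ.remainingLength_pos ha)

/-- Division by the remaining length normalizes the degree to one. The integral of the indicator
vanishes on an interval exactly when J contains its interior, by positivity near every remaining
point. -/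
theorem isCollapse (hJ : IsArcSet J) {a : ℝ} (ha : a ∉ J) : IsCollapse J (collapseMap J a) where
  continuous := by
    refine continuous_const.mul ?_
    exact intervalIntegral.continuous_primitive hJ.intervalIntegrable a
  monotone u v huv := by
    have h1 := hJ.collapseMap_sub a u v
    have h2 := mul_nonneg (hJ.collapseMap_slope_pos ha).le (integral_nonneg J huv)
    linarith
  add_period u := by
    have h1 := hJ.collapseMap_sub a u (u + 2 * Real.pi)
    rw [hJ.indicator_periodic.intervalIntegral_add_eq u 0, zero_add] at h1
    have h2 := (hJ.remainingLength_pos ha).ne'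
    rw [← remainingLength, div_mul_cancel₀ _ h2] at h1
    linarith
  eq_iff u v huv := by
    have h1 := hJ.collapseMap_sub a u v
    have h3 := hJ.collapseMap_slope_pos ha
    constructor
    · intro h x hx
      by_contra hxJ
      have h2 := mul_pos h3 (hJ.integral_pos hx hxJ)
      linarith
    · intro h
      rw [integral_eq_zero huv.le h, mul_zero] at h1
      linarith

theorem collapseMap_sub_eq (hJ : IsArcSet J) (a : ℝ) {u v : ℝ} (huv : u ≤ v)
    (h : Disjoint (Set.Ioo u v) J) :
    collapseMap J a v - collapseMap J a u = 2 * Real.pi / remainingLength J * (v - u) := by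
  rw [hJ.collapseMap_sub, integral_eq huv h]

end IsArcSet

/-! ### Existence of subloops -/

section Subloop

variable {M : Type*} [TopologicalSpace M] [ChartedSpace (EuclideanHalfSpace 2) M]

/-- The set of times `J` can be removed from the loop `α`: the arcs in `J` are subloops. -/
structure IsRemovable (α : PointedLoop M) (J : Set ℝ) (a : ℝ) : Prop extends IsArcSet J where
  glue : ∀ u v, u < v → u ∉ J → v ∉ J → Set.Ioo u v ⊆ J → α.path u = α.path v
  exp_ne : ∀ u v, u < v → u ∉ J → v ∉ J → Set.Ioo u v ⊆ J → Circle.exp u ≠ Circle.exp v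
  start_notMem : a ∉ J
  -- The second alternative is for the outer loops: their base point is a crossing of α, but its two
  -- passages are glued together.
  start : α.path a ∉ α.crossings ∨ ∃ v, v < a ∧ v ∉ J ∧ Set.Ioo v a ⊆ J

/-- A right inverse of `collapseMap` with values in the complement of `J`. -/
def collapseInv (J : Set ℝ) (a x : ℝ) : ℝ :=
  Classical.epsilon fun u => u ∉ J ∧ collapseMap J a u = x

/-- The path which runs through the remaining times. -/
def subloopPath (α : PointedLoop M) (J : Set ℝ) (a x : ℝ) : M := α.path (collapseInv J a x)

theorem linearIndependent_of_det₂ {v w : Plane} (h : det₂ v w ≠ 0) :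
    LinearIndependent ℝ ![v, w] := by
  rw [LinearIndependent.pair_iff]
  intro s t hst
  have h0 := congrFun (congrArg WithLp.ofLp hst) 0
  have h1 := congrFun (congrArg WithLp.ofLp hst) 1
  simp at h0 h1
  have e1 : s * det₂ v w = 0 := by simp only [det₂]; linear_combination w 1 * h0 - w 0 * h1
  have e2 : t * det₂ v w = 0 := by simp only [det₂]; linear_combination v 0 * h1 - v 1 * h0
  exact ⟨(mul_eq_zero.1 e1).resolve_right h, (mul_eq_zero.1 e2).resolve_right h⟩

theorem not_sameRay_neg_of_linearIndependent {v w : Plane} (h : LinearIndependent ℝ ![v, w]) :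
    ¬ SameRay ℝ (-v) w := fun h' => by
  have h1 : SameRay ℝ v (-w) := by simpa using h'.neg
  exact sameRay_or_sameRay_neg_iff_not_linearIndependent.1 (Or.inr h1) h

namespace IsRemovable

variable {α : PointedLoop M} {J : Set ℝ} {a : ℝ}

theorem collapseInv_spec (h : IsRemovable α J a) (x : ℝ) :
    collapseInv J a x ∉ J ∧ collapseMap J a (collapseInv J a x) = x :=
  Classical.epsilon_spec (p := fun u => u ∉ J ∧ collapseMap J a u = x)
    ((h.isCollapse h.start_notMem).exists_notMem h.isOpen x)

theorem path_eq_of_collapseMap_eq (h : IsRemovable α J a) {u v : ℝ} (hu : u ∉ J) (hv : v ∉ J)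
    (huv : collapseMap J a u = collapseMap J a v) : α.path u = α.path v := by
  have hc := h.isCollapse h.start_notMem
  rcases lt_trichotomy u v with h1 | h1 | h1
  · exact h.glue u v h1 hu hv ((hc.eq_iff u v h1).1 huv)
  · rw [h1]
  · exact (h.glue v u h1 hv hu ((hc.eq_iff v u h1).1 huv.symm)).symm

theorem subloopPath_collapseMap (h : IsRemovable α J a) {u : ℝ} (hu : u ∉ J) :
    subloopPath α J a (collapseMap J a u) = α.path u := by
  obtain ⟨h1, h2⟩ := h.collapseInv_spec (collapseMap J a u)
  exact h.path_eq_of_collapseMap_eq h1 hu h2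

theorem exists_notMem (h : IsRemovable α J a) (x : ℝ) : ∃ u, u ∉ J ∧ collapseMap J a u = x :=
  ⟨_, h.collapseInv_spec x⟩

theorem subloopPath_periodic (h : IsRemovable α J a) :
    Function.Periodic (subloopPath α J a) (2 * Real.pi) := fun x => by
  obtain ⟨u, hu, rfl⟩ := h.exists_notMem x
  have hc := h.isCollapse h.start_notMem
  rw [← hc.add_period, h.subloopPath_collapseMap hu, h.subloopPath_collapseMap
    (fun h' => hu ((h.periodic u).1 h')), α.path_periodic]

theorem subloopPath_congr (h : IsRemovable α J a) {x y : ℝ} (hxy : Circle.exp x = Circle.exp y) :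
    subloopPath α J a x = subloopPath α J a y := by
  obtain ⟨k, rfl⟩ := exp_eq_iff.1 hxy
  exact h.subloopPath_periodic.int_mul k y

/-- At the last time b with image x, the interval to the right cannot be collapsed. The collapse is
affine there, and the subloop is locally an affine reparametrization of α. -/
theorem exists_right (h : IsRemovable α J a) (x : ℝ) : ∃ b, b ∉ J ∧ collapseMap J a b = x ∧
    (∀ u, collapseMap J a u = x → u ≤ b) ∧ ∃ ε > 0, ∀ y ∈ Set.Ico x (x + ε),
      subloopPath α J a y = α.path (b + (2 * Real.pi / remainingLength J)⁻¹ * (y - x)) := by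
  have hc := h.isCollapse h.start_notMem
  have hκ := h.collapseMap_slope_pos h.start_notMem
  obtain ⟨b, hb, rfl, hmax⟩ := hc.exists_max h.isOpen x
  refine ⟨b, hb, rfl, hmax, ?_⟩
  obtain ⟨w, hw, h1⟩ := h.right b
  have h2 : Disjoint (Set.Ioo b w) J := h1.resolve_left fun h1 => by
    have := hmax w ((hc.eq_iff b w hw).2 h1).symm
    linarith
  refine ⟨2 * Real.pi / remainingLength J * (w - b), mul_pos hκ (by linarith), fun y hy => ?_⟩
  set κ := 2 * Real.pi / remainingLength J
  have hz1 : 0 ≤ κ⁻¹ * (y - collapseMap J a b) :=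
    mul_nonneg (inv_nonneg.2 hκ.le) (by linarith [hy.1])
  have hz2 : κ⁻¹ * (y - collapseMap J a b) < w - b := by
    rw [inv_mul_lt_iff₀ hκ]; linarith [hy.2]
  set z := κ⁻¹ * (y - collapseMap J a b) with hz
  have hbz : b + z ∉ J := by
    rcases hz1.eq_or_lt with h3 | h3
    · rwa [← h3, add_zero]
    · exact Set.disjoint_left.1 h2 ⟨by linarith, by linarith⟩
  have h3 := h.collapseMap_sub_eq a (u := b) (v := b + z) (by linarith)
    (h2.mono_left (Set.Ioo_subset_Ioo_right (by linarith)))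
  have h4 : collapseMap J a (b + z) = y := by
    rw [add_sub_cancel_left] at h3
    have : κ * z = y - collapseMap J a b := by rw [hz, mul_inv_cancel_left₀ hκ.ne']
    linarith
  rw [← h.subloopPath_collapseMap hbz, h4]

theorem exists_left (h : IsRemovable α J a) (x : ℝ) : ∃ b, b ∉ J ∧ collapseMap J a b = x ∧
    (∀ u, collapseMap J a u = x → b ≤ u) ∧ ∃ ε > 0, ∀ y ∈ Set.Ioc (x - ε) x,
      subloopPath α J a y = α.path (b + (2 * Real.pi / remainingLength J)⁻¹ * (y - x)) := by
  have hc := h.isCollapse h.start_notMem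
  have hκ := h.collapseMap_slope_pos h.start_notMem
  obtain ⟨b, hb, rfl, hmin⟩ := hc.exists_min h.isOpen x
  refine ⟨b, hb, rfl, hmin, ?_⟩
  obtain ⟨w, hw, h1⟩ := h.left b
  have h2 : Disjoint (Set.Ioo w b) J := h1.resolve_left fun h1 => by
    have := hmin w ((hc.eq_iff w b hw).2 h1)
    linarith
  refine ⟨2 * Real.pi / remainingLength J * (b - w), mul_pos hκ (by linarith), fun y hy => ?_⟩
  set κ := 2 * Real.pi / remainingLength J
  have hz1 : κ⁻¹ * (y - collapseMap J a b) ≤ 0 :=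
    mul_nonpos_of_nonneg_of_nonpos (inv_nonneg.2 hκ.le) (by linarith [hy.2])
  have hz2 : -(b - w) < κ⁻¹ * (y - collapseMap J a b) := by
    rw [lt_inv_mul_iff₀ hκ]; linarith [hy.1]
  set z := κ⁻¹ * (y - collapseMap J a b) with hz
  have hbz : b + z ∉ J := by
    rcases hz1.eq_or_lt with h3 | h3
    · rwa [h3, add_zero]
    · exact Set.disjoint_left.1 h2 ⟨by linarith, by linarith⟩
  have h3 := h.collapseMap_sub_eq a (u := b + z) (v := b) (by linarith)
    (h2.mono_left (Set.Ioo_subset_Ioo_left (by linarith)))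
  have h4 : collapseMap J a (b + z) = y := by
    rw [sub_add_cancel_left] at h3
    have : κ * z = y - collapseMap J a b := by rw [hz, mul_inv_cancel_left₀ hκ.ne']
    linarith
  rw [← h.subloopPath_collapseMap hbz, h4]

/-- The crossings of the subloop are not at the points where arcs are collapsed. -/
theorem collapse_single (h : IsRemovable α J a) {u v : ℝ} (hu : u ∉ J)
    (huv : α.path u = α.path v)
    (hne : Circle.exp (collapseMap J a u) ≠ Circle.exp (collapseMap J a v)) {w : ℝ}
    (hw : collapseMap J a w = collapseMap J a u) : w = u := by
  have hc := h.isCollapse h.start_notMem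
  by_contra hwu
  obtain ⟨s, hs, hsu, hmin⟩ := hc.exists_min h.isOpen (collapseMap J a u)
  obtain ⟨t, ht, htu, hmax⟩ := hc.exists_max h.isOpen (collapseMap J a u)
  have hst : s < t := by
    have h1 := hmin w hw
    have h2 := hmin u rfl
    have h3 := hmax w hw
    have h4 := hmax u rfl
    rcases lt_or_gt_of_ne hwu with h5 | h5 <;> linarith
  have hsub := (hc.eq_iff s t hst).1 (hsu.trans htu.symm)
  have hne' := h.exp_ne s t hst hs ht hsub
  have hpath := h.glue s t hst hs ht hsub
  have hps := h.path_eq_of_collapseMap_eq hs hu hsu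
  -- If the fibre were an interval [s, t], the point would be passed at s, t and v, which is one
  -- passage too many.
  rcases α.exp_eq_of_path_eq (u := v) (v := s) (w := t) (by rw [hps, huv])
    (by rw [← hpath, hps, huv]) with h1 | h1 | h1
  · exact hne (by rw [← hsu]; exact (hc.exp_congr h1).symm)
  · exact hne (by rw [← htu]; exact (hc.exp_congr h1).symm)
  · exact hne' h1

/-- Near a crossing, the subloop is an affine reparametrization of the loop. -/
theorem eventually_eq_of_single (h : IsRemovable α J a) {u : ℝ}
    (hsingle : ∀ w, collapseMap J a w = collapseMap J a u → w = u) :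
    ∀ᶠ y in nhds (collapseMap J a u), subloopPath α J a y =
      α.path (u + (2 * Real.pi / remainingLength J)⁻¹ * (y - collapseMap J a u)) := by
  obtain ⟨b, -, hb, -, ε, hε, h1⟩ := h.exists_right (collapseMap J a u)
  obtain ⟨b', -, hb', -, ε', hε', h2⟩ := h.exists_left (collapseMap J a u)
  rw [hsingle b hb] at h1
  rw [hsingle b' hb'] at h2
  filter_upwards [Ioo_mem_nhds (show collapseMap J a u - ε' < collapseMap J a u by linarith)
    (show collapseMap J a u < collapseMap J a u + ε by linarith)] with y hy
  rcases le_total (collapseMap J a u) y with h3 | h3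
  · exact h1 y ⟨h3, hy.2⟩
  · exact h2 y ⟨hy.1, h3⟩

theorem subloopPath_eq (h : IsRemovable α J a) {x y : ℝ}
    (hxy : subloopPath α J a x = subloopPath α J a y) (hne : Circle.exp x ≠ Circle.exp y) :
    ∃ u v, u ∉ J ∧ v ∉ J ∧ collapseMap J a u = x ∧ collapseMap J a v = y ∧ α.path u = α.path v ∧
      Circle.exp u ≠ Circle.exp v ∧ (∀ w, collapseMap J a w = collapseMap J a u → w = u) ∧
      (∀ w, collapseMap J a w = collapseMap J a v → w = v) := by
  have hc := h.isCollapse h.start_notMem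
  obtain ⟨u, hu, rfl⟩ := h.exists_notMem x
  obtain ⟨v, hv, rfl⟩ := h.exists_notMem y
  rw [h.subloopPath_collapseMap hu, h.subloopPath_collapseMap hv] at hxy
  exact ⟨u, v, hu, hv, rfl, rfl, hxy, fun h' => hne (hc.exp_congr h'),
    fun w hw => h.collapse_single hu hxy hne hw,
    fun w hw => h.collapse_single hv hxy.symm hne.symm hw⟩

theorem velocity_right (h : IsRemovable α J a) (x : ℝ) : ∃ b, b ∉ J ∧ collapseMap J a b = x ∧
    (∀ u, collapseMap J a u = x → u ≤ b) ∧ velocity (subloopPath α J a) (Set.Ici x) x =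
      (2 * Real.pi / remainingLength J)⁻¹ • velocity α.path (Set.Ici b) b := by
  obtain ⟨b, hb, hbx, hmax, ε, hε, h1⟩ := h.exists_right x
  have hκ := inv_pos.2 (h.collapseMap_slope_pos h.start_notMem)
  refine ⟨b, hb, hbx, hmax, velocity_eq_smul (fun y hy => ?_) ?_ ?_
    (uniqueDiffOn_Ici x x Set.self_mem_Ici) (α.path_immersed_right b)⟩
  · have : 0 ≤ y - x := sub_nonneg.2 hy
    simpa using mul_nonneg hκ.le this
  · filter_upwards [Ico_mem_nhdsGE (show x < x + ε by linarith)] with y hy using h1 y hy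
  · simpa using h1 x ⟨le_rfl, by linarith⟩

theorem velocity_left (h : IsRemovable α J a) (x : ℝ) : ∃ b, b ∉ J ∧ collapseMap J a b = x ∧
    (∀ u, collapseMap J a u = x → b ≤ u) ∧ velocity (subloopPath α J a) (Set.Iic x) x =
      (2 * Real.pi / remainingLength J)⁻¹ • velocity α.path (Set.Iic b) b := by
  obtain ⟨b, hb, hbx, hmin, ε, hε, h1⟩ := h.exists_left x
  have hκ := inv_pos.2 (h.collapseMap_slope_pos h.start_notMem)
  refine ⟨b, hb, hbx, hmin, velocity_eq_smul (fun y hy => ?_) ?_ ?_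
    (uniqueDiffOn_Iic x x Set.self_mem_Iic) (α.path_immersed_left b)⟩
  · have : y - x ≤ 0 := sub_nonpos.2 hy
    simpa using mul_nonpos_of_nonneg_of_nonpos hκ.le this
  · filter_upwards [Ioc_mem_nhdsLE (show x - ε < x by linarith)] with y hy using h1 y hy
  · simpa using h1 x ⟨by linarith, le_rfl⟩

theorem velocity_crossing (h : IsRemovable α J a) {u : ℝ} (hu : u ∉ J)
    (hsingle : ∀ w, collapseMap J a w = collapseMap J a u → w = u)
    (hcross : α.path u ∈ α.crossings) :
    velocity (subloopPath α J a) Set.univ (collapseMap J a u) =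
      (2 * Real.pi / remainingLength J)⁻¹ • velocity α.path Set.univ u := by
  refine velocity_eq_smul (fun y _ => trivial) ?_ ?_ uniqueDiffWithinAt_univ
    (α.velocity_ne_zero_of_crossing hcross)
  · rw [nhdsWithin_univ]
    exact h.eventually_eq_of_single hsingle
  · exact h.subloopPath_collapseMap hu

theorem contMDiff_affine (b κ x : ℝ) :
    ContMDiff 𝓘(ℝ, ℝ) 𝓘(ℝ, ℝ) ∞ fun y : ℝ => b + κ * (y - x) :=
  (contDiff_const.add (contDiff_const.mul (contDiff_id.sub contDiff_const))).contMDiff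

theorem subloopPath_smooth_right (h : IsRemovable α J a) (x : ℝ) : ∃ v, x < v ∧
    ContMDiffOn 𝓘(ℝ, ℝ) (𝓡∂ 2) ∞ (subloopPath α J a) (Set.Icc x v) := by
  obtain ⟨b, hb, hbx, hmax, ε, hε, h1⟩ := h.exists_right x
  have hκ := h.collapseMap_slope_pos h.start_notMem
  obtain ⟨w, hw, h2⟩ := α.path_smooth_right b
  set κ := 2 * Real.pi / remainingLength J
  have h3 : 0 < min (ε / 2) (κ * (w - b)) := lt_min (by linarith) (mul_pos hκ (by linarith))
  refine ⟨x + min (ε / 2) (κ * (w - b)), by linarith, ?_⟩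
  refine ContMDiffOn.congr (f := α.path ∘ fun y => b + κ⁻¹ * (y - x)) ?_ fun y hy => ?_
  · refine h2.comp (contMDiff_affine b κ⁻¹ x).contMDiffOn fun y hy => ⟨?_, ?_⟩
    · have := mul_nonneg (inv_nonneg.2 hκ.le) (sub_nonneg.2 hy.1)
      linarith
    · have h4 : y - x ≤ κ * (w - b) := by
        linarith [hy.2, min_le_right (ε / 2) (κ * (w - b))]
      rw [← inv_mul_le_iff₀ hκ] at h4
      linarith
  · exact h1 y ⟨hy.1, by linarith [hy.2, min_le_left (ε / 2) (κ * (w - b))]⟩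

theorem subloopPath_smooth_left (h : IsRemovable α J a) (x : ℝ) : ∃ v, v < x ∧
    ContMDiffOn 𝓘(ℝ, ℝ) (𝓡∂ 2) ∞ (subloopPath α J a) (Set.Icc v x) := by
  obtain ⟨b, hb, hbx, hmax, ε, hε, h1⟩ := h.exists_left x
  have hκ := h.collapseMap_slope_pos h.start_notMem
  obtain ⟨w, hw, h2⟩ := α.path_smooth_left b
  set κ := 2 * Real.pi / remainingLength J
  have h3 : 0 < min (ε / 2) (κ * (b - w)) := lt_min (by linarith) (mul_pos hκ (by linarith))
  refine ⟨x - min (ε / 2) (κ * (b - w)), by linarith, ?_⟩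
  refine ContMDiffOn.congr (f := α.path ∘ fun y => b + κ⁻¹ * (y - x)) ?_ fun y hy => ?_
  · refine h2.comp (contMDiff_affine b κ⁻¹ x).contMDiffOn fun y hy => ⟨?_, ?_⟩
    · have h4 : -(κ * (b - w)) ≤ y - x := by
        linarith [hy.1, min_le_right (ε / 2) (κ * (b - w))]
      have h5 : -(b - w) ≤ κ⁻¹ * (y - x) := by
        rw [le_inv_mul_iff₀ hκ]; linarith
      linarith
    · have := mul_nonpos_of_nonneg_of_nonpos (inv_nonneg.2 hκ.le) (sub_nonpos.2 hy.2)
      linarith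
  · exact h1 y ⟨by linarith [hy.1, min_le_left (ε / 2) (κ * (b - w))], hy.2⟩

theorem continuous_subloopPath (h : IsRemovable α J a) : Continuous (subloopPath α J a) := by
  rw [continuous_iff_continuousAt]
  intro x
  rw [continuousAt_iff_continuous_left_right]
  obtain ⟨v, hv, h1⟩ := h.subloopPath_smooth_left x
  obtain ⟨w, hw, h2⟩ := h.subloopPath_smooth_right x
  exact ⟨(h1.continuousOn x ⟨hv.le, le_rfl⟩).mono_of_mem_nhdsWithin (Icc_mem_nhdsLE hv),
    (h2.continuousOn x ⟨le_rfl, hw.le⟩).mono_of_mem_nhdsWithin (Icc_mem_nhdsGE hw)⟩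

/-- Away from collapsed intervals this is inherited from α. At a collapsed interval the one-sided
velocities belong to two transversal branches of a crossing, so the new corner is not a cusp. -/
theorem subloopPath_no_cusp (h : IsRemovable α J a) (x : ℝ) :
    ¬ SameRay ℝ (-velocity (subloopPath α J a) (Set.Iic x) x)
      (velocity (subloopPath α J a) (Set.Ici x) x) := by
  have hc := h.isCollapse h.start_notMem
  have hκ := h.collapseMap_slope_pos h.start_notMem
  obtain ⟨b, hb, hbx, hmax, h1⟩ := h.velocity_right x
  obtain ⟨s, hs, hsx, hmin, h2⟩ := h.velocity_left x
  rw [h1, h2, ← smul_neg]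
  intro hray
  have hray' : SameRay ℝ (-velocity α.path (Set.Iic s) s) (velocity α.path (Set.Ici b) b) := by
    have := hray.map (LinearMap.lsmul ℝ Plane (2 * Real.pi / remainingLength J))
    simpa only [LinearMap.lsmul_apply, smul_smul, mul_inv_cancel₀ hκ.ne', one_smul] using this
  rcases (hmin b hbx).eq_or_lt with h3 | h3
  · subst h3
    exact α.path_no_cusp s hray'
  · have hsub := (hc.eq_iff s b h3).1 (hsx.trans hbx.symm)
    have hp := h.glue s b h3 hs hb hsub
    have hne := h.exp_ne s b h3 hs hb hsub
    have hcs := α.path_mem_crossings hp hne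
    have hcb : α.path b ∈ α.crossings := hp ▸ hcs
    have e1 : velocity α.path (Set.Iic s) s = (1 : ℝ) • velocity α.path Set.univ s :=
      velocity_eq_smul (fun _ _ => trivial) (Filter.Eventually.of_forall fun y => by congr 1; ring)
        rfl (uniqueDiffOn_Iic s s Set.self_mem_Iic) (α.velocity_ne_zero_of_crossing hcs)
    have e2 : velocity α.path (Set.Ici b) b = (1 : ℝ) • velocity α.path Set.univ b :=
      velocity_eq_smul (fun _ _ => trivial) (Filter.Eventually.of_forall fun y => by congr 1; ring)
        rfl (uniqueDiffOn_Ici b b Set.self_mem_Ici) (α.velocity_ne_zero_of_crossing hcb)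
    rw [e1, e2, one_smul, one_smul] at hray'
    exact not_sameRay_neg_of_linearIndependent (α.path_transversal hne hp) hray'

theorem subloopPath_arg (h : IsRemovable α J a) (t : ℝ) :
    subloopPath α J a (Complex.arg (Circle.exp t)) = subloopPath α J a t :=
  h.subloopPath_congr (Circle.exp_arg _)

theorem crossings_subset (h : IsRemovable α J a) :
    selfCrossings (fun z : Circle => subloopPath α J a (Complex.arg z)) ⊆ α.crossings := by
  rintro p ⟨z, w, hzw, hz, hw⟩
  obtain ⟨x, rfl⟩ := Circle.exp_surjective z
  obtain ⟨y, rfl⟩ := Circle.exp_surjective w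
  simp only [h.subloopPath_arg] at hz hw
  obtain ⟨u, v, hu, hv, rfl, rfl, hp, hne, -, -⟩ := h.subloopPath_eq (hz.trans hw.symm) hzw
  rw [← hz, h.subloopPath_collapseMap hu]
  exact α.path_mem_crossings hp hne

end IsRemovable

/-- The subloop of `α` which runs through the times not in `J` and starts at time `a`. -/
def subloop (α : PointedLoop M) (J : Set ℝ) (a : ℝ) (h : IsRemovable α J a) : PointedLoop M where
  toFun z := subloopPath α J a (Complex.arg z)
  continuous := by
    rw [isQuotientMap_exp.continuous_iff]
    convert! h.continuous_subloopPath using 1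
    exact funext h.subloopPath_arg
  interior z := α.path_mem_interior _
  smooth_right u := by
    simp only [h.subloopPath_arg]
    exact h.subloopPath_smooth_right u
  smooth_left u := by
    simp only [h.subloopPath_arg]
    exact h.subloopPath_smooth_left u
  immersed_right u := by
    simp only [h.subloopPath_arg]
    obtain ⟨b, -, -, -, h1⟩ := h.velocity_right u
    rw [show velocity (fun t => subloopPath α J a t) (Set.Ici u) u = _ from h1]
    exact smul_ne_zero (inv_ne_zero (h.collapseMap_slope_pos h.start_notMem).ne')
      (α.path_immersed_right b)
  immersed_left u := by
    simp only [h.subloopPath_arg]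
    obtain ⟨b, -, -, -, h1⟩ := h.velocity_left u
    rw [show velocity (fun t => subloopPath α J a t) (Set.Iic u) u = _ from h1]
    exact smul_ne_zero (inv_ne_zero (h.collapseMap_slope_pos h.start_notMem).ne')
      (α.path_immersed_left b)
  no_cusp u := by
    simp only [h.subloopPath_arg]
    exact h.subloopPath_no_cusp u
  finite_crossings := α.finite_crossings.subset h.crossings_subset
  double p := by
    by_contra! hlt
    obtain ⟨t, hts, ht⟩ := Set.exists_subset_encard_eq (Order.add_one_le_of_lt hlt)
    obtain ⟨z₁, z₂, z₃, h12, h13, h23, rfl⟩ := Set.encard_eq_three.1 (ht.trans (by norm_num))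
    have hc := h.isCollapse h.start_notMem
    -- Three points of the subloop over p lift to three times of α; equality of two of them on the
    -- circle would persist after the collapse.
    have hrep : ∀ z ∈ ({z₁, z₂, z₃} : Set Circle),
        ∃ u, Circle.exp (collapseMap J a u) = z ∧ α.path u = p := fun z hz => by
      obtain ⟨x, rfl⟩ := Circle.exp_surjective z
      obtain ⟨u, hu, rfl⟩ := h.exists_notMem x
      have h1 := hts hz
      simp only [Set.mem_preimage, Set.mem_singleton_iff, h.subloopPath_arg,
        h.subloopPath_collapseMap hu] at h1
      exact ⟨u, rfl, h1⟩
    obtain ⟨u₁, rfl, h1⟩ := hrep z₁ (by simp)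
    obtain ⟨u₂, rfl, h2⟩ := hrep z₂ (by simp)
    obtain ⟨u₃, rfl, h3⟩ := hrep z₃ (by simp)
    rcases α.exp_eq_of_path_eq (h1.trans h2.symm) (h1.trans h3.symm) with h4 | h4 | h4
    · exact h12 (hc.exp_congr h4)
    · exact h13 (hc.exp_congr h4)
    · exact h23 (hc.exp_congr h4)
  smooth_at_crossing u hu := by
    simp only [h.subloopPath_arg]
    obtain ⟨z, w, hzw, hz, hw⟩ := hu
    have hex : ∃ y, subloopPath α J a u = subloopPath α J a y ∧ Circle.exp u ≠ Circle.exp y := by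
      obtain ⟨x, rfl⟩ := Circle.exp_surjective z
      obtain ⟨y, rfl⟩ := Circle.exp_surjective w
      simp only [h.subloopPath_arg] at hz hw
      by_cases hux : Circle.exp u = Circle.exp x
      · exact ⟨y, hw.symm, hux ▸ hzw⟩
      · exact ⟨x, hz.symm, hux⟩
    obtain ⟨y, hy, hne⟩ := hex
    obtain ⟨s, t, hs, ht, rfl, rfl, hp, hne', hsing, -⟩ := h.subloopPath_eq hy hne
    have h1 : ContMDiffAt 𝓘(ℝ, ℝ) (𝓡∂ 2) ∞ (α.path ∘ fun y => s +
        (2 * Real.pi / remainingLength J)⁻¹ * (y - collapseMap J a s)) (collapseMap J a s) := by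
      refine ContMDiffAt.comp _ ?_ (IsRemovable.contMDiff_affine _ _ _).contMDiffAt
      simpa using α.path_smooth_at_crossing (α.path_mem_crossings hp hne')
    exact h1.congr_of_eventuallyEq (h.eventually_eq_of_single hsing)
  transversal u v hne huv := by
    simp only [h.subloopPath_arg] at huv ⊢
    obtain ⟨s, t, hs, ht, rfl, rfl, hp, hne', hsing, hsing'⟩ := h.subloopPath_eq huv hne
    have hcs := α.path_mem_crossings hp hne'
    have hct : α.path t ∈ α.crossings := hp ▸ hcs
    have e1 := h.velocity_crossing hs hsing hcs
    have e2 := h.velocity_crossing ht hsing' hct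
    have hκ := inv_ne_zero (h.collapseMap_slope_pos h.start_notMem).ne'
    refine linearIndependent_of_det₂ ?_
    rw [show velocity (fun t => subloopPath α J a t) Set.univ (collapseMap J a s) = _ from e1,
      show velocity (fun t => subloopPath α J a t) Set.univ (collapseMap J a t) = _ from e2,
      det₂_smul_smul]
    exact mul_ne_zero (mul_ne_zero hκ hκ) (det₂_ne_zero (α.path_transversal hne' hp))
  base := α.path a
  base_mem := ⟨Circle.exp 0, by
    simp only [h.subloopPath_arg]
    rw [← collapseMap_self J a, h.subloopPath_collapseMap h.start_notMem]⟩
  base_not_crossing := by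
    rintro ⟨z, w, hzw, hz, hw⟩
    obtain ⟨x, rfl⟩ := Circle.exp_surjective z
    obtain ⟨y, rfl⟩ := Circle.exp_surjective w
    simp only [h.subloopPath_arg] at hz hw
    have hc := h.isCollapse h.start_notMem
    obtain ⟨u, v, hu, hv, rfl, rfl, hp, hne, hsing, hsing'⟩ :=
      h.subloopPath_eq (hz.trans hw.symm) hzw
    rw [h.subloopPath_collapseMap hu] at hz
    rcases h.start with h1 | ⟨v', hv', hv'J, hsub⟩
    · exact h1 (hz ▸ α.path_mem_crossings hp hne)
    · have hcoll := (hc.eq_iff v' a hv').2 hsub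
      -- Here a is glued to the earlier time v', whereas both passages of a crossing of the subloop
      -- have singleton fibres. The times a, u, v would therefore give three passages of α.
      have key : ∀ u, (∀ w, collapseMap J a w = collapseMap J a u → w = u) →
          Circle.exp a ≠ Circle.exp u := by
        intro u hsing hexp
        obtain ⟨k, hk⟩ := exp_eq_iff.1 hexp
        have h3 := hc.add_int u k
        rw [← hk] at h3
        have h2 := hsing (v' + (-k : ℤ) * (2 * Real.pi)) (by
          rw [hc.add_int, hcoll, h3]; push_cast; ring)
        push_cast at h2
        linarith
      rcases α.exp_eq_of_path_eq (u := a) hz.symm (hz.symm.trans hp) with h2 | h2 | h2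
      · exact key u hsing h2
      · exact key v hsing' h2
      · exact hne h2

variable {α : PointedLoop M} {J : Set ℝ} {a : ℝ}

theorem subloop_toFun_exp (h : IsRemovable α J a) (t : ℝ) :
    (subloop α J a h).toFun (Circle.exp t) = subloopPath α J a t := h.subloopPath_arg t

theorem basePreimage_subloop (h : IsRemovable α J a) : (subloop α J a h).basePreimage = 1 := by
  refine ((subloop α J a h).eq_basePreimage ?_).symm
  rw [← Circle.exp_zero, subloop_toFun_exp, ← collapseMap_self J a,
    h.subloopPath_collapseMap h.start_notMem]
  rfl

theorem path_subloop (h : IsRemovable α J a) :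
    (subloop α J a h).path = subloopPath α J a := by
  funext t
  rw [PointedLoop.path, basePreimage_subloop, one_mul, subloop_toFun_exp]

theorem path_subloop_collapseMap (h : IsRemovable α J a) {u : ℝ} (hu : u ∉ J) :
    (subloop α J a h).path (collapseMap J a u) = α.path u := by
  rw [path_subloop, h.subloopPath_collapseMap hu]

theorem isSubloop_subloop (h : IsRemovable α J a) : IsSubloop α J a (subloop α J a h) :=
  ⟨collapseMap J a, h.isCollapse h.start_notMem, collapseMap_self J a,
    fun _ hu => path_subloop_collapseMap h hu⟩

end Subloop

/-! ### Unions of arcs -/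

section ArcUnion

variable {ι : Type*}

/-- The union of the arcs `]s p, t p[`, `p ∈ H`. -/
def arcUnion (H : Finset ι) (s t : ι → ℝ) : Set ℝ :=
  {u | ∃ p ∈ H, ∃ k : ℤ, u + k * (2 * Real.pi) ∈ Set.Ioo (s p) (t p)}

/-- The closed arcs `[s p, t p]`, `p ∈ H`, are nondegenerate and pairwise disjoint on the circle. -/
structure ArcsDisjoint (H : Finset ι) (s t : ι → ℝ) : Prop where
  lt : ∀ p ∈ H, s p < t p
  eq : ∀ p ∈ H, ∀ q ∈ H, ∀ (k l : ℤ) (x : ℝ), x + k * (2 * Real.pi) ∈ Set.Icc (s p) (t p) →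
    x + l * (2 * Real.pi) ∈ Set.Icc (s q) (t q) → p = q ∧ k = l

variable {H : Finset ι} {s t : ι → ℝ}

theorem isOpen_arcUnion (H : Finset ι) (s t : ι → ℝ) : IsOpen (arcUnion H s t) := by
  have : arcUnion H s t = ⋃ p ∈ H, ⋃ k : ℤ,
      (fun u : ℝ => u + k * (2 * Real.pi)) ⁻¹' Set.Ioo (s p) (t p) := by
    ext u; simp only [arcUnion, Set.mem_ofPred_eq, Set.mem_iUnion, Set.mem_preimage, exists_prop]
  rw [this]
  exact isOpen_biUnion fun p _ => isOpen_iUnion fun k => isOpen_Ioo.preimage (by fun_prop)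

theorem arcUnion_add_int (H : Finset ι) (s t : ι → ℝ) (u : ℝ) (k : ℤ) :
    u + k * (2 * Real.pi) ∈ arcUnion H s t ↔ u ∈ arcUnion H s t := by
  constructor
  · rintro ⟨p, hp, l, h⟩
    refine ⟨p, hp, k + l, ?_⟩
    push_cast
    rwa [add_mul, ← add_assoc]
  · rintro ⟨p, hp, l, h⟩
    refine ⟨p, hp, l - k, ?_⟩
    push_cast
    rwa [sub_mul, add_add_sub_cancel]

namespace ArcsDisjoint

theorem exists_int_right (a u : ℝ) : ∃ k : ℤ, a ≤ u + k * (2 * Real.pi) ∧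
    u + k * (2 * Real.pi) < a + 2 * Real.pi := by
  have hp := Real.two_pi_pos
  refine ⟨-⌊(u - a) / (2 * Real.pi)⌋, ?_⟩
  have h1 := Int.floor_le ((u - a) / (2 * Real.pi))
  have h2 := Int.lt_floor_add_one ((u - a) / (2 * Real.pi))
  rw [le_div_iff₀ hp] at h1
  rw [div_lt_iff₀ hp] at h2
  push_cast
  constructor <;> linarith

theorem exists_int_left (a u : ℝ) : ∃ k : ℤ, a - 2 * Real.pi < u + k * (2 * Real.pi) ∧
    u + k * (2 * Real.pi) ≤ a := by
  obtain ⟨k, h1, h2⟩ := exists_int_right (-a) (-u)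
  refine ⟨-k, ?_, ?_⟩ <;> push_cast <;> linarith

theorem int_eq_of_abs_lt {k l : ℤ} {x y : ℝ} (h : |x - y| < 2 * Real.pi)
    (h' : x - y = (k - l) * (2 * Real.pi)) : k = l := by
  have hp := Real.two_pi_pos
  rw [h', abs_mul, abs_of_pos hp] at h
  have h1 : |((k - l : ℤ) : ℝ)| < 1 := by
    push_cast
    by_contra! h2
    nlinarith
  rw [← Int.cast_abs] at h1
  have h2 : |k - l| < 1 := by exact_mod_cast h1
  rw [Int.abs_lt_one_iff] at h2
  omega

/-- After a translation into [s p, s p + 2π[, the point lies at or beyond t p. The next translate of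
the arc starts only at s p + 2π. -/
theorem exists_right_single {p : ι} {u : ℝ}
    (hu : ∀ k : ℤ, u + k * (2 * Real.pi) ∉ Set.Ioo (s p) (t p))
    (hs : ∀ k : ℤ, u + k * (2 * Real.pi) ≠ s p) :
    ∃ v, u < v ∧ ∀ y ∈ Set.Ioo u v, ∀ k : ℤ, y + k * (2 * Real.pi) ∉ Set.Ioo (s p) (t p) := by
  obtain ⟨k, h1, h2⟩ := exists_int_right (s p) u
  have h3 : t p ≤ u + k * (2 * Real.pi) := by
    by_contra! h3
    exact hu k ⟨lt_of_le_of_ne h1 (hs k).symm, h3⟩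
  refine ⟨s p + 2 * Real.pi - k * (2 * Real.pi), by linarith, fun y hy l hl => ?_⟩
  have e1 := hy.1
  have e2 := hy.2
  have e3 := hl.1
  have e4 := hl.2
  have h4 : k = l := int_eq_of_abs_lt (x := y + k * (2 * Real.pi)) (y := y + l * (2 * Real.pi))
    (by rw [abs_lt]; constructor <;> linarith) (by ring)
  subst h4
  linarith

theorem exists_left_single {p : ι} {u : ℝ}
    (hu : ∀ k : ℤ, u + k * (2 * Real.pi) ∉ Set.Ioo (s p) (t p))
    (ht : ∀ k : ℤ, u + k * (2 * Real.pi) ≠ t p) :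
    ∃ v, v < u ∧ ∀ y ∈ Set.Ioo v u, ∀ k : ℤ, y + k * (2 * Real.pi) ∉ Set.Ioo (s p) (t p) := by
  obtain ⟨k, h1, h2⟩ := exists_int_left (t p) u
  have h3 : u + k * (2 * Real.pi) ≤ s p := by
    by_contra! h3
    exact hu k ⟨h3, lt_of_le_of_ne h2 (ht k)⟩
  refine ⟨t p - 2 * Real.pi - k * (2 * Real.pi), by linarith, fun y hy l hl => ?_⟩
  have e1 := hy.1
  have e2 := hy.2
  have e3 := hl.1
  have e4 := hl.2
  have h4 : k = l := int_eq_of_abs_lt (x := y + k * (2 * Real.pi)) (y := y + l * (2 * Real.pi))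
    (by rw [abs_lt]; constructor <;> linarith) (by ring)
  subst h4
  linarith

theorem exists_right {u : ℝ} (hu : u ∉ arcUnion H s t)
    (hs : ∀ p ∈ H, ∀ k : ℤ, u + k * (2 * Real.pi) ≠ s p) :
    ∃ v, u < v ∧ Disjoint (Set.Ioo u v) (arcUnion H s t) := by
  have h1 : ∀ p ∈ H, ∀ᶠ v in nhdsWithin u (Set.Ioi u),
      ∀ y ∈ Set.Ioo u v, ∀ k : ℤ, y + k * (2 * Real.pi) ∉ Set.Ioo (s p) (t p) := fun p hp => by
    obtain ⟨v, hv, h2⟩ := exists_right_single (u := u) (fun k hk => hu ⟨p, hp, k, hk⟩)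
      (hs p hp)
    filter_upwards [Ioo_mem_nhdsGT hv] with w hw y hy
    exact h2 y ⟨hy.1, hy.2.trans hw.2⟩
  obtain ⟨v, hv, huv⟩ := ((Filter.eventually_all_finset H).2 h1 |>.and self_mem_nhdsWithin).exists
  refine ⟨v, huv, Set.disjoint_left.2 ?_⟩
  rintro y hy ⟨p, hp, k, hk⟩
  exact hv p hp y hy k hk

theorem exists_left {u : ℝ} (hu : u ∉ arcUnion H s t)
    (ht : ∀ p ∈ H, ∀ k : ℤ, u + k * (2 * Real.pi) ≠ t p) :
    ∃ v, v < u ∧ Disjoint (Set.Ioo v u) (arcUnion H s t) := by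
  have h1 : ∀ p ∈ H, ∀ᶠ v in nhdsWithin u (Set.Iio u),
      ∀ y ∈ Set.Ioo v u, ∀ k : ℤ, y + k * (2 * Real.pi) ∉ Set.Ioo (s p) (t p) := fun p hp => by
    obtain ⟨v, hv, h2⟩ := exists_left_single (u := u) (fun k hk => hu ⟨p, hp, k, hk⟩)
      (ht p hp)
    filter_upwards [Ioo_mem_nhdsLT hv] with w hw y hy
    exact h2 y ⟨hw.1.trans hy.1, hy.2⟩
  obtain ⟨v, hv, huv⟩ := ((Filter.eventually_all_finset H).2 h1 |>.and self_mem_nhdsWithin).exists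
  refine ⟨v, huv, Set.disjoint_left.2 ?_⟩
  rintro y hy ⟨p, hp, k, hk⟩
  exact hv p hp y hy k hk

theorem exists_eq_left_end {u v : ℝ} (huv : u < v)
    (hu : u ∉ arcUnion H s t) (hsub : Set.Ioo u v ⊆ arcUnion H s t) :
    ∃ p ∈ H, ∃ k : ℤ, u + k * (2 * Real.pi) = s p := by
  by_contra! hs
  obtain ⟨w, hw, hd⟩ := exists_right hu hs
  have hm : u < min v w := lt_min huv hw
  have hy : (u + min v w) / 2 ∈ Set.Ioo u (min v w) := ⟨by linarith, by linarith⟩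
  exact Set.disjoint_left.1 hd ⟨hy.1, hy.2.trans_le (min_le_right _ _)⟩
    (hsub ⟨hy.1, hy.2.trans_le (min_le_left _ _)⟩)

theorem exists_eq_right_end {u v : ℝ} (huv : v < u)
    (hu : u ∉ arcUnion H s t) (hsub : Set.Ioo v u ⊆ arcUnion H s t) :
    ∃ p ∈ H, ∃ k : ℤ, u + k * (2 * Real.pi) = t p := by
  by_contra! ht
  obtain ⟨w, hw, hd⟩ := exists_left hu ht
  have hm : max v w < u := max_lt huv hw
  have hy : (max v w + u) / 2 ∈ Set.Ioo (max v w) u := ⟨by linarith, by linarith⟩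
  exact Set.disjoint_left.1 hd ⟨(le_max_right _ _).trans_lt hy.1, hy.2⟩
    (hsub ⟨(le_max_left _ _).trans_lt hy.1, hy.2⟩)

/-- A removed interval with both ends outside the union starts at the left end of some arc. It
cannot extend past the right end of this arc, since another arc covering that end would meet the
closed arc. -/
theorem exists_gap (h : ArcsDisjoint H s t) {u v : ℝ} (huv : u < v)
    (hu : u ∉ arcUnion H s t) (hv : v ∉ arcUnion H s t) (hsub : Set.Ioo u v ⊆ arcUnion H s t) :
    ∃ p ∈ H, ∃ k : ℤ, u + k * (2 * Real.pi) = s p ∧ v + k * (2 * Real.pi) = t p := by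
  obtain ⟨p, hp, k, hk⟩ := exists_eq_left_end huv hu hsub
  refine ⟨p, hp, k, hk, ?_⟩
  rcases lt_trichotomy (v + k * (2 * Real.pi)) (t p) with h1 | h1 | h1
  · exact absurd ⟨p, hp, k, by linarith, h1⟩ hv
  · exact h1
  · obtain ⟨q, hq, l, hl⟩ := hsub (show t p - k * (2 * Real.pi) ∈ Set.Ioo u v from
      ⟨by linarith [h.lt p hp], by linarith⟩)
    obtain ⟨rfl, rfl⟩ := h.eq p hp q hq k l (t p - k * (2 * Real.pi))
      ⟨by linarith [h.lt p hp], by linarith⟩ ⟨hl.1.le, hl.2.le⟩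
    linarith [hl.2]

/-- Only finitely many arcs occur up to translation, so one-sided neighbourhoods are uniform.
Disjointness of the closed arcs prevents two arcs from abutting, which is the condition `thick`. -/
theorem isArcSet (h : ArcsDisjoint H s t) : IsArcSet (arcUnion H s t) where
  isOpen := isOpen_arcUnion H s t
  periodic u := by simpa using arcUnion_add_int H s t u 1
  right u := by
    by_cases hu : u ∈ arcUnion H s t
    · obtain ⟨ε, hε, hball⟩ := Metric.isOpen_iff.1 (isOpen_arcUnion H s t) u hu
      refine ⟨u + ε, by linarith, Or.inl fun y hy => hball ?_⟩
      rw [Real.ball_eq_Ioo]; exact ⟨by linarith [hy.1], hy.2⟩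
    by_cases hs : ∃ p ∈ H, ∃ k : ℤ, u + k * (2 * Real.pi) = s p
    · obtain ⟨p, hp, k, hk⟩ := hs
      have := h.lt p hp
      exact ⟨u + (t p - s p), by linarith, Or.inl fun y hy =>
        ⟨p, hp, k, by linarith [hy.1], by linarith [hy.2]⟩⟩
    · push Not at hs
      obtain ⟨v, hv, hd⟩ := exists_right hu hs
      exact ⟨v, hv, Or.inr hd⟩
  left u := by
    by_cases hu : u ∈ arcUnion H s t
    · obtain ⟨ε, hε, hball⟩ := Metric.isOpen_iff.1 (isOpen_arcUnion H s t) u hu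
      refine ⟨u - ε, by linarith, Or.inl fun y hy => hball ?_⟩
      rw [Real.ball_eq_Ioo]; exact ⟨hy.1, by linarith [hy.2]⟩
    by_cases ht : ∃ p ∈ H, ∃ k : ℤ, u + k * (2 * Real.pi) = t p
    · obtain ⟨p, hp, k, hk⟩ := ht
      have := h.lt p hp
      exact ⟨u - (t p - s p), by linarith, Or.inl fun y hy =>
        ⟨p, hp, k, by linarith [hy.1], by linarith [hy.2]⟩⟩
    · push Not at ht
      obtain ⟨v, hv, hd⟩ := exists_left hu ht
      exact ⟨v, hv, Or.inr hd⟩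
  thick u hu v w hv hw h1 h2 := by
    obtain ⟨p, hp, k, hk⟩ := exists_eq_left_end hw hu h2
    obtain ⟨q, hq, l, hl⟩ := exists_eq_right_end hv hu h1
    obtain ⟨rfl, rfl⟩ := h.eq p hp q hq k l u ⟨hk.ge, by linarith [h.lt p hp]⟩
      ⟨by linarith [h.lt q hq], hl.le⟩
    linarith [h.lt p hp]

end ArcsDisjoint

end ArcUnion

/-! ### Removable arcs and the loops of a cut -/

section Subloop

variable {M : Type*} [TopologicalSpace M] [ChartedSpace (EuclideanHalfSpace 2) M]

theorem ArcsDisjoint.isRemovable {ι : Type*} {H : Finset ι} {s t : ι → ℝ}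
    (h : ArcsDisjoint H s t) {α : PointedLoop M} (hα : ∀ p ∈ H, α.path (s p) = α.path (t p))
    {a : ℝ} (ha : a ∉ arcUnion H s t)
    (hstart : α.path a ∉ α.crossings ∨
      ∃ v, v < a ∧ v ∉ arcUnion H s t ∧ Set.Ioo v a ⊆ arcUnion H s t) :
    IsRemovable α (arcUnion H s t) a where
  toIsArcSet := h.isArcSet
  glue u v huv hu hv hsub := by
    obtain ⟨p, hp, k, h1, h2⟩ := h.exists_gap huv hu hv hsub
    have h3 := hα p hp
    rw [← h1, ← h2] at h3
    rwa [α.path_congr (exp_eq_iff.2 ⟨k, rfl⟩ : _ = Circle.exp u),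
      α.path_congr (exp_eq_iff.2 ⟨k, rfl⟩ : _ = Circle.exp v)] at h3
  exp_ne u v huv hu hv hsub hexp := by
    obtain ⟨p, hp, k, h1, h2⟩ := h.exists_gap huv hu hv hsub
    obtain ⟨l, hl⟩ := exp_eq_iff.1 hexp
    have := (h.eq p hp p hp k (k + l) v ⟨by linarith [h.lt p hp], h2.le⟩
      (by push_cast; constructor <;> linarith [h.lt p hp])).2
    have hl0 : l = 0 := by omega
    rw [hl0] at hl
    push_cast at hl
    linarith
  start_notMem := ha
  start := hstart

namespace PointedLoop

variable (α : PointedLoop M)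

/-- The set of times `]time₁ p, time₂ p[`, `p ∈ H`. -/
def rootArcs (H : Finset M) : Set ℝ := arcUnion H α.time₁ α.time₂

/-- The set of times outside of `[time₁ p, time₂ p]`. -/
def outerArcs (p : M) : Set ℝ :=
  arcUnion {p} (fun p => α.time₂ p - 2 * Real.pi) α.time₁

/-- A set of crossings such that the closed time intervals between their two passages are pairwise
disjoint. -/
structure IsDisjointCut (H : Finset M) : Prop where
  subset : ∀ p ∈ H, p ∈ α.crossings
  disjoint : ∀ p ∈ H, ∀ q ∈ H, p ≠ q → α.time₂ p < α.time₁ q ∨ α.time₂ q < α.time₁ p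

variable {α}

theorem IsDisjointCut.arcsDisjoint {H : Finset M} (h : α.IsDisjointCut H) :
    ArcsDisjoint H α.time₁ α.time₂ where
  lt p hp := (α.time_spec (h.subset p hp)).2.1
  eq p hp q hq k l x hx hy := by
    obtain ⟨h1, h2, h3, -⟩ := α.time_spec (h.subset p hp)
    obtain ⟨h1', h2', h3', -⟩ := α.time_spec (h.subset q hq)
    have e1 := hx.1
    have e2 := hx.2
    have e3 := hy.1
    have e4 := hy.2
    have hkl : k = l := ArcsDisjoint.int_eq_of_abs_lt (x := x + k * (2 * Real.pi))
      (y := x + l * (2 * Real.pi)) (by rw [abs_lt]; constructor <;> linarith) (by ring)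
    refine ⟨?_, hkl⟩
    subst hkl
    by_contra hpq
    rcases h.disjoint p hp q hq hpq with h4 | h4 <;> linarith

theorem arcsDisjoint_outer {p : M} (hp : p ∈ α.crossings) :
    ArcsDisjoint {p} (fun p => α.time₂ p - 2 * Real.pi) α.time₁ where
  lt q hq := by
    rw [Finset.mem_singleton] at hq
    subst hq
    obtain ⟨h1, h2, h3, -⟩ := α.time_spec hp
    linarith
  eq q hq r hr k l x hx hy := by
    rw [Finset.mem_singleton] at hq hr
    subst hq
    subst hr
    obtain ⟨h1, h2, h3, -⟩ := α.time_spec hp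
    have e1 := hx.1
    have e2 := hx.2
    have e3 := hy.1
    have e4 := hy.2
    exact ⟨rfl, ArcsDisjoint.int_eq_of_abs_lt (x := x + k * (2 * Real.pi))
      (y := x + l * (2 * Real.pi)) (by rw [abs_lt]; constructor <;> linarith) (by ring)⟩

/-- Among the times in `]0, 2π[`, membership in `rootArcs` needs no translation. -/
theorem mem_rootArcs_iff {H : Finset M} (h : ∀ p ∈ H, p ∈ α.crossings) {u : ℝ}
    (hu : u ∈ Set.Icc 0 (2 * Real.pi)) :
    u ∈ α.rootArcs H ↔ ∃ p ∈ H, u ∈ Set.Ioo (α.time₁ p) (α.time₂ p) := by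
  constructor
  · rintro ⟨p, hp, k, hk⟩
    obtain ⟨h1, h2, h3, -⟩ := α.time_spec (h p hp)
    have e1 := hk.1
    have e2 := hk.2
    have hk0 : k = 0 := ArcsDisjoint.int_eq_of_abs_lt (x := u + k * (2 * Real.pi)) (y := u)
      (by rw [abs_lt]; constructor <;> linarith [hu.1, hu.2]) (by push_cast; ring)
    subst hk0
    exact ⟨p, hp, by simpa using hk⟩
  · rintro ⟨p, hp, hk⟩
    exact ⟨p, hp, 0, by simpa using hk⟩

theorem mem_outerArcs_iff {p : M} (hp : p ∈ α.crossings) {u : ℝ}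
    (hu : u ∈ Set.Icc 0 (2 * Real.pi)) :
    u ∈ α.outerArcs p ↔ u < α.time₁ p ∨ α.time₂ p < u := by
  obtain ⟨h1, h2, h3, -⟩ := α.time_spec hp
  constructor
  · rintro ⟨q, hq, k, hk⟩
    rw [Finset.mem_singleton] at hq
    subst hq
    have e1 := hk.1
    have e2 := hk.2
    by_contra! hcon
    have e3 := hcon.1
    have e4 := hcon.2
    rcases le_or_gt k (-1) with hk1 | hk1
    · have : (k : ℝ) ≤ -1 := by exact_mod_cast hk1
      nlinarith [Real.two_pi_pos]
    · have : (0 : ℝ) ≤ k := by exact_mod_cast (show 0 ≤ k by omega)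
      nlinarith [Real.two_pi_pos]
  · rintro (h | h)
    · exact ⟨p, by simp, 0, by constructor <;> push_cast <;> linarith [hu.1]⟩
    · exact ⟨p, by simp, -1, by constructor <;> push_cast <;> linarith [hu.2]⟩

theorem IsDisjointCut.isRemovable {H : Finset M} (h : α.IsDisjointCut H) :
    IsRemovable α (α.rootArcs H) 0 := by
  refine h.arcsDisjoint.isRemovable (fun p hp => ?_) ?_ (Or.inl ?_)
  · obtain ⟨-, -, -, h4, h5⟩ := α.time_spec (h.subset p hp)
    rw [h4, h5]
  · change (0 : ℝ) ∉ α.rootArcs H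
    rw [mem_rootArcs_iff h.subset zero_mem_Icc_two_pi]
    rintro ⟨p, hp, h1⟩
    linarith [(α.time_spec (h.subset p hp)).1, h1.1]
  · rw [path_zero]; exact α.base_not_crossing

/-- The base point is the crossing p itself, so the second form of the starting condition applies,
with the removed arc ending at the first passage. -/
theorem isRemovable_outer {p : M} (hp : p ∈ α.crossings) :
    IsRemovable α (α.outerArcs p) (α.time₁ p) := by
  obtain ⟨h1, h2, h3, h4, h5⟩ := α.time_spec hp
  have hend : α.time₂ p - 2 * Real.pi ∉ α.outerArcs p := by
    have := arcUnion_add_int {p} (fun p => α.time₂ p - 2 * Real.pi) α.time₁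
      (α.time₂ p - 2 * Real.pi) 1
    intro h
    have h' := this.2 h
    rw [Int.cast_one, one_mul, sub_add_cancel] at h'
    have := (mem_outerArcs_iff hp ⟨by linarith, by linarith⟩).1 h'
    rcases this with h6 | h6 <;> linarith
  refine (arcsDisjoint_outer hp).isRemovable (fun q hq => ?_) ?_ (Or.inr
    ⟨α.time₂ p - 2 * Real.pi, by linarith, hend, fun y hy => ⟨p, by simp, 0, by simpa using hy⟩⟩)
  · rw [Finset.mem_singleton] at hq
    subst hq
    rw [α.path_periodic.sub_eq, h5, h4]
  · intro h
    have := (mem_outerArcs_iff hp ⟨by linarith, by linarith⟩).1 h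
    rcases this with h6 | h6 <;> linarith

open Classical in
variable (α) in
/-- A loop representing `α_{v(H)}`. -/
def rootLoop (H : Finset M) : PointedLoop M :=
  if h : α.IsDisjointCut H then subloop α (α.rootArcs H) 0 h.isRemovable else α

open Classical in
variable (α) in
/-- A loop representing `α_{v(H, p)}`. -/
def outerLoop (p : M) : PointedLoop M :=
  if h : p ∈ α.crossings then subloop α (α.outerArcs p) (α.time₁ p) (isRemovable_outer h) else α

theorem IsDisjointCut.rootLoop_eq {H : Finset M} (h : α.IsDisjointCut H) :
    α.rootLoop H = subloop α (α.rootArcs H) 0 h.isRemovable := dif_pos h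

theorem outerLoop_eq {p : M} (h : p ∈ α.crossings) :
    α.outerLoop p = subloop α (α.outerArcs p) (α.time₁ p) (isRemovable_outer h) := dif_pos h

end PointedLoop

end Subloop

section Subloop

variable {M : Type*} [TopologicalSpace M] [ChartedSpace (EuclideanHalfSpace 2) M]

/-! ### Crossings, times and signs of subloops -/

/-- `w` is the only time which `c` maps to `c w`. -/
def IsSingle (c : ℝ → ℝ) (w : ℝ) : Prop := ∀ y, c y = c w → y = w

theorem IsCollapse.isSingle_add_int {J : Set ℝ} {c : ℝ → ℝ} (hc : IsCollapse J c) {w : ℝ}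
    (h : IsSingle c w) (k : ℤ) : IsSingle c (w + k * (2 * Real.pi)) := fun y hy => by
  have h1 := h (y + (-k : ℤ) * (2 * Real.pi)) (by
    rw [hc.add_int, hy, hc.add_int]; push_cast; ring)
  push_cast at h1
  linarith

/-- The crossings of `β` are crossings of `α`, and the order of their times is the same. -/
def TimesEmbed (α β : PointedLoop M) : Prop :=
  ∃ c : ℝ → ℝ, Monotone c ∧ ∀ p ∈ β.crossings, p ∈ α.crossings ∧
    β.time₁ p = c (α.time₁ p) ∧ β.time₂ p = c (α.time₂ p) ∧
      IsSingle c (α.time₁ p) ∧ IsSingle c (α.time₂ p)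

section

variable {α : PointedLoop M} {J : Set ℝ} {a : ℝ}

theorem IsRemovable.notMem_of_exp_eq (h : IsRemovable α J a) {u v : ℝ}
    (huv : Circle.exp u = Circle.exp v) (hu : u ∉ J) : v ∉ J := by
  obtain ⟨k, rfl⟩ := exp_eq_iff.1 huv
  have h1 : Function.Periodic (fun u => u ∈ J) (2 * Real.pi) := fun u => propext (h.periodic u)
  have h2 := h1.int_mul k v
  simp only [eq_iff_iff] at h2
  rwa [h2] at hu

/-- A crossing of α survives precisely when neither passage is removed and the two are not glued. No
new crossing arises, because the subloop runs along α. -/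
theorem mem_crossings_subloop (h : IsRemovable α J a) {p : M} :
    p ∈ (subloop α J a h).crossings ↔ p ∈ α.crossings ∧ α.time₁ p ∉ J ∧ α.time₂ p ∉ J ∧
      Circle.exp (collapseMap J a (α.time₁ p)) ≠ Circle.exp (collapseMap J a (α.time₂ p)) := by
  have hc := h.isCollapse h.start_notMem
  constructor
  · rintro ⟨z, w, hzw, hz, hw⟩
    obtain ⟨x, rfl⟩ := Circle.exp_surjective z
    obtain ⟨y, rfl⟩ := Circle.exp_surjective w
    rw [subloop_toFun_exp] at hz hw
    obtain ⟨u, v, hu, hv, rfl, rfl, hp, hne, -, -⟩ := h.subloopPath_eq (hz.trans hw.symm) hzw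
    rw [h.subloopPath_collapseMap hu] at hz
    have hcr : p ∈ α.crossings := hz ▸ α.path_mem_crossings hp hne
    refine ⟨hcr, ?_⟩
    rcases α.exp_eq_time hcr hz with h1 | h1 <;>
      rcases α.exp_eq_time hcr (hp.symm.trans hz) with h2 | h2
    · exact absurd (h1.trans h2.symm) hne
    · refine ⟨h.notMem_of_exp_eq h1 hu, h.notMem_of_exp_eq h2 hv, ?_⟩
      rwa [← hc.exp_congr h1, ← hc.exp_congr h2]
    · refine ⟨h.notMem_of_exp_eq h2 hv, h.notMem_of_exp_eq h1 hu, ?_⟩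
      rw [← hc.exp_congr h1, ← hc.exp_congr h2]
      exact hzw.symm
    · exact absurd (h1.trans h2.symm) hne
  · rintro ⟨hp, h1, h2, hne⟩
    obtain ⟨-, -, -, h3, h4⟩ := α.time_spec hp
    refine ⟨_, _, hne, ?_, ?_⟩
    · rw [subloop_toFun_exp, h.subloopPath_collapseMap h1, h3]
    · rw [subloop_toFun_exp, h.subloopPath_collapseMap h2, h4]

theorem isSingle_of_mem_crossings (h : IsRemovable α J a) {p : M}
    (hp : p ∈ (subloop α J a h).crossings) : IsSingle (collapseMap J a) (α.time₁ p) ∧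
      IsSingle (collapseMap J a) (α.time₂ p) := by
  obtain ⟨hp, h1, h2, hne⟩ := (mem_crossings_subloop h).1 hp
  obtain ⟨-, -, -, h3, h4⟩ := α.time_spec hp
  exact ⟨fun y hy => h.collapse_single h1 (h3.trans h4.symm) hne hy,
    fun y hy => h.collapse_single h2 (h4.trans h3.symm) hne.symm hy⟩

/-- The times of the crossings of a subloop, if the remaining times in `]0, 2π[` all lie in an
interval `[a, b]` which is mapped onto `[0, 2π]`. -/
theorem time_subloop (h : IsRemovable α J a) {b : ℝ} (hb : collapseMap J a b = 2 * Real.pi)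
    (hwin : ∀ u ∈ Set.Ioo 0 (2 * Real.pi), u ∉ J → a ≤ u ∧ u ≤ b) {p : M}
    (hp : p ∈ (subloop α J a h).crossings) :
    (subloop α J a h).time₁ p = collapseMap J a (α.time₁ p) ∧
      (subloop α J a h).time₂ p = collapseMap J a (α.time₂ p) := by
  have hc := h.isCollapse h.start_notMem
  obtain ⟨hpα, h1, h2, hne⟩ := (mem_crossings_subloop h).1 hp
  obtain ⟨e1, e2, e3, e4, e5⟩ := α.time_spec hpα
  have hw1 := hwin _ ⟨e1, e2.trans e3⟩ h1
  have hw2 := hwin _ ⟨e1.trans e2, e3⟩ h2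
  have c1 : 0 ≤ collapseMap J a (α.time₁ p) := by
    have := hc.monotone hw1.1; rwa [collapseMap_self] at this
  have c2 : collapseMap J a (α.time₂ p) ≤ 2 * Real.pi := by
    have := hc.monotone hw2.2; rwa [hb] at this
  have c3 : collapseMap J a (α.time₁ p) < collapseMap J a (α.time₂ p) :=
    lt_of_le_of_ne (hc.monotone e2.le) fun h' => hne (by rw [h'])
  have p1 := path_subloop_collapseMap h h1
  have p2 := path_subloop_collapseMap h h2
  rw [e4] at p1
  rw [e5] at p2
  -- The images 0 and 2π belong to the base point, which is not a crossing; this makes the bounds on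
  -- the times strict.
  have hbase : (subloop α J a h).base ≠ p := fun h' =>
    (subloop α J a h).base_not_crossing (h' ▸ hp)
  have c1' : 0 < collapseMap J a (α.time₁ p) := lt_of_le_of_ne c1 fun h' => hbase (by
    rw [← p1, ← h', PointedLoop.path_zero])
  have c2' : collapseMap J a (α.time₂ p) < 2 * Real.pi := lt_of_le_of_ne c2 fun h' => hbase (by
    rw [← p2, h', ← PointedLoop.path_zero, (subloop α J a h).path_periodic.eq])
  have := (subloop α J a h).time_eq c1' c3 c2' (p1.trans p2.symm)
  rw [p1] at this
  exact this.2

theorem timesEmbed_subloop (h : IsRemovable α J a) {b : ℝ} (hb : collapseMap J a b = 2 * Real.pi)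
    (hwin : ∀ u ∈ Set.Ioo 0 (2 * Real.pi), u ∉ J → a ≤ u ∧ u ≤ b) :
    TimesEmbed α (subloop α J a h) := by
  refine ⟨collapseMap J a, (h.isCollapse h.start_notMem).monotone, fun p hp => ?_⟩
  obtain ⟨h1, h2⟩ := time_subloop h hb hwin hp
  obtain ⟨h3, h4⟩ := isSingle_of_mem_crossings h hp
  exact ⟨((mem_crossings_subloop h).1 hp).1, h1, h2, h3, h4⟩

/-- The collapse preserves the order of the passages and multiplies both velocities by the same
positive factor. -/
theorem sign_subloop [IsManifold (𝓡∂ 2) ∞ M] (o : SurfaceOrientation M) (h : IsRemovable α J a)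
    {b : ℝ} (hb : collapseMap J a b = 2 * Real.pi)
    (hwin : ∀ u ∈ Set.Ioo 0 (2 * Real.pi), u ∉ J → a ≤ u ∧ u ≤ b) {p : M}
    (hp : p ∈ (subloop α J a h).crossings) : (subloop α J a h).sign o p = α.sign o p := by
  obtain ⟨h1, h2⟩ := time_subloop h hb hwin hp
  obtain ⟨h3, h4⟩ := isSingle_of_mem_crossings h hp
  obtain ⟨hpα, h5, h6, -⟩ := (mem_crossings_subloop h).1 hp
  obtain ⟨-, -, -, e4, e5⟩ := α.time_spec hpα
  have hκ := inv_pos.2 (h.collapseMap_slope_pos h.start_notMem)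
  have h7 := SurfaceOrientation.IsPositive.smul_iff o p (velocity α.path Set.univ (α.time₁ p))
    (velocity α.path Set.univ (α.time₂ p)) hκ hκ
  unfold PointedLoop.sign
  rw [path_subloop, h1, h2, h.velocity_crossing h5 h3 (by rwa [e4]),
    h.velocity_crossing h6 h4 (by rwa [e5])]
  classical exact if_congr h7 rfl rfl

/-- A subloop of a subloop is a subloop. -/
theorem IsSubloop.of_subloop (h : IsRemovable α J a) {ι : Type*} {H : Finset ι}
    {s' t' s t : ι → ℝ}
    (hs : ∀ p ∈ H, s' p = collapseMap J a (s p) ∧ IsSingle (collapseMap J a) (s p))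
    (ht : ∀ p ∈ H, t' p = collapseMap J a (t p) ∧ IsSingle (collapseMap J a) (t p)) {a' : ℝ}
    {γ : PointedLoop M}
    (hγ : IsSubloop (subloop α J a h) (arcUnion H s' t') (collapseMap J a a') γ) :
    IsSubloop α (J ∪ arcUnion H s t) a' γ := by
  have hc := h.isCollapse h.start_notMem
  -- Since the endpoints have singleton fibres, the preimage of an open arc is again the open arc
  -- between the original endpoints.
  have hpre : collapseMap J a ⁻¹' arcUnion H s' t' = arcUnion H s t := by
    ext u
    simp only [arcUnion, Set.mem_preimage, Set.mem_ofPred_eq]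
    refine exists_congr fun p => and_congr_right fun hp => exists_congr fun k => ?_
    rw [(hs p hp).1, (ht p hp).1, ← hc.add_int]
    constructor
    · intro h'
      exact ⟨hc.lt_of_lt h'.1, hc.lt_of_lt h'.2⟩
    · intro h'
      refine ⟨lt_of_le_of_ne (hc.monotone h'.1.le) fun e => ?_,
        lt_of_le_of_ne (hc.monotone h'.2.le) fun e => ?_⟩
      · exact h'.1.ne' ((hs p hp).2 _ e.symm)
      · exact h'.2.ne ((ht p hp).2 _ e)
  rw [← hpre]
  refine IsSubloop.comp hc h.isOpen (fun u hu => path_subloop_collapseMap h hu) hγ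
    fun u v huv hcuv hu => ?_
  -- The image of a nondegenerate collapsed interval cannot be an endpoint of an arc, because
  -- endpoints have singleton fibres.
  have key : ∀ w k, IsSingle (collapseMap J a) w →
      collapseMap J a u + (k : ℤ) * (2 * Real.pi) ≠ collapseMap J a w := by
    intro w k hw heq
    have h1 := hw (u + k * (2 * Real.pi)) (by rw [hc.add_int, heq])
    have h2 := hw (v + k * (2 * Real.pi)) (by rw [hc.add_int, ← hcuv, heq])
    linarith
  constructor
  · intro y hy hsub
    obtain ⟨p, hp, k, hk⟩ := ArcsDisjoint.exists_eq_left_end hy hu hsub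
    exact key (s p) k (hs p hp).2 (hk.trans (hs p hp).1)
  · intro y hy hsub
    obtain ⟨p, hp, k, hk⟩ := ArcsDisjoint.exists_eq_right_end hy hu hsub
    exact key (t p) k (ht p hp).2 (hk.trans (ht p hp).1)

end

namespace PointedLoop

variable {α : PointedLoop M}

/-! ### Root loops and outer loops -/

theorem IsDisjointCut.collapse_end {H : Finset M} (h : α.IsDisjointCut H) :
    collapseMap (α.rootArcs H) 0 (2 * Real.pi) = 2 * Real.pi := by
  have := (h.isRemovable.isCollapse h.isRemovable.start_notMem).add_period 0
  rwa [zero_add, collapseMap_self, zero_add] at this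

theorem IsDisjointCut.window {H : Finset M} (u : ℝ) (hu : u ∈ Set.Ioo 0 (2 * Real.pi))
    (_ : u ∉ α.rootArcs H) : 0 ≤ u ∧ u ≤ 2 * Real.pi := ⟨hu.1.le, hu.2.le⟩

theorem outer_collapse_end {p : M} (hp : p ∈ α.crossings) :
    collapseMap (α.outerArcs p) (α.time₁ p) (α.time₂ p) = 2 * Real.pi := by
  have hc := (isRemovable_outer hp).isCollapse (isRemovable_outer hp).start_notMem
  obtain ⟨h1, h2, h3, -⟩ := α.time_spec hp
  have h4 := (hc.eq_iff (α.time₂ p - 2 * Real.pi) (α.time₁ p) (by linarith)).2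
    fun u hu => ⟨p, by simp, 0, by simpa using hu⟩
  have h5 := hc.add_period (α.time₂ p - 2 * Real.pi)
  rw [sub_add_cancel, h4, collapseMap_self, zero_add] at h5
  exact h5

theorem outer_window {p : M} (hp : p ∈ α.crossings) (u : ℝ) (hu : u ∈ Set.Ioo 0 (2 * Real.pi))
    (h : u ∉ α.outerArcs p) : α.time₁ p ≤ u ∧ u ≤ α.time₂ p := by
  rw [mem_outerArcs_iff hp ⟨hu.1.le, hu.2.le⟩] at h
  push Not at h
  exact h

theorem time_ne {p q : M} (hp : p ∈ α.crossings) (hq : q ∈ α.crossings) (hpq : p ≠ q) :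
    α.time₁ p ≠ α.time₁ q ∧ α.time₁ p ≠ α.time₂ q ∧ α.time₂ p ≠ α.time₁ q ∧
      α.time₂ p ≠ α.time₂ q := by
  obtain ⟨-, -, -, h1, h2⟩ := α.time_spec hp
  obtain ⟨-, -, -, h3, h4⟩ := α.time_spec hq
  refine ⟨fun h => hpq ?_, fun h => hpq ?_, fun h => hpq ?_, fun h => hpq ?_⟩
  · rw [← h1, h, h3]
  · rw [← h1, h, h4]
  · rw [← h2, h, h3]
  · rw [← h2, h, h4]

variable (α) in
/-- The passages through `q` are between the passages through `p`. -/
def Inside (q p : M) : Prop := α.time₁ p < α.time₁ q ∧ α.time₂ q < α.time₂ p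

variable (α) in
/-- The closed time intervals of `p` and `q` are disjoint. -/
def Apart (p q : M) : Prop := α.time₂ p < α.time₁ q ∨ α.time₂ q < α.time₁ p

/-- A crossing linked with or inside an element of H loses a passage, and the elements of H have
their passages glued. The crossings left are apart from each q in H or enclose it. -/
theorem mem_crossings_rootLoop {H : Finset M} (h : α.IsDisjointCut H) {p : M} :
    p ∈ (α.rootLoop H).crossings ↔
      p ∈ α.crossings ∧ ∀ q ∈ H, α.Apart p q ∨ α.Inside q p := by
  have hc := h.isRemovable.isCollapse h.isRemovable.start_notMem
  rw [h.rootLoop_eq, mem_crossings_subloop]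
  refine and_congr_right fun hp => ?_
  obtain ⟨h1, h2, h3, h4, h5⟩ := α.time_spec hp
  rw [mem_rootArcs_iff h.subset ⟨h1.le, (h2.trans h3).le⟩,
    mem_rootArcs_iff h.subset ⟨(h1.trans h2).le, h3.le⟩]
  constructor
  · rintro ⟨e1, e2, e3⟩ q hq
    obtain ⟨h1', h2', h3', h4', h5'⟩ := α.time_spec (h.subset q hq)
    have hpq : p ≠ q := by
      rintro rfl
      apply e3
      rw [(hc.eq_iff _ _ h2).2 fun u hu => ⟨p, hq, 0, by simpa using hu⟩]
    obtain ⟨n1, n2, n3, n4⟩ := time_ne hp (h.subset q hq) hpq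
    have e1' : ¬ (α.time₁ q < α.time₁ p ∧ α.time₁ p < α.time₂ q) := fun e => e1 ⟨q, hq, e⟩
    have e2' : ¬ (α.time₁ q < α.time₂ p ∧ α.time₂ p < α.time₂ q) := fun e => e2 ⟨q, hq, e⟩
    unfold Apart Inside
    rcases lt_or_gt_of_ne n1 with f1 | f1
    · rcases lt_or_gt_of_ne n3 with f3 | f3
      · exact Or.inl (Or.inl f3)
      · rcases lt_or_gt_of_ne n4 with f4 | f4
        · exact absurd ⟨f3, f4⟩ e2'
        · exact Or.inr ⟨f1, f4⟩
    · rcases lt_or_gt_of_ne n2 with f2 | f2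
      · exact absurd ⟨f1, f2⟩ e1'
      · exact Or.inl (Or.inr f2)
  · intro hall
    have e1 : ¬ ∃ q ∈ H, α.time₁ p ∈ Set.Ioo (α.time₁ q) (α.time₂ q) := by
      rintro ⟨q, hq, f1, f2⟩
      rcases hall q hq with (f3 | f3) | f3
      · linarith
      · linarith
      · linarith [f3.1]
    have e2 : ¬ ∃ q ∈ H, α.time₂ p ∈ Set.Ioo (α.time₁ q) (α.time₂ q) := by
      rintro ⟨q, hq, f1, f2⟩
      rcases hall q hq with (f3 | f3) | f3
      · linarith
      · linarith
      · linarith [f3.2]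
    refine ⟨e1, e2, fun hexp => ?_⟩
    rw [← mem_rootArcs_iff h.subset ⟨h1.le, (h2.trans h3).le⟩] at e1
    rw [← mem_rootArcs_iff h.subset ⟨(h1.trans h2).le, h3.le⟩] at e2
    have c1 := hc.monotone h1.le
    have c2 := hc.monotone h3.le
    have c3 := hc.monotone h2.le
    rw [collapseMap_self] at c1
    rw [h.collapse_end] at c2
    -- Both images lie in [0, 2π] in this order. Equality on the circle leaves only equal images or
    -- the images 0 and 2π.
    obtain ⟨k, hk⟩ := exp_eq_iff.1 hexp
    have hp0 := Real.two_pi_pos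
    have hk0 : k = 0 ∨ k = -1 := by
      have g1 : (k : ℝ) * (2 * Real.pi) ≤ 0 := by linarith
      have g2 : -(2 * Real.pi) ≤ (k : ℝ) * (2 * Real.pi) := by linarith
      have g3 : (k : ℝ) ≤ 0 := by by_contra! g; nlinarith
      have g4 : (-1 : ℝ) ≤ k := by by_contra! g; nlinarith
      have g5 : k ≤ 0 := by exact_mod_cast g3
      have g6 : -1 ≤ k := by exact_mod_cast g4
      omega
    rcases hk0 with rfl | rfl
    · have hcc : collapseMap (α.rootArcs H) 0 (α.time₁ p) =
          collapseMap (α.rootArcs H) 0 (α.time₂ p) := by rw [hk]; simp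
      obtain ⟨q, hq, l, f1, f2⟩ := h.arcsDisjoint.exists_gap h2 e1 e2 ((hc.eq_iff _ _ h2).1 hcc)
      have hqp : q = p := by
        rw [← (α.time_spec (h.subset q hq)).2.2.2.1, ← f1,
          α.path_congr (exp_eq_iff.2 ⟨l, rfl⟩ : _ = Circle.exp (α.time₁ p)), h4]
      subst hqp
      rcases hall q hq with (f3 | f3) | f3
      · linarith
      · linarith
      · linarith [f3.1]
    -- In the second case an interval containing 2π would be collapsed, although the base time is
    -- never removed.
    · have hcc : collapseMap (α.rootArcs H) 0 (α.time₂ p) =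
          collapseMap (α.rootArcs H) 0 (α.time₁ p + 2 * Real.pi) := by
        rw [hc.add_period, hk]; push_cast; ring
      have hsub := (hc.eq_iff _ _ (by linarith)).1 hcc
      have h6 := hsub (show 2 * Real.pi ∈ _ from ⟨h3, by linarith⟩)
      have h7 := (h.isRemovable.periodic 0).1 (by rwa [zero_add])
      exact h.isRemovable.start_notMem h7

/-- The collapse is strictly increasing on the closed time interval of p and sends its ends to 0 and
2π. Only p itself is lost at the ends. -/
theorem mem_crossings_outerLoop {p : M} (hp : p ∈ α.crossings) {q : M} :
    q ∈ (α.outerLoop p).crossings ↔ q ∈ α.crossings ∧ α.Inside q p := by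
  have hr := isRemovable_outer hp
  have hc := hr.isCollapse hr.start_notMem
  rw [outerLoop_eq hp, mem_crossings_subloop]
  refine and_congr_right fun hq => ?_
  obtain ⟨h1, h2, h3, -⟩ := α.time_spec hp
  obtain ⟨h1', h2', h3', -⟩ := α.time_spec hq
  rw [mem_outerArcs_iff hp ⟨h1'.le, (h2'.trans h3').le⟩,
    mem_outerArcs_iff hp ⟨(h1'.trans h2').le, h3'.le⟩]
  constructor
  · rintro ⟨e1, e2, e3⟩
    have hqp : q ≠ p := by
      rintro rfl
      apply e3
      rw [collapseMap_self, outer_collapse_end hp, Circle.exp_two_pi, Circle.exp_zero]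
    obtain ⟨n1, n2, n3, n4⟩ := time_ne hq hp hqp
    push Not at e1 e2
    exact ⟨lt_of_le_of_ne e1.1 n1.symm, lt_of_le_of_ne e2.2 n4⟩
  · rintro ⟨e1, e2⟩
    refine ⟨by push Not; constructor <;> linarith, by push Not; constructor <;> linarith,
      fun hexp => ?_⟩
    have hnot : ∀ u, α.time₁ p ≤ u → u ≤ α.time₂ p → u ∉ α.outerArcs p := fun u hu1 hu2 => by
      rw [mem_outerArcs_iff hp ⟨by linarith, by linarith⟩]
      push Not
      exact ⟨hu1, hu2⟩
    have hstrict : ∀ u v, α.time₁ p ≤ u → u < v → v ≤ α.time₂ p →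
        collapseMap (α.outerArcs p) (α.time₁ p) u < collapseMap (α.outerArcs p) (α.time₁ p) v := by
      intro u v hu huv hv
      refine lt_of_le_of_ne (hc.monotone huv.le) fun heq => ?_
      have hm : (u + v) / 2 ∈ Set.Ioo u v := ⟨by linarith, by linarith⟩
      exact hnot _ (by linarith [hm.1]) (by linarith [hm.2]) ((hc.eq_iff u v huv).1 heq hm)
    have c1 := hstrict _ _ le_rfl e1 (by linarith)
    have c2 := hstrict _ _ e1.le h2' e2.le
    have c3 := hstrict _ _ (by linarith) e2 le_rfl
    rw [collapseMap_self] at c1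
    rw [outer_collapse_end hp] at c3
    exact c2.ne (exp_injOn ⟨c1.le, by linarith⟩ ⟨by linarith, c3⟩ hexp)

theorem timesEmbed_rootLoop {H : Finset M} (h : α.IsDisjointCut H) :
    TimesEmbed α (α.rootLoop H) := by
  rw [h.rootLoop_eq]
  exact timesEmbed_subloop h.isRemovable h.collapse_end IsDisjointCut.window

theorem timesEmbed_outerLoop {p : M} (hp : p ∈ α.crossings) : TimesEmbed α (α.outerLoop p) := by
  rw [outerLoop_eq hp]
  exact timesEmbed_subloop (isRemovable_outer hp) (outer_collapse_end hp) (outer_window hp)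

theorem sign_rootLoop [IsManifold (𝓡∂ 2) ∞ M] (o : SurfaceOrientation M) {H : Finset M}
    (h : α.IsDisjointCut H) {p : M} (hp : p ∈ (α.rootLoop H).crossings) :
    (α.rootLoop H).sign o p = α.sign o p := by
  rw [h.rootLoop_eq] at hp ⊢
  exact sign_subloop o h.isRemovable h.collapse_end IsDisjointCut.window hp

theorem sign_outerLoop [IsManifold (𝓡∂ 2) ∞ M] (o : SurfaceOrientation M) {p q : M}
    (hp : p ∈ α.crossings) (hq : q ∈ (α.outerLoop p).crossings) :
    (α.outerLoop p).sign o q = α.sign o q := by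
  rw [outerLoop_eq hp] at hq ⊢
  exact sign_subloop o (isRemovable_outer hp) (outer_collapse_end hp) (outer_window hp) hq

theorem IsDisjointCut.isSubloop {H : Finset M} (h : α.IsDisjointCut H) :
    IsSubloop α (α.rootArcs H) 0 (α.rootLoop H) := by
  rw [h.rootLoop_eq]; exact isSubloop_subloop _

theorem isSubloop_outerLoop {p : M} (hp : p ∈ α.crossings) :
    IsSubloop α (α.outerArcs p) (α.time₁ p) (α.outerLoop p) := by
  rw [outerLoop_eq hp]; exact isSubloop_subloop _

/-! ### Isotopy classes of subloops of subloops -/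

/-- The outer loop of a subloop is a subloop. -/
theorem isSubloop_outer_of_subloop {J : Set ℝ} {a : ℝ} (h : IsRemovable α J a) {b : ℝ}
    (hb : collapseMap J a b = 2 * Real.pi)
    (hwin : ∀ u ∈ Set.Ioo 0 (2 * Real.pi), u ∉ J → a ≤ u ∧ u ≤ b) {p : M}
    (hp : p ∈ (subloop α J a h).crossings) :
    IsSubloop α (J ∪ α.outerArcs p) (α.time₁ p) ((subloop α J a h).outerLoop p) := by
  have hc := h.isCollapse h.start_notMem
  obtain ⟨h1, h2⟩ := time_subloop h hb hwin hp
  obtain ⟨h3, h4⟩ := isSingle_of_mem_crossings h hp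
  refine IsSubloop.of_subloop h ?_ ?_ (h1 ▸ isSubloop_outerLoop hp)
  · intro q hq
    rw [Finset.mem_singleton] at hq
    subst hq
    have e : α.time₂ q - 2 * Real.pi = α.time₂ q + (-1 : ℤ) * (2 * Real.pi) := by push_cast; ring
    rw [e]
    refine ⟨?_, hc.isSingle_add_int h4 _⟩
    rw [hc.add_int, h2]
    push_cast
    ring
  · intro q hq
    rw [Finset.mem_singleton] at hq
    subst hq
    exact ⟨h1, h3⟩

/-- The root loop of a subloop is a subloop. -/
theorem isSubloop_root_of_subloop {J : Set ℝ} {a : ℝ} (h : IsRemovable α J a) {b : ℝ}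
    (hb : collapseMap J a b = 2 * Real.pi)
    (hwin : ∀ u ∈ Set.Ioo 0 (2 * Real.pi), u ∉ J → a ≤ u ∧ u ≤ b) {K : Finset M}
    (hK : (subloop α J a h).IsDisjointCut K) :
    IsSubloop α (J ∪ α.rootArcs K) a ((subloop α J a h).rootLoop K) := by
  refine IsSubloop.of_subloop h ?_ ?_ ((collapseMap_self J a).symm ▸ hK.isSubloop)
  · intro q hq
    exact ⟨(time_subloop h hb hwin (hK.subset q hq)).1,
      (isSingle_of_mem_crossings h (hK.subset q hq)).1⟩
  · intro q hq
    exact ⟨(time_subloop h hb hwin (hK.subset q hq)).2,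
      (isSingle_of_mem_crossings h (hK.subset q hq)).2⟩

theorem arc_subset_outerArcs {p q : M} (hp : p ∈ α.crossings) (hq : q ∈ α.crossings)
    (h : α.Apart p q) : α.rootArcs {q} ⊆ α.outerArcs p := by
  obtain ⟨h1, h2, h3, -⟩ := α.time_spec hp
  obtain ⟨h1', h2', h3', -⟩ := α.time_spec hq
  rintro u ⟨r, hr, k, hk⟩
  rw [Finset.mem_singleton] at hr
  subst hr
  have e1 := hk.1
  have e2 := hk.2
  rcases h with h | h
  · exact ⟨p, by simp, k - 1, by push_cast; constructor <;> linarith⟩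
  · exact ⟨p, by simp, k, by constructor <;> linarith⟩

theorem mem_rootArcs_of {H : Finset M} {q : M} (hq : q ∈ H) {u : ℝ} (hu : u ∈ α.rootArcs {q}) :
    u ∈ α.rootArcs H := by
  obtain ⟨r, hr, k, hk⟩ := hu
  rw [Finset.mem_singleton] at hr
  subst hr
  exact ⟨r, hq, k, hk⟩

theorem exists_mem_rootArcs {H : Finset M} {u : ℝ} (hu : u ∈ α.rootArcs H) :
    ∃ q ∈ H, u ∈ α.rootArcs {q} := by
  obtain ⟨q, hq, k, hk⟩ := hu
  exact ⟨q, hq, q, by simp, k, hk⟩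

theorem rootArcs_subset_of_inside {p q : M} (h : α.Inside q p) :
    α.rootArcs {q} ⊆ α.rootArcs {p} := by
  rintro u ⟨r, hr, k, hk⟩
  rw [Finset.mem_singleton] at hr
  subst hr
  exact ⟨p, by simp, k, h.1.trans hk.1, hk.2.trans h.2⟩

theorem outerArcs_subset_of_inside {p q : M} (h : α.Inside q p) :
    α.outerArcs p ⊆ α.outerArcs q := by
  rintro u ⟨r, hr, k, hk⟩
  rw [Finset.mem_singleton] at hr
  subst hr
  exact ⟨q, by simp, k, by have := hk.1; have := h.2; simp only at *; linarith, hk.2.trans h.1⟩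

-- Both loops result from the same set of times. A removed arc of H apart from p already lies
-- outside the interval of p; the other arcs lie inside it and form the cut of the outer loop.
open Classical in
theorem isotopyClass_outer_root {H : Finset M} (h : α.IsDisjointCut H) {p : M}
    (hp : p ∈ (α.rootLoop H).crossings)
    (hK : (α.outerLoop p).IsDisjointCut (H.filter fun q => α.Inside q p)) :
    ((α.rootLoop H).outerLoop p).isotopyClass =
      ((α.outerLoop p).rootLoop (H.filter fun q => α.Inside q p)).isotopyClass := by
  obtain ⟨hpα, hpH⟩ := (mem_crossings_rootLoop h).1 hp
  rw [h.rootLoop_eq] at hp ⊢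
  rw [outerLoop_eq hpα] at hK ⊢
  have h1 := isSubloop_outer_of_subloop h.isRemovable h.collapse_end IsDisjointCut.window hp
  have h2 := isSubloop_root_of_subloop (isRemovable_outer hpα) (outer_collapse_end hpα)
    (outer_window hpα) hK
  have hset : α.rootArcs H ∪ α.outerArcs p =
      α.outerArcs p ∪ α.rootArcs (H.filter fun q => α.Inside q p) := by
    refine Set.Subset.antisymm (Set.union_subset ?_ Set.subset_union_left)
      (Set.union_subset Set.subset_union_right ?_)
    · intro u hu
      obtain ⟨q, hq, hu⟩ := exists_mem_rootArcs hu
      rcases hpH q hq with h3 | h3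
      · exact Or.inl (arc_subset_outerArcs hpα (h.subset q hq) h3 hu)
      · exact Or.inr (mem_rootArcs_of (Finset.mem_filter.2 ⟨hq, h3⟩) hu)
    · intro u hu
      obtain ⟨q, hq, hu⟩ := exists_mem_rootArcs hu
      exact Or.inl (mem_rootArcs_of (Finset.mem_filter.1 hq).1 hu)
  rw [← hset] at h2
  exact h1.isotopyClass_eq h2 ((isOpen_arcUnion _ _ _).union (isOpen_arcUnion _ _ _))

-- An arc of H inside an arc of K is absorbed by the latter, so removing H and then K amounts to
-- removing K and the remaining elements of H.
open Classical in
theorem isotopyClass_root_root {H K : Finset M} (h : α.IsDisjointCut H)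
    (hK : (α.rootLoop H).IsDisjointCut K)
    (hU : α.IsDisjointCut (K ∪ H.filter fun q => ∀ p ∈ K, ¬ α.Inside q p)) :
    ((α.rootLoop H).rootLoop K).isotopyClass =
      (α.rootLoop (K ∪ H.filter fun q => ∀ p ∈ K, ¬ α.Inside q p)).isotopyClass := by
  have h2 := hU.isSubloop
  rw [h.rootLoop_eq] at hK ⊢
  have h1 := isSubloop_root_of_subloop h.isRemovable h.collapse_end IsDisjointCut.window hK
  have hset : α.rootArcs H ∪ α.rootArcs K =
      α.rootArcs (K ∪ H.filter fun q => ∀ p ∈ K, ¬ α.Inside q p) := by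
    refine Set.Subset.antisymm (Set.union_subset ?_ ?_) ?_
    · intro u hu
      obtain ⟨q, hq, hu⟩ := exists_mem_rootArcs hu
      by_cases h3 : ∀ p ∈ K, ¬ α.Inside q p
      · exact mem_rootArcs_of (Finset.mem_union_right _ (Finset.mem_filter.2 ⟨hq, h3⟩)) hu
      · push Not at h3
        obtain ⟨p, hp, h3⟩ := h3
        exact mem_rootArcs_of (Finset.mem_union_left _ hp) (rootArcs_subset_of_inside h3 hu)
    · intro u hu
      obtain ⟨q, hq, hu⟩ := exists_mem_rootArcs hu
      exact mem_rootArcs_of (Finset.mem_union_left _ hq) hu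
    · intro u hu
      obtain ⟨q, hq, hu⟩ := exists_mem_rootArcs hu
      rcases Finset.mem_union.1 hq with hq | hq
      · exact Or.inr (mem_rootArcs_of hq hu)
      · exact Or.inl (mem_rootArcs_of (Finset.mem_filter.1 hq).1 hu)
  rw [hset] at h1
  exact h1.isotopyClass_eq h2 (isOpen_arcUnion _ _ _)

/-- Everything removed for p is also removed for a crossing q inside p. -/
theorem isotopyClass_outer_outer {p q : M} (hp : p ∈ α.crossings) (hq : q ∈ α.crossings)
    (h : α.Inside q p) :
    ((α.outerLoop p).outerLoop q).isotopyClass = (α.outerLoop q).isotopyClass := by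
  have hq' := (mem_crossings_outerLoop hp).2 ⟨hq, h⟩
  have h2 := isSubloop_outerLoop hq
  rw [outerLoop_eq hp] at hq' ⊢
  have h1 := isSubloop_outer_of_subloop (isRemovable_outer hp) (outer_collapse_end hp)
    (outer_window hp) hq'
  rw [Set.union_eq_self_of_subset_left (outerArcs_subset_of_inside h)] at h1
  exact h1.isotopyClass_eq h2 (isOpen_arcUnion _ _ _)

theorem isDisjointCut_empty : α.IsDisjointCut ∅ := ⟨by simp, by simp⟩

theorem isotopyClass_rootLoop_empty : (α.rootLoop ∅).isotopyClass = α.isotopyClass := by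
  have h1 := (isDisjointCut_empty (α := α)).isSubloop
  have he : α.rootArcs ∅ = ∅ := by
    ext u; simp [rootArcs, arcUnion]
  rw [he] at h1
  refine h1.isotopyClass_eq ⟨id, ⟨continuous_id, monotone_id, fun _ => rfl, fun u v huv => ?_⟩,
    rfl, fun _ _ => rfl⟩ isOpen_empty
  refine ⟨fun h => absurd h huv.ne, fun h => ?_⟩
  exact absurd (h (⟨by linarith, by linarith⟩ : (u + v) / 2 ∈ Set.Ioo u v)) (by simp)

end PointedLoop

end Subloop

namespace PointedLoop

variable {M : Type*} [TopologicalSpace M] [ChartedSpace (EuclideanHalfSpace 2) M]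

/-! ### The two sides of a chord -/

section Side

variable (α : PointedLoop M)

/-- An affine function on the plane which vanishes on the line through `e_p` and is positive on the
circular segment which does not contain the base point. -/
def side (p : M) (z : ℂ) : ℝ :=
  z.re * Real.cos (α.baseAngle + (α.time₁ p + α.time₂ p) / 2) +
    z.im * Real.sin (α.baseAngle + (α.time₁ p + α.time₂ p) / 2) -
    Real.cos ((α.time₂ p - α.time₁ p) / 2)

theorem continuous_side (p : M) : Continuous (α.side p) := by
  unfold side
  fun_prop

theorem side_combo (p : M) (x y : ℂ) {a b : ℝ} (hab : a + b = 1) :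
    α.side p (a • x + b • y) = a * α.side p x + b * α.side p y := by
  obtain rfl : b = 1 - a := by linarith
  simp only [side, Complex.add_re, Complex.add_im, Complex.real_smul, Complex.re_ofReal_mul,
    Complex.im_ofReal_mul]
  ring

/-- The difference of two cosines becomes a product of two half-angle sines, so the sign on the
circle can be read off from the times. -/
theorem side_exp (p : M) (u : ℝ) : α.side p (Circle.exp (α.baseAngle + u)) =
    -2 * Real.sin ((u - α.time₁ p) / 2) * Real.sin ((u - α.time₂ p) / 2) := by
  rw [side, Circle.coe_exp, Complex.exp_ofReal_mul_I_re, Complex.exp_ofReal_mul_I_im,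
    ← Real.cos_sub, Real.cos_sub_cos]
  congr 2
  · congr 1; ring_nf
  · ring_nf

theorem side_point₁ (p : M) : α.side p (α.point₁ p) = 0 := by
  rw [point₁, ← exp_baseAngle, ← Circle.exp_add, side_exp]
  simp

theorem side_point₂ (p : M) : α.side p (α.point₂ p) = 0 := by
  rw [point₂, ← exp_baseAngle, ← Circle.exp_add, side_exp]
  simp

theorem convex_side (p : M) : Convex ℝ {z | α.side p z ≤ 0} ∧ Convex ℝ {z | α.side p z < 0} ∧
    Convex ℝ {z | 0 ≤ α.side p z} ∧ Convex ℝ {z | 0 < α.side p z} := by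
  refine ⟨?_, ?_, ?_, ?_⟩ <;> intro x hx y hy a b ha hb hab <;>
    rw [Set.mem_ofPred_eq] at hx hy ⊢ <;> rw [side_combo α p x y hab]
  · nlinarith
  · rcases ha.eq_or_lt with rfl | ha
    · nlinarith
    · nlinarith
  · positivity
  · rcases ha.eq_or_lt with rfl | ha
    · nlinarith
    · nlinarith [mul_nonneg hb hy.le, mul_pos ha hx]

theorem mem_closedBall (z : Circle) : (z : ℂ) ∈ Metric.closedBall (0 : ℂ) 1 := by
  rw [mem_closedBall_zero_iff, Circle.norm_coe]

variable {α}

theorem side_pos_iff {p : M} (hp : p ∈ α.crossings) (u : ℝ) :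
    0 < α.side p (Circle.exp (α.baseAngle + u)) ↔ u ∈ α.rootArcs {p} := by
  obtain ⟨k, hk1, hk2⟩ := ArcsDisjoint.exists_int_right 0 u
  have he : Circle.exp (α.baseAngle + u) = Circle.exp (α.baseAngle + (u + k * (2 * Real.pi))) :=
    (exp_eq_iff.2 ⟨k, by ring⟩ : _ = _).symm
  rw [he, rootArcs, ← arcUnion_add_int {p} α.time₁ α.time₂ u k]
  set v := u + k * (2 * Real.pi)
  obtain ⟨h1, h2, h3, -⟩ := α.time_spec hp
  change _ ↔ v ∈ α.rootArcs {p}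
  rw [mem_rootArcs_iff (by simpa using hp) ⟨hk1, by linarith⟩, side_exp]
  simp only [Finset.mem_singleton, exists_eq_left, Set.mem_Ioo]
  constructor
  · intro h
    by_contra! hcon
    rcases le_or_gt v (α.time₁ p) with h4 | h4
    · have e1 := Real.sin_nonpos_of_nonpos_of_neg_pi_le
        (show (v - α.time₁ p) / 2 ≤ 0 by linarith) (by linarith)
      have e2 := Real.sin_nonpos_of_nonpos_of_neg_pi_le
        (show (v - α.time₂ p) / 2 ≤ 0 by linarith) (by linarith)
      nlinarith
    · have h5 := hcon h4
      have e1 := Real.sin_nonneg_of_nonneg_of_le_pi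
        (show 0 ≤ (v - α.time₁ p) / 2 by linarith) (by linarith)
      have e2 := Real.sin_nonneg_of_nonneg_of_le_pi
        (show 0 ≤ (v - α.time₂ p) / 2 by linarith) (by linarith)
      nlinarith
  · rintro ⟨h4, h5⟩
    have e1 := Real.sin_pos_of_pos_of_lt_pi
      (show 0 < (v - α.time₁ p) / 2 by linarith) (by linarith)
    have e2 := Real.sin_neg_of_neg_of_neg_pi_lt
      (show (v - α.time₂ p) / 2 < 0 by linarith) (by linarith)
    nlinarith

theorem side_neg_iff {p : M} (hp : p ∈ α.crossings) (u : ℝ) :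
    α.side p (Circle.exp (α.baseAngle + u)) < 0 ↔ u ∈ α.outerArcs p := by
  obtain ⟨k, hk1, hk2⟩ := ArcsDisjoint.exists_int_right 0 u
  have he : Circle.exp (α.baseAngle + u) = Circle.exp (α.baseAngle + (u + k * (2 * Real.pi))) :=
    (exp_eq_iff.2 ⟨k, by ring⟩ : _ = _).symm
  rw [he, outerArcs, ← arcUnion_add_int _ _ _ u k]
  set v := u + k * (2 * Real.pi)
  obtain ⟨h1, h2, h3, -⟩ := α.time_spec hp
  change _ ↔ v ∈ α.outerArcs p
  rw [mem_outerArcs_iff hp ⟨hk1, by linarith⟩, side_exp]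
  constructor
  · intro h
    by_contra! hcon
    have e1 := Real.sin_nonneg_of_nonneg_of_le_pi
      (show 0 ≤ (v - α.time₁ p) / 2 by linarith) (by linarith)
    have e2 := Real.sin_nonpos_of_nonpos_of_neg_pi_le
      (show (v - α.time₂ p) / 2 ≤ 0 by linarith) (by linarith)
    nlinarith
  · rintro (h4 | h4)
    · have e1 := Real.sin_neg_of_neg_of_neg_pi_lt
        (show (v - α.time₁ p) / 2 < 0 by linarith) (by linarith)
      have e2 := Real.sin_neg_of_neg_of_neg_pi_lt
        (show (v - α.time₂ p) / 2 < 0 by linarith) (by linarith)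
      nlinarith
    · have e1 := Real.sin_pos_of_pos_of_lt_pi
        (show 0 < (v - α.time₁ p) / 2 by linarith) (by linarith)
      have e2 := Real.sin_pos_of_pos_of_lt_pi
        (show 0 < (v - α.time₂ p) / 2 by linarith) (by linarith)
      nlinarith

/-- The point of the line through `e_p` with a given coordinate along the line. -/
theorem eq_lineMap_of_side_eq_zero {p : M} (hp : p ∈ α.crossings) {z : ℂ} (hz : α.side p z = 0) :
    ∃ r : ℝ, z = (1 - r) • (α.point₁ p : ℂ) + r • (α.point₂ p : ℂ) ∧ (‖z‖ ≤ 1 → 0 ≤ r ∧ r ≤ 1) := by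
  obtain ⟨h1, h2, h3, -⟩ := α.time_spec hp
  -- In the frame rotated by m, points of the line have coordinates (cos d, s), and the ends of the
  -- chord are s = ∓ sin d. In the unit disk s² ≤ sin² d.
  set m := α.baseAngle + (α.time₁ p + α.time₂ p) / 2 with hm
  set d := (α.time₂ p - α.time₁ p) / 2 with hd
  have hd0 : 0 < Real.sin d := Real.sin_pos_of_pos_of_lt_pi (by linarith) (by linarith)
  set s := z.im * Real.cos m - z.re * Real.sin m with hs
  have hc : z.re * Real.cos m + z.im * Real.sin m = Real.cos d := by
    rw [side] at hz; linarith
  have hm1 := Real.sin_sq_add_cos_sq m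
  have hd1 := Real.sin_sq_add_cos_sq d
  have hre : z.re = Real.cos d * Real.cos m - s * Real.sin m := by
    rw [← hc, hs]; linear_combination (-z.re) * hm1
  have him : z.im = Real.cos d * Real.sin m + s * Real.cos m := by
    rw [← hc, hs]; linear_combination (-z.im) * hm1
  have hp1 : (α.point₁ p : ℂ) = Complex.exp ((m - d : ℝ) * Complex.I) := by
    rw [point₁, ← exp_baseAngle, ← Circle.exp_add, Circle.coe_exp, hm, hd]
    congr 3; ring
  have hp2 : (α.point₂ p : ℂ) = Complex.exp ((m + d : ℝ) * Complex.I) := by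
    rw [point₂, ← exp_baseAngle, ← Circle.exp_add, Circle.coe_exp, hm, hd]
    congr 3; ring
  refine ⟨(1 + s / Real.sin d) / 2, ?_, fun hn => ?_⟩
  · rw [hp1, hp2]
    apply Complex.ext
    · simp only [Complex.add_re, Complex.real_smul, Complex.re_ofReal_mul,
        Complex.exp_ofReal_mul_I_re]
      rw [Real.cos_add, Real.cos_sub, hre]
      field_simp
      ring
    · simp only [Complex.add_im, Complex.real_smul, Complex.im_ofReal_mul,
        Complex.exp_ofReal_mul_I_im]
      rw [Real.sin_add, Real.sin_sub, him]
      field_simp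
      ring
  · have h4 : ‖z‖ ^ 2 ≤ 1 := by nlinarith [norm_nonneg z]
    rw [← Complex.normSq_eq_norm_sq, Complex.normSq_apply] at h4
    have h5 : z.re * z.re + z.im * z.im = Real.cos d ^ 2 + s ^ 2 := by
      rw [hre, him]; linear_combination (Real.cos d ^ 2 + s ^ 2) * hm1
    have h6 : |s| ≤ Real.sin d := abs_le_of_sq_le_sq (by nlinarith) hd0.le
    obtain ⟨h7, h8⟩ := abs_le.1 h6
    have h9 : -1 ≤ s / Real.sin d := by rw [le_div_iff₀ hd0]; linarith
    have h10 : s / Real.sin d ≤ 1 := by rw [div_le_iff₀ hd0]; linarith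
    constructor <;> linarith

theorem mem_chord_iff {p : M} (hp : p ∈ α.crossings) {z : ℂ} :
    z ∈ α.chord p ↔ z ∈ Metric.closedBall (0 : ℂ) 1 ∧ α.side p z = 0 := by
  constructor
  · rintro ⟨a, b, ha, hb, hab, rfl⟩
    refine ⟨convex_closedBall _ _ (mem_closedBall _) (mem_closedBall _) ha hb hab, ?_⟩
    rw [side_combo α p _ _ hab, side_point₁, side_point₂]
    simp
  · rintro ⟨h1, h2⟩
    obtain ⟨r, hr, h3⟩ := eq_lineMap_of_side_eq_zero hp h2
    obtain ⟨h4, h5⟩ := h3 (by simpa using h1)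
    exact ⟨1 - r, r, by linarith, h4, by ring, hr.symm⟩

theorem mem_line_iff {p : M} (hp : p ∈ α.crossings) {z : ℂ} :
    z ∈ line[ℝ, (α.point₁ p : ℂ), (α.point₂ p : ℂ)] ↔ α.side p z = 0 := by
  rw [mem_affineSpan_pair_iff_exists_lineMap_eq]
  constructor
  · rintro ⟨r, rfl⟩
    rw [AffineMap.lineMap_apply_module, side_combo α p _ _ (by ring), side_point₁, side_point₂]
    simp
  · intro h
    obtain ⟨r, hr, -⟩ := eq_lineMap_of_side_eq_zero hp h
    exact ⟨r, by rw [AffineMap.lineMap_apply_module, ← hr]⟩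

theorem sOppSide_iff {p : M} (hp : p ∈ α.crossings) {x y : ℂ} (hy : α.side p y < 0) :
    (line[ℝ, (α.point₁ p : ℂ), (α.point₂ p : ℂ)]).SOppSide x y ↔ 0 < α.side p x := by
  rw [AffineSubspace.SOppSide, AffineSubspace.wOppSide_iff_exists_wbtw, mem_line_iff hp,
    mem_line_iff hp]
  constructor
  · rintro ⟨⟨z, hz, r, ⟨hr0, hr1⟩, rfl⟩, hx, -⟩
    rw [mem_line_iff hp, AffineMap.lineMap_apply_module, side_combo α p _ _ (by ring)] at hz
    by_contra! hcon
    have hx' := lt_of_le_of_ne hcon hx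
    rcases hr0.eq_or_lt with rfl | hr
    · linarith
    · nlinarith [mul_pos_of_neg_of_neg (neg_lt_zero.2 hr) hy]
  · intro hx
    have h0 : 0 < α.side p x - α.side p y := by linarith
    refine ⟨⟨AffineMap.lineMap x y (α.side p x / (α.side p x - α.side p y)), ?_,
      α.side p x / (α.side p x - α.side p y), ⟨by positivity, ?_⟩, rfl⟩, hx.ne', hy.ne⟩
    · rw [mem_line_iff hp, AffineMap.lineMap_apply_module, side_combo α p _ _ (by ring)]
      field_simp
      ring
    · rw [div_le_one h0]; linarith

theorem side_basePreimage {p : M} (hp : p ∈ α.crossings) : α.side p α.basePreimage < 0 := by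
  have h := side_neg_iff hp 0
  rw [add_zero, exp_baseAngle] at h
  obtain ⟨h1, h2, h3, -⟩ := α.time_spec hp
  rw [h, mem_outerArcs_iff hp ⟨le_rfl, by linarith⟩]
  exact Or.inl h1

theorem side_mid {p : M} (hp : p ∈ α.crossings) :
    0 < α.side p (Circle.exp (α.baseAngle + (α.time₁ p + α.time₂ p) / 2)) := by
  obtain ⟨h1, h2, h3, -⟩ := α.time_spec hp
  rw [side_pos_iff hp, mem_rootArcs_iff (by simpa using hp) ⟨by linarith, by linarith⟩]
  exact ⟨p, by simp, by linarith, by linarith⟩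

end Side

/-! ### The faces -/

section Faces

variable {α : PointedLoop M} {H : Finset M}

theorem side_ne_zero_of_mem_splitDisk (hH : (H : Set M) ⊆ α.crossings) {z : ℂ}
    (hz : z ∈ α.splitDisk H) {p : M} (hp : p ∈ H) : α.side p z ≠ 0 := fun h =>
  hz.2 (Set.mem_biUnion hp ((mem_chord_iff (hH hp)).2 ⟨hz.1, h⟩))

theorem mem_splitDisk_of_side_ne_zero (hH : (H : Set M) ⊆ α.crossings) {z : ℂ}
    (hz : z ∈ Metric.closedBall (0 : ℂ) 1) (h : ∀ p ∈ H, α.side p z ≠ 0) :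
    z ∈ α.splitDisk H := by
  refine ⟨hz, fun hz' => ?_⟩
  simp only [Set.mem_iUnion] at hz'
  obtain ⟨p, hp, hzp⟩ := hz'
  exact h p hp ((mem_chord_iff (hH hp)).1 hzp).2

theorem pos_of_isPreconnected {C : Set ℂ} (hC : IsPreconnected C) {p : M}
    (h : ∀ z ∈ C, α.side p z ≠ 0) {z w : ℂ} (hz : z ∈ C) (hw : w ∈ C) (h0 : 0 < α.side p z) :
    0 < α.side p w := by
  by_contra! hcon
  obtain ⟨x, hx, hx0⟩ := hC.intermediate_value hw hz (α.continuous_side p).continuousOn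
    ⟨hcon, h0.le⟩
  exact h x hx hx0

/-- The set described by the inequalities is convex, hence connected, and contains the base point.
Conversely, on a connected subset of the split disk no function `side` changes its sign. -/
theorem mem_rootFace_iff (hH : (H : Set M) ⊆ α.crossings) {z : ℂ} :
    z ∈ α.rootFace H ↔ z ∈ Metric.closedBall (0 : ℂ) 1 ∧ ∀ p ∈ H, α.side p z < 0 := by
  constructor
  · intro hz
    have hsub := connectedComponentIn_subset (α.splitDisk H) (α.basePreimage : ℂ)
    refine ⟨(hsub hz).1, fun p hp => ?_⟩
    have hb : (α.basePreimage : ℂ) ∈ α.rootFace H :=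
      mem_connectedComponentIn (mem_splitDisk_of_side_ne_zero hH (mem_closedBall _) fun q hq =>
        (side_basePreimage (hH hq)).ne)
    by_contra! hcon
    have h0 := lt_of_le_of_ne hcon (side_ne_zero_of_mem_splitDisk hH (hsub hz) hp).symm
    exact absurd (pos_of_isPreconnected isPreconnected_connectedComponentIn
      (fun w hw => side_ne_zero_of_mem_splitDisk hH (hsub hw) hp) hz hb h0)
      (not_lt.2 (side_basePreimage (hH hp)).le)
  · rintro ⟨h1, h2⟩
    have hconv : Convex ℝ (Metric.closedBall (0 : ℂ) 1 ∩ ⋂ p ∈ H, {z | α.side p z < 0}) :=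
      (convex_closedBall _ _).inter (convex_iInter₂ fun p _ => (α.convex_side p).2.1)
    refine hconv.isPreconnected.subset_connectedComponentIn ⟨mem_closedBall _, ?_⟩ ?_ ⟨h1, ?_⟩
    · exact Set.mem_iInter₂.2 fun p hp => side_basePreimage (hH hp)
    · rintro w ⟨hw1, hw2⟩
      exact mem_splitDisk_of_side_ne_zero hH hw1 fun p hp => (Set.mem_iInter₂.1 hw2 p hp).ne
    · exact Set.mem_iInter₂.2 h2

/-- The open segment from a point satisfying the weak inequalities to the base point satisfies the
strict ones. -/
theorem mem_closure_rootFace_iff (hH : (H : Set M) ⊆ α.crossings) {z : ℂ} :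
    z ∈ closure (α.rootFace H) ↔
      z ∈ Metric.closedBall (0 : ℂ) 1 ∧ ∀ p ∈ H, α.side p z ≤ 0 := by
  constructor
  · intro hz
    have hcl : IsClosed (Metric.closedBall (0 : ℂ) 1 ∩ ⋂ p ∈ H, {z | α.side p z ≤ 0}) :=
      Metric.isClosed_closedBall.inter (isClosed_biInter fun p _ =>
        isClosed_le (α.continuous_side p) continuous_const)
    have := closure_minimal (fun w hw => ?_) hcl hz
    · exact ⟨this.1, fun p hp => Set.mem_iInter₂.1 this.2 p hp⟩
    · obtain ⟨h1, h2⟩ := (mem_rootFace_iff hH).1 hw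
      exact ⟨h1, Set.mem_iInter₂.2 fun p hp => (h2 p hp).le⟩
  · rintro ⟨h1, h2⟩
    have hsub : openSegment ℝ z (α.basePreimage : ℂ) ⊆ α.rootFace H := by
      rintro w ⟨a, b, ha, hb, hab, rfl⟩
      refine (mem_rootFace_iff hH).2
        ⟨convex_closedBall _ _ h1 (mem_closedBall _) ha.le hb.le hab, fun p hp => ?_⟩
      rw [side_combo α p _ _ hab]
      nlinarith [h2 p hp, side_basePreimage (hH hp)]
    apply closure_mono hsub
    rw [closure_openSegment]
    exact left_mem_segment _ _ _

/-- The circular segment cut off by `e_p`. -/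
def cap (α : PointedLoop M) (p : M) : Set ℂ :=
  {z | z ∈ Metric.closedBall (0 : ℂ) 1 ∧ 0 < α.side p z}

theorem mem_closure_cap_iff {p : M} (hp : p ∈ α.crossings) {z : ℂ} :
    z ∈ closure (α.cap p) ↔ z ∈ Metric.closedBall (0 : ℂ) 1 ∧ 0 ≤ α.side p z := by
  constructor
  · intro hz
    have hcl : IsClosed (Metric.closedBall (0 : ℂ) 1 ∩ {z | 0 ≤ α.side p z}) :=
      Metric.isClosed_closedBall.inter (isClosed_le continuous_const (α.continuous_side p))
    have hsub : α.cap p ⊆ Metric.closedBall (0 : ℂ) 1 ∩ {z | 0 ≤ α.side p z} :=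
      fun w hw => ⟨hw.1, le_of_lt hw.2⟩
    exact closure_minimal hsub hcl hz
  · rintro ⟨h1, h2⟩
    have hsub : openSegment ℝ z
        (Circle.exp (α.baseAngle + (α.time₁ p + α.time₂ p) / 2) : ℂ) ⊆ α.cap p := by
      rintro w ⟨a, b, ha, hb, hab, rfl⟩
      refine ⟨convex_closedBall _ _ h1 (mem_closedBall _) ha.le hb.le hab, ?_⟩
      rw [side_combo α p _ _ hab]
      have := mul_pos hb (side_mid hp)
      have := mul_nonneg ha.le h2
      linarith
    apply closure_mono hsub
    rw [closure_openSegment]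
    exact left_mem_segment _ _ _

theorem side_point_lt {p q : M} (hp : p ∈ α.crossings) (hq : q ∈ α.crossings)
    (h : α.Apart p q) : α.side p (α.point₁ q) < 0 ∧ α.side p (α.point₂ q) < 0 := by
  obtain ⟨h1, h2, h3, -⟩ := α.time_spec hp
  obtain ⟨h1', h2', h3', -⟩ := α.time_spec hq
  rw [point₁, point₂, ← exp_baseAngle, ← Circle.exp_add, ← Circle.exp_add, side_neg_iff hp,
    side_neg_iff hp, mem_outerArcs_iff hp ⟨by linarith, by linarith⟩,
    mem_outerArcs_iff hp ⟨by linarith, by linarith⟩]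
  rcases h with h | h
  · exact ⟨Or.inr h, Or.inr (by linarith)⟩
  · exact ⟨Or.inl (by linarith), Or.inl h⟩

theorem side_lt_of_mem_chord {p q : M} (hp : p ∈ α.crossings) (hq : q ∈ α.crossings)
    (h : α.Apart p q) {z : ℂ} (hz : z ∈ α.chord q) : α.side p z < 0 :=
  (α.convex_side p).2.1.segment_subset (side_point_lt hp hq h).1 (side_point_lt hp hq h).2 hz

/-- Adjacency puts both ends of e_q on the root side of every other e_p, so no passage of q lies
between those of p, and vice versa. Conversely, a chord apart from e_p lies strictly on its root
side. -/
theorem isSimpleCut_iff : α.IsSimpleCut H ↔ α.IsDisjointCut H := by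
  constructor
  · rintro ⟨⟨hsub, -⟩, hadj⟩
    have key : ∀ p ∈ H, ∀ q ∈ H, ¬ (α.time₁ p < α.time₁ q ∧ α.time₁ q < α.time₂ p) ∧
        ¬ (α.time₁ p < α.time₂ q ∧ α.time₂ q < α.time₂ p) := by
      intro p hp q hq
      obtain ⟨h1, h2, h3, -⟩ := α.time_spec (hsub hq)
      have e1 := (mem_closure_rootFace_iff hsub).1 (hadj q hq (left_mem_segment ℝ _ _))
      have e2 := (mem_closure_rootFace_iff hsub).1 (hadj q hq (right_mem_segment ℝ _ _))
      have e3 := not_lt.2 (e1.2 p hp)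
      have e4 := not_lt.2 (e2.2 p hp)
      rw [point₁, ← exp_baseAngle, ← Circle.exp_add, side_pos_iff (hsub hp),
        mem_rootArcs_iff (by simpa using hsub hp) ⟨by linarith, by linarith⟩] at e3
      rw [point₂, ← exp_baseAngle, ← Circle.exp_add, side_pos_iff (hsub hp),
        mem_rootArcs_iff (by simpa using hsub hp) ⟨by linarith, by linarith⟩] at e4
      exact ⟨fun h => e3 ⟨p, by simp, h⟩, fun h => e4 ⟨p, by simp, h⟩⟩
    refine ⟨fun p hp => hsub hp, fun p hp q hq hpq => ?_⟩
    obtain ⟨n1, n2, n3, n4⟩ := time_ne (hsub hp) (hsub hq) hpq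
    obtain ⟨e1, e2⟩ := key p hp q hq
    obtain ⟨e3, e4⟩ := key q hq p hp
    have h1 := (α.time_spec (hsub hp)).2.1
    have h2 := (α.time_spec (hsub hq)).2.1
    grind
  · intro h
    have hsub : (H : Set M) ⊆ α.crossings := fun p hp => h.subset p hp
    refine ⟨⟨hsub, fun p hp q hq hpq => Set.disjoint_left.2 fun z hz hz' => ?_⟩,
      fun p hp z hz => ?_⟩
    · exact (side_lt_of_mem_chord (hsub hp) (hsub hq) (h.disjoint p hp q hq hpq) hz').ne
        ((mem_chord_iff (hsub hp)).1 hz).2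
    · refine (mem_closure_rootFace_iff hsub).2 ⟨((mem_chord_iff (hsub hp)).1 hz).1,
        fun q hq => ?_⟩
      by_cases hqp : q = p
      · subst hqp
        exact ((mem_chord_iff (hsub hp)).1 hz).2.le
      · exact (side_lt_of_mem_chord (hsub hq) (hsub hp) (h.disjoint q hq p hp hqp) hz).le

theorem mem_simpleCuts_iff : H ∈ α.simpleCuts ↔ α.IsDisjointCut H := by
  classical
  rw [simpleCuts, Finset.mem_filter, Finset.mem_powerset, isSimpleCut_iff]
  refine and_iff_right_of_imp fun h p hp => ?_
  rw [Set.Finite.mem_toFinset]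
  exact h.subset p hp

/-- No other chord of H enters the cap behind e_p, so the convex cap is a whole component. The
condition on opposite sides selects it. -/
theorem IsDisjointCut.isOuterFace_iff (h : α.IsDisjointCut H) {p : M} (hp : p ∈ H) {V : Set ℂ} :
    α.IsOuterFace H p V ↔ V = α.cap p := by
  have hsub : (H : Set M) ⊆ α.crossings := fun p hp => h.subset p hp
  have hpα := h.subset p hp
  have hcap : α.cap p ⊆ α.splitDisk H := by
    rintro z ⟨hz1, hz2⟩
    refine ⟨hz1, fun hz => ?_⟩
    simp only [Set.mem_iUnion] at hz
    obtain ⟨q, hq, hzq⟩ := hz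
    by_cases hqp : p = q
    · subst hqp
      exact hz2.ne' ((mem_chord_iff hpα).1 hzq).2
    · exact lt_asymm hz2
        (side_lt_of_mem_chord hpα (h.subset q hq) (h.disjoint p hp q hq hqp) hzq)
  have hconn : IsPreconnected (α.cap p) :=
    ((convex_closedBall (0 : ℂ) 1).inter (α.convex_side p).2.2.2).isPreconnected
  have hcomp : ∀ z ∈ α.cap p, connectedComponentIn (α.splitDisk H) z = α.cap p := by
    intro z hz
    refine Set.Subset.antisymm (fun w hw => ?_) (hconn.subset_connectedComponentIn hz hcap)
    have hs := connectedComponentIn_subset (α.splitDisk H) z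
    exact ⟨(hs hw).1, pos_of_isPreconnected isPreconnected_connectedComponentIn
      (fun x hx => side_ne_zero_of_mem_splitDisk hsub (hs hx) hp)
      (mem_connectedComponentIn (hcap hz)) hw hz.2⟩
  constructor
  · rintro ⟨⟨z, hz, rfl⟩, -, hside⟩
    refine hcomp z ⟨hz.1, ?_⟩
    exact (sOppSide_iff hpα (side_basePreimage hpα)).1 (hside z (mem_connectedComponentIn hz) _
      ((mem_rootFace_iff hsub).2 ⟨mem_closedBall _, fun q hq => side_basePreimage (hsub hq)⟩))
  · rintro rfl
    have hmid : (Circle.exp (α.baseAngle + (α.time₁ p + α.time₂ p) / 2) : ℂ) ∈ α.cap p :=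
      ⟨mem_closedBall _, side_mid hpα⟩
    refine ⟨⟨_, hcap hmid, (hcomp _ hmid).symm⟩, fun z hz => ?_, fun x hx y hy => ?_⟩
    · obtain ⟨h1, h2⟩ := (mem_chord_iff hpα).1 hz
      exact (mem_closure_cap_iff hpα).2 ⟨h1, h2.ge⟩
    · exact (sOppSide_iff hpα (((mem_rootFace_iff hsub).1 hy).2 p hp)).2 hx.2

/-- Angles and times differ by the angle of the base point. The prescribed base point fixes the
additive constant of the angular function, because it has a unique preimage on β. -/
theorem isBoundaryLoop_iff {V : Set ℂ} {β : PointedLoop M} {J : Set ℝ} {a : ℝ} (ha : a ∉ J)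
    (hJ : ∀ u, u ∈ J ↔ (Circle.exp (α.baseAngle + u) : ℂ) ∉ closure V) :
    (α.IsBoundaryLoop V β.toGenericLoop ∧ β.base = α.path a) ↔ IsSubloop α J a β := by
  constructor
  · rintro ⟨⟨c, h1, h2, h3, h4, h5⟩, hbase⟩
    have hmem : ∀ u, u ∉ J → β.toFun (Circle.exp (c (α.baseAngle + u))) = α.path u := by
      intro u hu
      rw [hJ, not_not] at hu
      rw [h5 _ hu, path_eq]
    refine ⟨fun u => c (α.baseAngle + u) - c (α.baseAngle + a), ⟨by fun_prop, fun u v huv => ?_,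
      fun u => ?_, fun u v huv => ?_⟩, by simp, fun u hu => ?_⟩
    · have := h2 (show α.baseAngle + u ≤ α.baseAngle + v by linarith)
      linarith
    · rw [← add_assoc, h3]
      ring
    · rw [sub_left_inj, h4 _ _ (by linarith)]
      constructor
      · intro h t ht
        exact (hJ t).2 (h _ ⟨by linarith [ht.1], by linarith [ht.2]⟩)
      · intro h t ht
        have := (hJ _).1 (h (⟨by linarith [ht.1], by linarith [ht.2]⟩ :
          t - α.baseAngle ∈ Set.Ioo u v))
        rwa [add_sub_cancel] at this
    · rw [← hmem u hu, path]
      have h6 := β.eq_basePreimage ((hmem a ha).trans hbase.symm)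
      rw [← h6, ← Circle.exp_add, add_sub_cancel]
  · rintro ⟨c, hc, hca, hβ⟩
    refine ⟨⟨fun u => c (u - α.baseAngle) + β.baseAngle, ?_, fun u v huv => ?_, fun u => ?_,
      fun u v huv => ?_, fun u hu => ?_⟩, ?_⟩
    · have := hc.continuous
      fun_prop
    · have := hc.monotone (show u - α.baseAngle ≤ v - α.baseAngle by linarith)
      linarith
    · dsimp only
      rw [show u + 2 * Real.pi - α.baseAngle = u - α.baseAngle + 2 * Real.pi by ring,
        hc.add_period]
      ring
    · rw [add_left_inj, hc.eq_iff _ _ (by linarith)]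
      constructor
      · intro h t ht
        have := (hJ _).1 (h (⟨by linarith [ht.1], by linarith [ht.2]⟩ :
          t - α.baseAngle ∈ Set.Ioo (u - α.baseAngle) (v - α.baseAngle)))
        rwa [add_sub_cancel] at this
      · intro h t ht
        exact (hJ t).2 (h _ ⟨by linarith [ht.1], by linarith [ht.2]⟩)
    · rw [angular_eq_path, angular_eq_path, add_sub_cancel_right]
      refine hβ _ ?_
      rw [hJ, not_not, add_sub_cancel]
      exact hu
    · rw [← hβ a ha, hca, path_zero]

theorem IsDisjointCut.mem_rootArcs_iff_closure (h : α.IsDisjointCut H) (u : ℝ) :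
    u ∈ α.rootArcs H ↔ (Circle.exp (α.baseAngle + u) : ℂ) ∉ closure (α.rootFace H) := by
  rw [mem_closure_rootFace_iff fun p hp => h.subset p hp, and_iff_right (mem_closedBall _)]
  push Not
  constructor
  · intro hu
    obtain ⟨q, hq, hu⟩ := exists_mem_rootArcs hu
    exact ⟨q, hq, (side_pos_iff (h.subset q hq) u).2 hu⟩
  · rintro ⟨q, hq, hu⟩
    exact mem_rootArcs_of hq ((side_pos_iff (h.subset q hq) u).1 hu)

theorem mem_outerArcs_iff_closure {p : M} (hp : p ∈ α.crossings) (u : ℝ) :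
    u ∈ α.outerArcs p ↔ (Circle.exp (α.baseAngle + u) : ℂ) ∉ closure (α.cap p) := by
  rw [mem_closure_cap_iff hp, and_iff_right (mem_closedBall _), not_le, side_neg_iff hp]

theorem IsDisjointCut.isRootLoop_iff (h : α.IsDisjointCut H) {β : PointedLoop M} :
    α.IsRootLoop H β ↔ IsSubloop α (α.rootArcs H) 0 β := by
  rw [← isBoundaryLoop_iff h.isRemovable.start_notMem h.mem_rootArcs_iff_closure, path_zero]
  rfl

theorem IsDisjointCut.isOuterLoop_iff (h : α.IsDisjointCut H) {p : M} (hp : p ∈ H)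
    {β : PointedLoop M} :
    α.IsOuterLoop H p β ↔ IsSubloop α (α.outerArcs p) (α.time₁ p) β := by
  have hpα := h.subset p hp
  rw [← isBoundaryLoop_iff (isRemovable_outer hpα).start_notMem (mem_outerArcs_iff_closure hpα),
    (α.time_spec hpα).2.2.2.1]
  constructor
  · rintro ⟨V, hV, h1⟩
    rw [h.isOuterFace_iff hp] at hV
    subst hV
    exact h1
  · intro h1
    exact ⟨_, (h.isOuterFace_iff hp).2 rfl, h1⟩

theorem IsDisjointCut.isotopyClass_of_isRootLoop (h : α.IsDisjointCut H) {β : PointedLoop M}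
    (hβ : α.IsRootLoop H β) : β.isotopyClass = (α.rootLoop H).isotopyClass :=
  (h.isRootLoop_iff.1 hβ).isotopyClass_eq h.isSubloop (isOpen_arcUnion _ _ _)

theorem IsDisjointCut.isotopyClass_of_isOuterLoop (h : α.IsDisjointCut H) {p : M} (hp : p ∈ H)
    {β : PointedLoop M} (hβ : α.IsOuterLoop H p β) :
    β.isotopyClass = (α.outerLoop p).isotopyClass :=
  ((h.isOuterLoop_iff hp).1 hβ).isotopyClass_eq (isSubloop_outerLoop (h.subset p hp))
    (isOpen_arcUnion _ _ _)

theorem IsDisjointCut.isRootLoop_rootLoop (h : α.IsDisjointCut H) :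
    α.IsRootLoop H (α.rootLoop H) := h.isRootLoop_iff.2 h.isSubloop

theorem IsDisjointCut.isOuterLoop_outerLoop (h : α.IsDisjointCut H) {p : M} (hp : p ∈ H) :
    α.IsOuterLoop H p (α.outerLoop p) :=
  (h.isOuterLoop_iff hp).2 (isSubloop_outerLoop (h.subset p hp))

/-- Existence makes the choice operator return the class of some admissible loop, and uniqueness
identifies it with the constructed one. -/
theorem IsDisjointCut.rootClass_eq (h : α.IsDisjointCut H) :
    α.rootClass H = (α.rootLoop H).isotopyClass := by
  obtain ⟨β, h1, h2⟩ := @Classical.epsilon_spec_aux _ ⟨α.isotopyClass⟩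
    (fun x => ∃ β, α.IsRootLoop H β ∧ x = β.isotopyClass) ⟨_, _, h.isRootLoop_rootLoop, rfl⟩
  exact h2.trans (h.isotopyClass_of_isRootLoop h1)

theorem IsDisjointCut.outerClass_eq (h : α.IsDisjointCut H) {p : M} (hp : p ∈ H) :
    α.outerClass H p = (α.outerLoop p).isotopyClass := by
  obtain ⟨β, h1, h2⟩ := @Classical.epsilon_spec_aux _ ⟨α.isotopyClass⟩
    (fun x => ∃ β, α.IsOuterLoop H p β ∧ x = β.isotopyClass)
    ⟨_, _, h.isOuterLoop_outerLoop hp, rfl⟩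
  exact h2.trans (h.isotopyClass_of_isOuterLoop hp h1)

end Faces

end PointedLoop

section Invariance

variable {M : Type*} [TopologicalSpace M] [ChartedSpace (EuclideanHalfSpace 2) M]

/-! ### Isotopic loops have the same cuts -/

/-- A bijection between the crossings of `α` and `β` which preserves all data associated with
cuts. -/
structure CutEquiv [IsManifold (𝓡∂ 2) ∞ M] (o : SurfaceOrientation M) (α β : PointedLoop M)
    (e : M ≃ M) (φ : ℝ → ℝ) : Prop where
  strictMono : StrictMono φ
  mem : ∀ p, e p ∈ β.crossings ↔ p ∈ α.crossings
  time₁ : ∀ p ∈ α.crossings, α.time₁ p = φ (β.time₁ (e p))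
  time₂ : ∀ p ∈ α.crossings, α.time₂ p = φ (β.time₂ (e p))
  sign : ∀ p ∈ α.crossings, β.sign o (e p) = α.sign o p
  root : ∀ H : Finset M, α.IsDisjointCut H → β.IsDisjointCut (H.map e.toEmbedding) →
    (β.rootLoop (H.map e.toEmbedding)).isotopyClass = (α.rootLoop H).isotopyClass
  outer : ∀ p ∈ α.crossings, (β.outerLoop (e p)).isotopyClass = (α.outerLoop p).isotopyClass

theorem CutEquiv.isDisjointCut_map [IsManifold (𝓡∂ 2) ∞ M] {o : SurfaceOrientation M}
    {α β : PointedLoop M} {e : M ≃ M} {φ : ℝ → ℝ} (h : CutEquiv o α β e φ) {H : Finset M} :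
    β.IsDisjointCut (H.map e.toEmbedding) ↔ α.IsDisjointCut H := by
  constructor
  · intro h'
    have hsub : ∀ p ∈ H, p ∈ α.crossings := fun p hp =>
      (h.mem p).1 (h'.subset _ (Finset.mem_map_of_mem _ hp))
    refine ⟨hsub, fun p hp q hq hpq => ?_⟩
    rw [h.time₁ p (hsub p hp), h.time₂ p (hsub p hp), h.time₁ q (hsub q hq),
      h.time₂ q (hsub q hq), h.strictMono.lt_iff_lt, h.strictMono.lt_iff_lt]
    exact h'.disjoint _ (Finset.mem_map_of_mem _ hp) _ (Finset.mem_map_of_mem _ hq)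
      (e.injective.ne hpq)
  · intro h'
    refine ⟨fun p' hp' => ?_, fun p' hp' q' hq' hpq => ?_⟩
    · obtain ⟨p, hp, rfl⟩ := Finset.mem_map.1 hp'
      exact (h.mem p).2 (h'.subset p hp)
    · obtain ⟨p, hp, rfl⟩ := Finset.mem_map.1 hp'
      obtain ⟨q, hq, rfl⟩ := Finset.mem_map.1 hq'
      have := h'.disjoint p hp q hq fun h => hpq (by rw [h])
      rwa [h.time₁ p (h'.subset p hp), h.time₂ p (h'.subset p hp), h.time₁ q (h'.subset q hq),
        h.time₂ q (h'.subset q hq), h.strictMono.lt_iff_lt, h.strictMono.lt_iff_lt] at this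

/-! ### Reparametrizations -/

namespace PointedLoop

variable {α β : PointedLoop M}

/-- A reparametrization relates the paths by a change of time. -/
theorem exists_path_eq_of_reparametrization (h : Reparametrization α β) : ∃ F : ℝ → ℝ,
    Continuous F ∧ StrictMono F ∧ (∀ u, F (u + 2 * Real.pi) = F u + 2 * Real.pi) ∧ F 0 = 0 ∧
      ∀ u, β.path u = α.path (F u) := by
  obtain ⟨hbase, f, ⟨F, hF, hmono, hf⟩, hβ⟩ := h
  -- F raises by a positive multiple of 2π over a period. If it were at least 4π, an intermediate
  -- time would have the same image on the circle, against injectivity of f.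
  have hper : ∀ u, F (u + 2 * Real.pi) = F u + 2 * Real.pi := by
    intro u
    have h1 : Circle.exp (F (u + 2 * Real.pi)) = Circle.exp (F u) := by
      rw [← hf, ← hf, Circle.periodic_exp u]
    obtain ⟨k, hk⟩ := exp_eq_iff.1 h1
    have hp := Real.two_pi_pos
    have hlt := hmono (show u < u + 2 * Real.pi by linarith)
    have hk1 : 0 < k := by
      have : (0 : ℝ) < k := by by_contra! h; nlinarith
      exact_mod_cast this
    by_contra hne
    have hk2 : 2 ≤ k := by
      by_contra! h3
      have : k = 1 := by omega
      rw [this, Int.cast_one, one_mul] at hk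
      exact hne hk
    have hk2' : (2 : ℝ) ≤ k := by exact_mod_cast hk2
    obtain ⟨v, hv, hFv⟩ := intermediate_value_Ioo (show u ≤ u + 2 * Real.pi by linarith)
      hF.continuousOn (show F u + 2 * Real.pi ∈ _ from ⟨by linarith, by rw [hk]; nlinarith⟩)
    have h4 : f (Circle.exp v) = f (Circle.exp u) := by
      rw [hf, hf, hFv, Circle.periodic_exp]
    obtain ⟨l, hl⟩ := exp_eq_iff.1 (f.injective h4)
    have e1 := hv.1
    have e2 := hv.2
    rw [hl] at e1 e2
    have l1 : (0 : ℝ) < l := by by_contra! h; nlinarith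
    have l2 : (l : ℝ) < 1 := by by_contra! h; nlinarith
    have l1' : 0 < l := by exact_mod_cast l1
    have l2' : l < 1 := by exact_mod_cast l2
    omega
  have h0 : Circle.exp (F β.baseAngle) = α.basePreimage := by
    refine α.eq_basePreimage ?_
    rw [hbase, ← β.toFun_basePreimage, ← β.exp_baseAngle, hβ, Function.comp, hf]
  refine ⟨fun u => F (β.baseAngle + u) - F β.baseAngle, by fun_prop, fun u v huv => ?_,
    fun u => ?_, by simp, fun u => ?_⟩
  · have := hmono (show β.baseAngle + u < β.baseAngle + v by linarith)
    linarith
  · dsimp only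
    rw [← add_assoc, hper]
    ring
  · rw [path_eq, hβ, Function.comp, hf, path, ← h0, ← Circle.exp_add, add_sub_cancel]

theorem crossings_eq_of_reparametrization (h : Reparametrization α β) :
    β.crossings = α.crossings := by
  obtain ⟨-, f, -, hβ⟩ := h
  ext p
  constructor
  · rintro ⟨z, w, hzw, hz, hw⟩
    rw [hβ] at hz hw
    exact ⟨f z, f w, f.injective.ne hzw, hz, hw⟩
  · rintro ⟨z, w, hzw, hz, hw⟩
    refine ⟨f.symm z, f.symm w, f.symm.injective.ne hzw, ?_, ?_⟩ <;> rw [hβ, Function.comp] <;>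
      rwa [f.apply_symm_apply]

theorem time_of_path_eq {F : ℝ → ℝ} (hmono : StrictMono F)
    (hper : ∀ u, F (u + 2 * Real.pi) = F u + 2 * Real.pi) (h0 : F 0 = 0)
    (h : ∀ u, β.path u = α.path (F u)) {p : M} (hp : p ∈ β.crossings) :
    α.time₁ p = F (β.time₁ p) ∧ α.time₂ p = F (β.time₂ p) := by
  obtain ⟨h1, h2, h3, h4, h5⟩ := β.time_spec hp
  have e1 := hmono h1
  have e2 := hmono h2
  have e3 := hmono h3
  have e4 := hper 0
  rw [zero_add, h0, zero_add] at e4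
  rw [h0] at e1
  rw [e4] at e3
  rw [h] at h4 h5
  have := α.time_eq e1 e2 e3 (h4.trans h5.symm)
  rw [h4] at this
  exact this.2

theorem preimage_arcUnion {ι : Type*} {F : ℝ → ℝ} (hmono : StrictMono F)
    (hper : ∀ (u : ℝ) (k : ℤ), F (u + k * (2 * Real.pi)) = F u + k * (2 * Real.pi)) {H : Finset ι}
    {s t s' t' : ι → ℝ} (hs : ∀ p ∈ H, s p = F (s' p)) (ht : ∀ p ∈ H, t p = F (t' p)) :
    F ⁻¹' arcUnion H s t = arcUnion H s' t' := by
  ext u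
  refine exists_congr fun p => and_congr_right fun hp => exists_congr fun k => ?_
  rw [hs p hp, ht p hp, ← hper, Set.mem_Ioo, Set.mem_Ioo, hmono.lt_iff_lt, hmono.lt_iff_lt]

/-- The crossings stay the same and their times change by F. Velocities are multiplied by positive
factors, possibly different at the two passages, which does not affect the sign. -/
theorem exists_cutEquiv_of_reparametrization [IsManifold (𝓡∂ 2) ∞ M] (o : SurfaceOrientation M)
    (h : Reparametrization α β) : ∃ F, CutEquiv o α β (Equiv.refl M) F := by
  have hcr := crossings_eq_of_reparametrization h
  obtain ⟨F, hF, hmono, hper, h0, hpath⟩ := exists_path_eq_of_reparametrization h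
  have hcol : IsCollapse ∅ F := ⟨hF, hmono.monotone, hper, fun u v huv => by
    refine ⟨fun h => absurd h (hmono huv).ne, fun h => ?_⟩
    exact absurd (h (⟨by linarith, by linarith⟩ : (u + v) / 2 ∈ Set.Ioo u v)) (by simp)⟩
  have ht : ∀ p ∈ α.crossings, α.time₁ p = F (β.time₁ p) ∧ α.time₂ p = F (β.time₂ p) :=
    fun p hp => time_of_path_eq hmono hper h0 hpath (hcr ▸ hp)
  refine ⟨F, hmono, fun p => by rw [Equiv.refl_apply, hcr], fun p hp => (ht p hp).1,
    fun p hp => (ht p hp).2, fun p hp => ?_, fun H hα hβ => ?_, fun p hp => ?_⟩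
  · obtain ⟨-, -, -, h4, h5⟩ := α.time_spec hp
    obtain ⟨-, -, -, h4', h5'⟩ := β.time_spec (hcr ▸ hp : p ∈ β.crossings)
    obtain ⟨t1, t2⟩ := ht p hp
    obtain ⟨r, hr, er⟩ := velocity_comp_eq_smul hF hmono hpath (u := β.time₁ p)
      (β.velocity_ne_zero_of_crossing (by rwa [h4', hcr]))
      (α.velocity_ne_zero_of_crossing (by rwa [← t1, h4]))
    obtain ⟨s, hs, es⟩ := velocity_comp_eq_smul hF hmono hpath (u := β.time₂ p)
      (β.velocity_ne_zero_of_crossing (by rwa [h5', hcr]))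
      (α.velocity_ne_zero_of_crossing (by rwa [← t2, h5]))
    have h7 := SurfaceOrientation.IsPositive.smul_iff o p (velocity α.path Set.univ (α.time₁ p))
      (velocity α.path Set.univ (α.time₂ p)) hr hs
    rw [Equiv.refl_apply]
    unfold sign
    rw [er, es, ← t1, ← t2]
    classical exact if_congr h7 rfl rfl
  · have hmap : H.map (Equiv.refl M).toEmbedding = H := by
      ext p; simp
    rw [hmap] at hβ ⊢
    have h1 := (h0.symm ▸ hα.isSubloop : IsSubloop α (α.rootArcs H) (F 0) _).reparam hF hmono
      hcol.surjective hper hpath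
    rw [rootArcs, preimage_arcUnion hmono hcol.add_int (fun p hp => (ht p (hα.subset p hp)).1)
      (fun p hp => (ht p (hα.subset p hp)).2)] at h1
    exact hβ.isSubloop.isotopyClass_eq h1 (isOpen_arcUnion _ _ _)
  · rw [Equiv.refl_apply]
    have h1 := ((ht p hp).1 ▸ isSubloop_outerLoop hp :
      IsSubloop α (α.outerArcs p) (F (β.time₁ p)) _).reparam hF hmono hcol.surjective hper hpath
    have hsub : ∀ x, F (x - 2 * Real.pi) = F x - 2 * Real.pi := fun x => by
      have := hper (x - 2 * Real.pi)
      rw [sub_add_cancel] at this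
      linarith
    rw [outerArcs, preimage_arcUnion (s' := fun p => β.time₂ p - 2 * Real.pi) (t' := β.time₁)
      hmono hcol.add_int (fun q hq => ?_) (fun q hq => ?_)] at h1
    · exact (isSubloop_outerLoop (hcr ▸ hp)).isotopyClass_eq h1 (isOpen_arcUnion _ _ _)
    · rw [Finset.mem_singleton] at hq
      rw [hsub, hq, (ht p hp).2]
    · rw [Finset.mem_singleton] at hq
      rw [hq, (ht p hp).1]

/-! ### Ambient isotopies -/

theorem path_of_toFun_eq {h : M ≃ₜ M} (hfun : β.toFun = h ∘ α.toFun) (hbase : β.base = h α.base)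
    (u : ℝ) : β.path u = h (α.path u) := by
  have h1 : α.basePreimage = β.basePreimage := by
    refine β.eq_basePreimage ?_
    rw [hfun, Function.comp, α.toFun_basePreimage, hbase]
  rw [path, path, ← h1, hfun, Function.comp]

theorem mem_crossings_of_toFun_eq {h : M ≃ₜ M} (hfun : β.toFun = h ∘ α.toFun) (p : M) :
    h p ∈ β.crossings ↔ p ∈ α.crossings := by
  simp only [crossings, selfCrossings, hfun, Function.comp, Set.mem_ofPred_eq,
    h.injective.eq_iff]

theorem time_of_toFun_eq {h : M ≃ₜ M} (hfun : β.toFun = h ∘ α.toFun) (hbase : β.base = h α.base)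
    (p : M) : α.time₁ p = β.time₁ (h p) ∧ α.time₂ p = β.time₂ (h p) := by
  simp only [time₁, time₂, path_of_toFun_eq hfun hbase, h.injective.eq_iff, and_self]

/-- Subloops of α and β are formed with the same times and the same collapse, so the given ambient
isotopy carries one to the other. -/
theorem isotopyClass_subloop_eq {h : unitInterval → M ≃ₜ M}
    (hh : Continuous fun x : unitInterval × M => h x.1 x.2) (h0 : h 0 = Homeomorph.refl M)
    (hfun : β.toFun = h 1 ∘ α.toFun) (hbase : β.base = h 1 α.base) {J J' : Set ℝ} {a a' : ℝ}
    (hJ : J = J') (ha : a = a') (hα : IsRemovable α J a) (hβ : IsRemovable β J' a') :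
    (subloop β J' a' hβ).isotopyClass = (subloop α J a hα).isotopyClass := by
  subst hJ ha
  suffices h' : AmbientIsotopic (subloop α J a hα) (subloop β J a hβ) by
    have h2 : (subloop α J a hα).isotopyClass = (subloop β J a hβ).isotopyClass :=
      Quot.sound (Or.inr h')
    exact h2.symm
  refine ⟨h, hh, h0, ?_, ?_⟩
  · funext z
    obtain ⟨t, rfl⟩ := Circle.exp_surjective z
    rw [Function.comp, subloop_toFun_exp, subloop_toFun_exp]
    exact path_of_toFun_eq hfun hbase _
  · exact path_of_toFun_eq hfun hbase _

/-- There are finitely many crossings, so the first time of p is isolated among all first times. -/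
theorem exists_meetOnlyAtZero (α : PointedLoop M) {p : M} (hp : p ∈ α.crossings) :
    ∃ δ > 0, MeetOnlyAtZero (fun s => α.path (α.time₁ p + s)) (fun s => α.path (α.time₂ p + s))
      δ := by
  obtain ⟨h1, h2, h3, h4, h5⟩ := α.time_spec hp
  have hfin : (α.time₁ '' α.crossings \ {α.time₁ p}).Finite :=
    (α.finite_crossings.image _).subset Set.sdiff_subset
  obtain ⟨ε, hε, hball⟩ := Metric.isOpen_iff.1 hfin.isClosed.isOpen_compl (α.time₁ p)
    fun h => h.2 rfl
  -- These bounds keep the perturbed times in ]0, 2π[ and in their order, so that `time_eq`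
  -- recognizes them as the times of a crossing.
  refine ⟨min ε (min (α.time₁ p) (min ((α.time₂ p - α.time₁ p) / 2) (2 * Real.pi - α.time₂ p))),
    by simp only [gt_iff_lt, lt_min_iff]; exact ⟨hε, h1, by linarith, by linarith⟩,
    fun s t hs ht hst => ?_⟩
  simp only [lt_min_iff, abs_lt] at hs ht
  obtain ⟨⟨s1, s2⟩, ⟨s3, s4⟩, ⟨s5, s6⟩, s7, s8⟩ := hs
  obtain ⟨⟨t1, t2⟩, ⟨t3, t4⟩, ⟨t5, t6⟩, t7, t8⟩ := ht
  obtain ⟨e1, e2, e3⟩ := α.time_eq (by linarith) (by linarith) (by linarith) hst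
  have e4 : α.time₁ p + s = α.time₁ p := by
    by_contra hne
    have := hball (show α.time₁ p + s ∈ Metric.ball (α.time₁ p) ε by
      rw [Real.ball_eq_Ioo]; constructor <;> linarith)
    exact this ⟨⟨_, e1, e2⟩, hne⟩
  have e5 : s = 0 := by linarith
  subst e5
  simp only [add_zero, h4] at e3
  exact ⟨rfl, by linarith⟩

theorem hasDerivAt_path {γ : ℝ → M} {t : ℝ} (h : velocity γ Set.univ t ≠ 0) :
    HasDerivAt (fun s => extChartAt (𝓡∂ 2) (γ t) (γ (t + s))) (velocity γ Set.univ t) 0 := by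
  have h1 := (hasDerivWithinAt_of_mdifferentiable
    (mdifferentiable_of_velocity_ne_zero h)).hasDerivAt Filter.univ_mem
  have h2 : HasDerivAt (extChartAt (𝓡∂ 2) (γ t) ∘ γ) (velocity γ Set.univ t) (t + 0) := by
    rwa [add_zero]
  exact HasDerivAt.comp_const_add t 0 h2

/-- The final homeomorphism matches the crossings and leaves the times unchanged. Only the sign
needs the local index, because the homeomorphisms need not be differentiable. -/
theorem exists_cutEquiv_of_ambientIsotopic [IsManifold (𝓡∂ 2) ∞ M] (o : SurfaceOrientation M)
    (h : AmbientIsotopic α β) : ∃ e, CutEquiv o α β e id := by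
  obtain ⟨h, hh, h0, hfun, hbase⟩ := h
  have hmem := mem_crossings_of_toFun_eq hfun
  have ht := time_of_toFun_eq hfun hbase
  have hpath := path_of_toFun_eq hfun hbase
  refine ⟨(h 1).toEquiv, strictMono_id, hmem, fun p _ => (ht p).1, fun p _ => (ht p).2,
    fun p hp => ?_, fun H hα hβ => ?_, fun p hp => ?_⟩
  · obtain ⟨-, -, -, h4, h5⟩ := α.time_spec hp
    have hp' := (hmem p).2 hp
    obtain ⟨-, -, -, h4', h5'⟩ := β.time_spec hp'
    obtain ⟨δ, hδ, hmeet⟩ := α.exists_meetOnlyAtZero hp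
    have hA : Continuous fun s => α.path (α.time₁ p + s) :=
      α.continuous_path.comp (continuous_const.add continuous_id)
    have hB : Continuous fun s => α.path (α.time₂ p + s) :=
      α.continuous_path.comp (continuous_const.add continuous_id)
    have v1 := hasDerivAt_path (α.velocity_ne_zero_of_crossing (u := α.time₁ p) (by rwa [h4]))
    have v2 := hasDerivAt_path (α.velocity_ne_zero_of_crossing (u := α.time₂ p) (by rwa [h5]))
    have v3 := hasDerivAt_path (β.velocity_ne_zero_of_crossing (u := β.time₁ (h 1 p))
      (by rwa [h4']))
    have v4 := hasDerivAt_path (β.velocity_ne_zero_of_crossing (u := β.time₂ (h 1 p))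
      (by rwa [h5']))
    rw [h4] at v1
    rw [h5] at v2
    rw [h4'] at v3
    rw [h5'] at v4
    simp only [hpath] at v3 v4
    have key := isPositive_iff_of_isotopy o hh hA hB (by simp [h4, h5]) hδ hmeet
      (v := velocity α.path Set.univ (α.time₁ p)) (w := velocity α.path Set.univ (α.time₂ p))
      (v' := velocity β.path Set.univ (β.time₁ (h 1 p)))
      (w' := velocity β.path Set.univ (β.time₂ (h 1 p)))
      (by simpa only [h0, add_zero, h4] using! v1) (by simpa only [h0, add_zero, h4] using! v2)
      (α.det₂_velocity_ne_zero hp)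
      (by simpa only [add_zero, h4, ← (ht p).1] using! v3)
      (by simpa only [add_zero, h4, ← (ht p).2] using! v4)
      (β.det₂_velocity_ne_zero hp')
    simp only [add_zero, h4, h0, Homeomorph.refl_apply, id] at key
    unfold sign
    classical exact (if_congr key rfl rfl).symm
  · rw [hα.rootLoop_eq, hβ.rootLoop_eq]
    refine isotopyClass_subloop_eq hh h0 hfun hbase ?_ rfl _ _
    ext u
    simp only [rootArcs, arcUnion, Set.mem_ofPred_eq, Finset.mem_map, exists_exists_and_eq_and,
      Equiv.coe_toEmbedding, Homeomorph.coe_toEquiv, ← (ht _).1, ← (ht _).2]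
  · rw [outerLoop_eq hp, Homeomorph.coe_toEquiv, outerLoop_eq ((hmem p).2 hp)]
    refine isotopyClass_subloop_eq hh h0 hfun hbase ?_ (ht p).1 _ _
    ext u
    simp only [outerArcs, arcUnion, Set.mem_ofPred_eq, Finset.mem_singleton, exists_eq_left,
      ← (ht _).1, ← (ht _).2]

end PointedLoop

end Invariance

section OrderedProducts

variable {M : Type*} [TopologicalSpace M] [ChartedSpace (EuclideanHalfSpace 2) M]

namespace PointedLoop

variable (α : PointedLoop M)

/-! ### Products over crossings in the order of their first times -/

open Classical in
/-- The crossings in `H` in the order of their first times. -/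
def timeList (H : Finset M) : List M := ((H.image α.time₁).sort).map α.path

/-- The product over `H` in the order of the first times. -/
def orderedProd {A : Type*} [Monoid A] (f : M → A) (H : Finset M) : A :=
  ((α.timeList H).map f).prod

variable {α} {A B : Type*} [Monoid A] [Monoid B] {H K : Finset M}

theorem mem_timeList (h : ∀ p ∈ H, p ∈ α.crossings) {p : M} : p ∈ α.timeList H ↔ p ∈ H := by
  simp only [timeList, List.mem_map, Finset.mem_sort, Finset.mem_image, exists_exists_and_eq_and]
  constructor
  · rintro ⟨q, hq, rfl⟩
    rwa [(α.time_spec (h q hq)).2.2.2.1]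
  · intro hp
    exact ⟨p, hp, (α.time_spec (h p hp)).2.2.2.1⟩

theorem pairwise_timeList (h : ∀ p ∈ H, p ∈ α.crossings) :
    (α.timeList H).Pairwise fun p q => α.time₁ p < α.time₁ q := by
  classical
  rw [timeList, List.pairwise_map]
  refine ((H.image α.time₁).sortedLT_sort.pairwise).imp_of_mem fun {u v} hu hv huv => ?_
  rw [Finset.mem_sort, Finset.mem_image] at hu hv
  obtain ⟨p, hp, rfl⟩ := hu
  obtain ⟨q, hq, rfl⟩ := hv
  rwa [(α.time_spec (h p hp)).2.2.2.1, (α.time_spec (h q hq)).2.2.2.1]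

theorem eq_timeList (h : ∀ p ∈ H, p ∈ α.crossings) {l : List M}
    (hl : l.Pairwise fun p q => α.time₁ p < α.time₁ q) (hmem : ∀ p, p ∈ l ↔ p ∈ H) :
    l = α.timeList H := by
  have : Std.Antisymm fun p q : M => α.time₁ p < α.time₁ q :=
    ⟨fun _ _ h1 h2 => absurd h1 (lt_asymm h2)⟩
  have : Std.Irrefl fun p q : M => α.time₁ p < α.time₁ q := ⟨fun _ => lt_irrefl _⟩
  exact hl.eq_of_mem_iff (pairwise_timeList h) fun p => by rw [hmem, mem_timeList h]

theorem orderedProd_congr (h : ∀ p ∈ H, p ∈ α.crossings) {f g : M → A}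
    (hfg : ∀ p ∈ H, f p = g p) : α.orderedProd f H = α.orderedProd g H := by
  rw [orderedProd, orderedProd]
  congr 1
  exact List.map_congr_left fun p hp => hfg p ((mem_timeList h).1 hp)

theorem orderedProd_empty (f : M → A) : α.orderedProd f ∅ = 1 := by
  simp [orderedProd, timeList]

theorem orderedProd_singleton {p : M} (hp : p ∈ α.crossings) (f : M → A) :
    α.orderedProd f {p} = f p := by
  rw [orderedProd, ← eq_timeList (l := [p]) (by simpa using hp) (by simp) (by simp)]
  simp

open Classical in
theorem orderedProd_union (hH : ∀ p ∈ H, p ∈ α.crossings) (hK : ∀ p ∈ K, p ∈ α.crossings)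
    (h : ∀ p ∈ H, ∀ q ∈ K, α.time₁ p < α.time₁ q) (f : M → A) :
    α.orderedProd f (H ∪ K) = α.orderedProd f H * α.orderedProd f K := by
  rw [orderedProd, orderedProd, orderedProd,
    ← eq_timeList (H := H ∪ K) (l := α.timeList H ++ α.timeList K), List.map_append,
    List.prod_append]
  · intro p hp
    exact (Finset.mem_union.1 hp).elim (hH p) (hK p)
  · refine List.pairwise_append.2 ⟨pairwise_timeList hH, pairwise_timeList hK, fun p hp q hq => ?_⟩
    exact h p ((mem_timeList hH).1 hp) q ((mem_timeList hK).1 hq)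
  · intro p
    rw [List.mem_append, mem_timeList hH, mem_timeList hK, Finset.mem_union]

theorem map_orderedProd {F : Type*} [FunLike F A B] [MonoidHomClass F A B] (φ : F) (f : M → A) :
    φ (α.orderedProd f H) = α.orderedProd (fun p => φ (f p)) H := by
  rw [orderedProd, orderedProd, map_list_prod, List.map_map]
  rfl

theorem orderedProd_eq_prod {C : Type*} [CommMonoid C] (h : ∀ p ∈ H, p ∈ α.crossings) (f : M → C) :
    α.orderedProd f H = ∏ p ∈ H, f p := by
  classical
  have hnd : (α.timeList H).Nodup := (pairwise_timeList h).imp fun hpq => by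
    rintro rfl; exact lt_irrefl _ hpq
  rw [orderedProd, ← List.prod_toFinset f hnd]
  congr 1
  ext p
  rw [List.mem_toFinset, mem_timeList h]

/-- Ordered products are compatible with bijections which preserve the order of the times. -/
theorem orderedProd_map {β : PointedLoop M} (e : M ↪ M) (h : ∀ p ∈ H, p ∈ α.crossings)
    (h' : ∀ p ∈ H, e p ∈ β.crossings)
    (hlt : ∀ p ∈ H, ∀ q ∈ H, α.time₁ p < α.time₁ q → β.time₁ (e p) < β.time₁ (e q)) (f : M → A) :
    β.orderedProd f (H.map e) = α.orderedProd (fun p => f (e p)) H := by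
  rw [orderedProd, orderedProd, ← eq_timeList (H := H.map e) (l := (α.timeList H).map e),
    List.map_map]
  · rfl
  · intro p hp
    obtain ⟨q, hq, rfl⟩ := Finset.mem_map.1 hp
    exact h' q hq
  · rw [List.pairwise_map]
    refine (pairwise_timeList h).imp_of_mem fun {p q} hp hq hpq => ?_
    exact hlt p ((mem_timeList h).1 hp) q ((mem_timeList h).1 hq) hpq
  · intro p
    simp only [List.mem_map, mem_timeList h, Finset.mem_map]

/-! ### Cuts of subloops -/

theorem lt_iff_of_isSingle {c : ℝ → ℝ} (hc : Monotone c) {u v : ℝ} (hu : IsSingle c u) :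
    c u < c v ↔ u < v := by
  constructor
  · intro h
    by_contra! hle
    exact absurd (hc hle) (not_le.2 h)
  · intro h
    exact lt_of_le_of_ne (hc h.le) fun he => h.ne' (hu v he.symm)

variable {β : PointedLoop M}

theorem _root_.LoopHopf.TimesEmbed.time₁_lt_iff (h : TimesEmbed α β) {p q : M}
    (hp : p ∈ β.crossings) (hq : q ∈ β.crossings) :
    β.time₁ p < β.time₁ q ↔ α.time₁ p < α.time₁ q := by
  obtain ⟨c, hc, h⟩ := h
  rw [(h p hp).2.1, (h q hq).2.1, lt_iff_of_isSingle hc (h p hp).2.2.2.1]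

theorem _root_.LoopHopf.TimesEmbed.apart_iff (h : TimesEmbed α β) {p q : M}
    (hp : p ∈ β.crossings) (hq : q ∈ β.crossings) : β.Apart p q ↔ α.Apart p q := by
  obtain ⟨c, hc, h⟩ := h
  rw [Apart, Apart, (h p hp).2.1, (h q hq).2.1, (h p hp).2.2.1, (h q hq).2.2.1,
    lt_iff_of_isSingle hc (h p hp).2.2.2.2, lt_iff_of_isSingle hc (h q hq).2.2.2.2]

theorem _root_.LoopHopf.TimesEmbed.isDisjointCut_iff (h : TimesEmbed α β) :
    β.IsDisjointCut H ↔ α.IsDisjointCut H ∧ ∀ p ∈ H, p ∈ β.crossings := by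
  constructor
  · intro hH
    refine ⟨⟨fun p hp => ?_, fun p hp q hq hpq => ?_⟩, hH.subset⟩
    · obtain ⟨c, -, h⟩ := h
      exact (h p (hH.subset p hp)).1
    · exact (h.apart_iff (hH.subset p hp) (hH.subset q hq)).1 (hH.disjoint p hp q hq hpq)
  · rintro ⟨hH, hsub⟩
    exact ⟨hsub, fun p hp q hq hpq =>
      (h.apart_iff (hsub p hp) (hsub q hq)).2 (hH.disjoint p hp q hq hpq)⟩

theorem _root_.LoopHopf.TimesEmbed.orderedProd_eq (h : TimesEmbed α β)
    (hH : ∀ p ∈ H, p ∈ β.crossings) (f : M → A) : β.orderedProd f H = α.orderedProd f H := by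
  have hα : ∀ p ∈ H, p ∈ α.crossings := fun p hp => by
    obtain ⟨c, -, h⟩ := h
    exact (h p (hH p hp)).1
  have := orderedProd_map (α := α) (β := β) (Function.Embedding.refl M) hα (H := H) hH
    (fun p hp q hq hpq => (h.time₁_lt_iff (hH p hp) (hH q hq)).2 hpq) f
  rwa [Finset.map_refl] at this

/-- The collapse preserves the order of surviving passages, so disjointness may be tested on α once
all crossings survive. -/
theorem isDisjointCut_rootLoop_iff (hK : α.IsDisjointCut K) :
    (α.rootLoop K).IsDisjointCut H ↔
      α.IsDisjointCut H ∧ ∀ p ∈ H, ∀ q ∈ K, α.Apart p q ∨ α.Inside q p := by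
  rw [(timesEmbed_rootLoop hK).isDisjointCut_iff]
  refine and_congr_right fun hH => forall₂_congr fun p hp => ?_
  rw [mem_crossings_rootLoop hK, and_iff_right (hH.subset p hp)]

theorem isDisjointCut_outerLoop_iff {p : M} (hp : p ∈ α.crossings) :
    (α.outerLoop p).IsDisjointCut H ↔ α.IsDisjointCut H ∧ ∀ q ∈ H, α.Inside q p := by
  rw [(timesEmbed_outerLoop hp).isDisjointCut_iff]
  refine and_congr_right fun hH => forall₂_congr fun q hq => ?_
  rw [mem_crossings_outerLoop hp, and_iff_right (hH.subset q hq)]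

theorem IsDisjointCut.mono (h : α.IsDisjointCut H) (hKH : K ⊆ H) : α.IsDisjointCut K :=
  ⟨fun p hp => h.subset p (hKH hp), fun p hp q hq => h.disjoint p (hKH hp) q (hKH hq)⟩

theorem tensorLeft_eq (R : Type*) [CommRing R] (hH : α.IsDisjointCut H) : α.tensorLeft R H =
    α.orderedProd (fun p => tensorGen R (α.outerLoop p).isotopyClass) H := by
  rw [orderedProd_congr hH.subset (g := fun p => tensorGen R (α.outerClass H p))
    fun p hp => by rw [hH.outerClass_eq hp], orderedProd, timeList, List.map_map]
  rfl

/-- In the symmetric algebra the order of factors is irrelevant. This lets the symmetric case follow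
from the tensor case. -/
theorem symLeft_eq (R : Type*) [CommRing R] (hH : α.IsDisjointCut H) : α.symLeft R H =
    SymmetricAlgebra.algHom R (LoopModule M R) (α.tensorLeft R H) := by
  rw [tensorLeft_eq R hH, map_orderedProd, orderedProd_eq_prod hH.subset, symLeft]
  refine Finset.prod_congr rfl fun p hp => ?_
  rw [hH.outerClass_eq hp]
  rfl

/-! ### Invariance of the comultiplication -/

theorem _root_.LoopHopf.CutEquiv.tensorDelta_eq [IsManifold (𝓡∂ 2) ∞ M] (R : Type*) [CommRing R]
    {o : SurfaceOrientation M} {e : M ≃ M} {φ : ℝ → ℝ} (h : CutEquiv o α β e φ)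
    (hclass : α.isotopyClass = β.isotopyClass) : α.tensorDelta R o = β.tensorDelta R o := by
  rw [tensorDelta, tensorDelta, hclass]
  congr 1
  refine Finset.sum_bij (fun H _ => H.map e.toEmbedding) (fun H hH => ?_)
    (fun H _ K _ hHK => Finset.map_injective _ hHK) (fun K hK => ?_) fun H hH => ?_
  · rw [mem_simpleCuts_iff] at hH ⊢
    exact h.isDisjointCut_map.2 hH
  · rw [mem_simpleCuts_iff] at hK
    have hmap : (K.map e.symm.toEmbedding).map e.toEmbedding = K := by
      ext x; simp
    refine ⟨K.map e.symm.toEmbedding, ?_, hmap⟩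
    rw [mem_simpleCuts_iff, ← h.isDisjointCut_map, hmap]
    exact hK
  · rw [mem_simpleCuts_iff] at hH
    have hH' := h.isDisjointCut_map.2 hH
    rw [tensorLeft_eq R hH, tensorLeft_eq R hH', hH.rootClass_eq, hH'.rootClass_eq,
      h.root H hH hH', orderedProd_map (α := α) e.toEmbedding hH.subset
        (fun p hp => (h.mem p).2 (hH.subset p hp)) ?_]
    · rw [orderedProd_congr hH.subset (g := fun p =>
        tensorGen R (β.outerLoop (e.toEmbedding p)).isotopyClass) fun p hp => by
          rw [← h.outer p (hH.subset p hp)]; rfl]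
      have hsign : β.cutSign o (H.map e.toEmbedding) = α.cutSign o H := by
        rw [cutSign, cutSign, Finset.prod_map]
        exact Finset.prod_congr rfl fun p hp => h.sign p (hH.subset p hp)
      rw [hsign]
    · intro p hp q hq hpq
      rwa [h.time₁ p (hH.subset p hp), h.time₁ q (hH.subset q hq), h.strictMono.lt_iff_lt] at hpq

theorem exists_cutEquiv [IsManifold (𝓡∂ 2) ∞ M] (o : SurfaceOrientation M)
    (h : Reparametrization α β ∨ AmbientIsotopic α β) : ∃ e φ, CutEquiv o α β e φ := by
  rcases h with h | h
  · obtain ⟨F, hF⟩ := exists_cutEquiv_of_reparametrization o h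
    exact ⟨_, F, hF⟩
  · obtain ⟨e, he⟩ := exists_cutEquiv_of_ambientIsotopic o h
    exact ⟨e, _, he⟩

/-! ### The number of crossings as a measure for recursion -/

variable (α) in
/-- The number of self-crossings. -/
def numCrossings : ℕ := α.crossings.ncard

theorem _root_.LoopHopf.CutEquiv.numCrossings_eq [IsManifold (𝓡∂ 2) ∞ M]
    {o : SurfaceOrientation M} {e : M ≃ M} {φ : ℝ → ℝ} (h : CutEquiv o α β e φ) :
    α.numCrossings = β.numCrossings := by
  rw [numCrossings, numCrossings, ← Set.ncard_image_of_injective α.crossings e.injective]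
  congr 1
  ext p
  constructor
  · rintro ⟨q, hq, rfl⟩
    exact (h.mem q).2 hq
  · intro hp
    refine ⟨e.symm p, (h.mem _).1 ?_, e.apply_symm_apply p⟩
    rwa [e.apply_symm_apply]

theorem numCrossings_rootLoop_lt (hH : α.IsDisjointCut H) (hne : H.Nonempty) :
    (α.rootLoop H).numCrossings < α.numCrossings := by
  obtain ⟨p, hp⟩ := hne
  refine Set.ncard_lt_ncard ⟨fun q hq => ((mem_crossings_rootLoop hH).1 hq).1, fun hsub => ?_⟩
    α.finite_crossings
  have hpα := hH.subset p hp
  have h1 := ((mem_crossings_rootLoop hH).1 (hsub hpα)).2 p hp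
  have h2 := (α.time_spec hpα).2.1
  rcases h1 with (h1 | h1) | h1
  · linarith
  · linarith
  · exact lt_irrefl _ h1.1

theorem numCrossings_outerLoop_lt {p : M} (hp : p ∈ α.crossings) :
    (α.outerLoop p).numCrossings < α.numCrossings := by
  refine Set.ncard_lt_ncard ⟨fun q hq => ((mem_crossings_outerLoop hp).1 hq).1, fun hsub => ?_⟩
    α.finite_crossings
  exact lt_irrefl _ ((mem_crossings_outerLoop hp).1 (hsub hp)).2.1

end PointedLoop

/-- The number of self-crossings of the loops in an isotopy class. -/
def LoopClass.numCrossings [IsManifold (𝓡∂ 2) ∞ M] (o : SurfaceOrientation M) : LoopClass M → ℕ :=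
  Quot.lift PointedLoop.numCrossings fun _ _ h =>
    let ⟨_, _, h'⟩ := PointedLoop.exists_cutEquiv o h
    h'.numCrossings_eq

/-- The value of the comultiplication of `T(𝓛)` on an isotopy class. -/
def LoopClass.tensorDelta [IsManifold (𝓡∂ 2) ∞ M] (R : Type*) [CommRing R]
    (o : SurfaceOrientation M) : LoopClass M → TensorLoops M R ⊗[R] TensorLoops M R :=
  Quot.lift (fun α => α.tensorDelta R o) fun _ _ h =>
    let ⟨_, _, h'⟩ := PointedLoop.exists_cutEquiv o h
    h'.tensorDelta_eq R (Quot.sound h)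

end OrderedProducts

section Expansion

variable {M : Type*} [TopologicalSpace M] [ChartedSpace (EuclideanHalfSpace 2) M]

namespace PointedLoop

variable {α : PointedLoop M} {H K L : Finset M}

/-! ### Pairs of nested cuts -/

variable (α) in
/-- `q` is `p` or its passages are between the passages through `p`. -/
def Below (q p : M) : Prop := q = p ∨ α.Inside q p

theorem Below.time_le {q p : M} (h : α.Below q p) :
    α.time₁ p ≤ α.time₁ q ∧ α.time₂ q ≤ α.time₂ p := by
  rcases h with rfl | h
  · exact ⟨le_rfl, le_rfl⟩
  · exact ⟨h.1.le, h.2.le⟩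

theorem Apart.of_below {p p' q q' : M} (h : α.Apart p' q') (hp : α.Below p p')
    (hq : α.Below q q') : α.Apart p q :=
  h.imp (fun h => (hp.time_le.2.trans_lt h).trans_le hq.time_le.1)
    fun h => (hq.time_le.2.trans_lt h).trans_le hp.time_le.1

theorem Apart.not_inside {p q : M} (hp : p ∈ α.crossings) (h : α.Apart p q) :
    ¬ α.Inside p q := fun hi =>
  h.elim (fun h' => by linarith [hi.1, hi.2, (α.time_spec hp).2.1])
    fun h' => by linarith [hi.1, hi.2, (α.time_spec hp).2.1]

theorem IsDisjointCut.eq_of_below (h : α.IsDisjointCut H) {p q : M} (hp : p ∈ H) (hq : q ∈ H)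
    (hqp : α.Below q p) : q = p := by
  rcases hqp with hqp | hqp
  · exact hqp
  by_contra hne
  exact Apart.not_inside (h.subset q hq) (h.disjoint q hq p hp hne) hqp

open Classical in
variable (α) in
/-- The simple cuts all of whose crossings are below crossings in `H`. -/
def cutsBelow (H : Finset M) : Finset (Finset M) :=
  α.simpleCuts.filter fun K => ∀ q ∈ K, ∃ p ∈ H, α.Below q p

theorem mem_cutsBelow : K ∈ α.cutsBelow H ↔
    α.IsDisjointCut K ∧ ∀ q ∈ K, ∃ p ∈ H, α.Below q p := by
  classical
  unfold cutsBelow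
  rw [Finset.mem_filter, mem_simpleCuts_iff]

section Insert

variable {a : M} {s : Finset M}

/-- The interval of a precedes those of s, and crossings below them stay within these intervals. -/
theorem time_lt_of_mem_cutsBelow (h : ∀ x ∈ s, α.Apart a x) (hmin : ∀ x ∈ s, α.time₁ a ≤ α.time₁ x)
    (hs : ∀ x ∈ s, x ∈ α.crossings) (hK : K ∈ α.cutsBelow {a}) (hL : L ∈ α.cutsBelow s) {q r : M}
    (hq : q ∈ K) (hr : r ∈ L) : α.time₂ q < α.time₁ r := by
  obtain ⟨p, hp, h1⟩ := (mem_cutsBelow.1 hL).2 r hr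
  obtain ⟨a', ha', h2⟩ := (mem_cutsBelow.1 hK).2 q hq
  rw [Finset.mem_singleton] at ha'
  subst ha'
  have h3 := (α.time_spec (hs p hp)).2.1
  have h4 := hmin p hp
  have h5 := h2.time_le
  have h6 := h1.time_le
  rcases h p hp with h7 | h7 <;> linarith

open Classical in
theorem union_mem_cutsBelow (h : ∀ x ∈ s, α.Apart a x)
    (hmin : ∀ x ∈ s, α.time₁ a ≤ α.time₁ x)
    (hs : ∀ x ∈ s, x ∈ α.crossings) (hK : K ∈ α.cutsBelow {a}) (hL : L ∈ α.cutsBelow s) :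
    K ∪ L ∈ α.cutsBelow (insert a s) := by
  have hlt := fun q hq r hr => time_lt_of_mem_cutsBelow h hmin hs hK hL (q := q) (r := r) hq hr
  obtain ⟨hK1, hK2⟩ := mem_cutsBelow.1 hK
  obtain ⟨hL1, hL2⟩ := mem_cutsBelow.1 hL
  refine mem_cutsBelow.2 ⟨⟨fun p hp => ?_, fun p hp q hq hpq => ?_⟩, fun q hq => ?_⟩
  · exact (Finset.mem_union.1 hp).elim (hK1.subset p) (hL1.subset p)
  · rcases Finset.mem_union.1 hp with hp | hp <;> rcases Finset.mem_union.1 hq with hq | hq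
    · exact hK1.disjoint p hp q hq hpq
    · exact Or.inl (hlt p hp q hq)
    · exact Or.inr (hlt q hq p hp)
    · exact hL1.disjoint p hp q hq hpq
  · rcases Finset.mem_union.1 hq with hq | hq
    · obtain ⟨p, hp, h1⟩ := hK2 q hq
      exact ⟨p, Finset.mem_insert.2 (Or.inl (Finset.mem_singleton.1 hp)), h1⟩
    · obtain ⟨p, hp, h1⟩ := hL2 q hq
      exact ⟨p, Finset.mem_insert_of_mem hp, h1⟩

-- A cut below the enlarged set splits uniquely into the crossings below a and the others. This
-- makes a product of two sums over cuts a single sum.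
open Classical in
theorem sum_cutsBelow_insert {A : Type*} [AddCommMonoid A] (h : ∀ x ∈ s, α.Apart a x)
    (hmin : ∀ x ∈ s, α.time₁ a ≤ α.time₁ x) (ha : a ∈ α.crossings)
    (hs : ∀ x ∈ s, x ∈ α.crossings) (f : Finset M → A) :
    ∑ K ∈ α.cutsBelow {a}, ∑ L ∈ α.cutsBelow s, f (K ∪ L) = ∑ N ∈ α.cutsBelow (insert a s), f N := by
  have hlt := fun K hK L hL q hq r hr =>
    time_lt_of_mem_cutsBelow h hmin hs (K := K) (L := L) hK hL (q := q) (r := r) hq hr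
  have hta := (α.time_spec ha).2.1
  have hfilter : ∀ K ∈ α.cutsBelow {a}, ∀ L ∈ α.cutsBelow s,
      (K ∪ L).filter (fun q => α.Below q a) = K := fun K hK L hL => by
    obtain ⟨hK1, hK2⟩ := mem_cutsBelow.1 hK
    obtain ⟨hL1, hL2⟩ := mem_cutsBelow.1 hL
    simp only [Finset.mem_singleton, exists_eq_left] at hK2
    rw [Finset.filter_union, Finset.filter_true_of_mem hK2, Finset.filter_false_of_mem (s := L),
      Finset.union_empty]
    intro q hq hqa
    obtain ⟨x, hx, h1⟩ := hL2 q hq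
    have := (α.time_spec (hs x hx)).2.1
    have := (α.time_spec (hL1.subset q hq)).2.1
    rcases h x hx with h2 | h2 <;> linarith [h1.time_le.1, hqa.time_le.2, hmin x hx]
  have hsdiff : ∀ K ∈ α.cutsBelow {a}, ∀ L ∈ α.cutsBelow s, (K ∪ L) \ K = L := fun K hK L hL => by
    rw [Finset.union_sdiff_left, Finset.sdiff_eq_self_iff_disjoint]
    refine Finset.disjoint_left.2 fun q hq hq' => ?_
    exact lt_asymm (hlt K hK L hL q hq' q hq)
      (α.time_spec ((mem_cutsBelow.1 hK).1.subset q hq')).2.1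
  rw [← Finset.sum_product']
  refine Finset.sum_bij (fun x _ => x.1 ∪ x.2) (fun x hx => ?_) (fun x hx y hy hxy => ?_)
    (fun N hN => ?_) fun x hx => rfl
  · rw [Finset.mem_product] at hx
    exact union_mem_cutsBelow h hmin hs hx.1 hx.2
  · rw [Finset.mem_product] at hx hy
    have h1 : x.1 = y.1 := by
      rw [← hfilter _ hx.1 _ hx.2, hxy, hfilter _ hy.1 _ hy.2]
    refine Prod.ext h1 ?_
    rw [← hsdiff _ hx.1 _ hx.2, hxy, h1, hsdiff _ hy.1 _ hy.2]
  · obtain ⟨hN1, hN2⟩ := mem_cutsBelow.1 hN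
    refine ⟨(N.filter fun q => α.Below q a, N.filter fun q => ¬ α.Below q a), ?_,
      Finset.filter_union_filter_not_eq _ N⟩
    rw [Finset.mem_product, mem_cutsBelow, mem_cutsBelow]
    refine ⟨⟨hN1.mono (Finset.filter_subset _ _), fun q hq => ⟨a, by simp, ?_⟩⟩,
      hN1.mono (Finset.filter_subset _ _), fun q hq => ?_⟩
    · exact (Finset.mem_filter.1 hq).2
    · obtain ⟨hq1, hq2⟩ := Finset.mem_filter.1 hq
      obtain ⟨p, hp, h1⟩ := hN2 q hq1
      rcases Finset.mem_insert.1 hp with rfl | hp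
      · exact absurd h1 hq2
      · exact ⟨p, hp, h1⟩

end Insert

/-! ### Expansion of the comultiplication on products of outer loops -/

section

variable [IsManifold (𝓡∂ 2) ∞ M] (o : SurfaceOrientation M) (R : Type*) [CommRing R]

theorem cutSign_outerLoop {p : M} (hp : p ∈ α.crossings) (hK : (α.outerLoop p).IsDisjointCut K) :
    (α.outerLoop p).cutSign o K = α.cutSign o K :=
  Finset.prod_congr rfl fun q hq => sign_outerLoop o hp (hK.subset q hq)

theorem cutSign_rootLoop (hH : α.IsDisjointCut H) (hK : (α.rootLoop H).IsDisjointCut K) :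
    (α.rootLoop H).cutSign o K = α.cutSign o K :=
  Finset.prod_congr rfl fun q hq => sign_rootLoop o hH (hK.subset q hq)

open Classical in
variable (α) in
/-- The contribution of the cut `K` to the comultiplication of the product of the outer loops of
the cut `H`. -/
def nestedTerm (H K : Finset M) : TensorLoops M R ⊗[R] TensorLoops M R :=
  -- An element of K ∩ H stands for the summand β ⊗ 1 in the comultiplication of its outer loop β,
  -- so it carries neither a sign nor a right factor.
  ((α.cutSign o (K \ H) : ℤ) : R) •
    (α.orderedProd (fun q => tensorGen R (α.outerLoop q).isotopyClass) K ⊗ₜ[R]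
      α.orderedProd (fun p => tensorGen R
        ((α.outerLoop p).rootLoop (K.filter fun q => α.Inside q p)).isotopyClass) (H \ K))

/-- The cuts below {a} are the simple cuts of the outer loop together with {a} itself, which encodes
the summand with right factor 1. -/
theorem tensorDelta_outerLoop {a : M} (ha : a ∈ α.crossings) :
    (α.outerLoop a).tensorDelta R o = ∑ K ∈ α.cutsBelow {a}, α.nestedTerm o R {a} K := by
  classical
  have hsing : α.IsDisjointCut {a} := ⟨by simpa using ha, by simp⟩
  have hset : α.cutsBelow {a} = insert {a} (α.outerLoop a).simpleCuts := by
    ext K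
    rw [mem_cutsBelow, Finset.mem_insert, mem_simpleCuts_iff, isDisjointCut_outerLoop_iff ha]
    simp only [Finset.mem_singleton, exists_eq_left]
    constructor
    · rintro ⟨h1, h2⟩
      by_cases haK : a ∈ K
      · left
        refine Finset.eq_singleton_iff_unique_mem.2 ⟨haK, fun q hq => ?_⟩
        exact h1.eq_of_below haK hq (h2 q hq)
      · right
        exact ⟨h1, fun q hq => (h2 q hq).resolve_left fun h => haK (h ▸ hq)⟩
    · rintro (rfl | ⟨h1, h2⟩)
      · exact ⟨hsing, by simp [Below]⟩
      · exact ⟨h1, fun q hq => Or.inr (h2 q hq)⟩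
  rw [hset, Finset.sum_insert]
  · rw [tensorDelta]
    congr 1
    · rw [nestedTerm, Finset.sdiff_self, orderedProd_empty, orderedProd_singleton ha, cutSign,
        Finset.prod_empty, Int.cast_one, one_smul]
    · refine Finset.sum_congr rfl fun K hK => ?_
      rw [mem_simpleCuts_iff] at hK
      obtain ⟨hKα, hin⟩ := (isDisjointCut_outerLoop_iff ha).1 hK
      have haK : a ∉ K := fun h => lt_irrefl _ (hin a h).1
      have h1 : K \ {a} = K := by rw [Finset.sdiff_singleton_eq_erase, Finset.erase_eq_of_notMem haK]
      have h2 : {a} \ K = {a} := by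
        rw [Finset.sdiff_eq_self_iff_disjoint, Finset.disjoint_singleton_left]; exact haK
      have h3 : K.filter (fun q => α.Inside q a) = K := Finset.filter_true_of_mem hin
      rw [nestedTerm, h1, h2, orderedProd_singleton ha, h3, hK.rootClass_eq,
        cutSign_outerLoop o ha hK, tensorLeft_eq R hK,
        (timesEmbed_outerLoop ha).orderedProd_eq hK.subset, orderedProd_congr hKα.subset]
      intro q hq
      rw [isotopyClass_outer_outer ha (hKα.subset q hq) (hin q hq)]
  · rw [mem_simpleCuts_iff, isDisjointCut_outerLoop_iff ha]
    rintro ⟨-, h⟩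
    exact lt_irrefl _ (h a (Finset.mem_singleton_self a)).1

-- All crossings of K precede those of L, so the ordered products concatenate. No crossing of one
-- block lies inside a crossing of the other.
open Classical in
theorem nestedTerm_mul {a : M} {s : Finset M} (h : ∀ x ∈ s, α.Apart a x) (hmin : ∀ x ∈ s, α.time₁ a ≤ α.time₁ x)
    (ha : a ∈ α.crossings) (hs : ∀ x ∈ s, x ∈ α.crossings) (hK : K ∈ α.cutsBelow {a})
    (hL : L ∈ α.cutsBelow s) :
    α.nestedTerm o R {a} K * α.nestedTerm o R s L = α.nestedTerm o R (insert a s) (K ∪ L) := by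
  have hlt := fun q hq r hr => time_lt_of_mem_cutsBelow h hmin hs hK hL (q := q) (r := r) hq hr
  obtain ⟨hK1, hK2⟩ := mem_cutsBelow.1 hK
  obtain ⟨hL1, hL2⟩ := mem_cutsBelow.1 hL
  simp only [Finset.mem_singleton, exists_eq_left] at hK2
  have hKL : Disjoint K L := Finset.disjoint_left.2 fun q hq hq' =>
    lt_asymm (hlt q hq q hq') (α.time_spec (hK1.subset q hq)).2.1
  have hta := (α.time_spec ha).2.1
  have hsa : ∀ x ∈ s, α.time₂ a < α.time₁ x := fun x hx => by
    have := hmin x hx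
    have := (α.time_spec (hs x hx)).2.1
    rcases h x hx with h1 | h1 <;> linarith
  have haL : a ∉ L := fun haL => by
    obtain ⟨p, hp, h1⟩ := hL2 a haL
    linarith [h1.time_le.1, hsa p hp]
  have hsK : ∀ x ∈ s, x ∉ K := fun x hx hxK => by
    linarith [(hK2 x hxK).time_le.2, hsa x hx, (α.time_spec (hs x hx)).2.1]
  have hsdiff : insert a s \ (K ∪ L) = ({a} \ K) ∪ (s \ L) := by
    ext x
    simp only [Finset.mem_sdiff, Finset.mem_insert, Finset.mem_union, Finset.mem_singleton]
    constructor
    · rintro ⟨rfl | hx, h1⟩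
      · exact Or.inl ⟨rfl, fun h2 => h1 (Or.inl h2)⟩
      · exact Or.inr ⟨hx, fun h2 => h1 (Or.inr h2)⟩
    · rintro (⟨rfl, h1⟩ | ⟨hx, h1⟩)
      · exact ⟨Or.inl rfl, fun h2 => h2.elim h1 haL⟩
      · exact ⟨Or.inr hx, fun h2 => h2.elim (hsK x hx) h1⟩
  have hsign : (K ∪ L) \ insert a s = (K \ {a}) ∪ (L \ s) := by
    ext x
    simp only [Finset.mem_sdiff, Finset.mem_insert, Finset.mem_union, Finset.mem_singleton]
    constructor
    · rintro ⟨hx | hx, h1⟩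
      · exact Or.inl ⟨hx, fun h2 => h1 (Or.inl h2)⟩
      · exact Or.inr ⟨hx, fun h2 => h1 (Or.inr h2)⟩
    · rintro (⟨hx, h1⟩ | ⟨hx, h1⟩)
      · exact ⟨Or.inl hx, fun h2 => h2.elim h1 fun h3 => hsK x h3 hx⟩
      · exact ⟨Or.inr hx, fun h2 => h2.elim (fun h3 => haL (h3 ▸ hx)) h1⟩
  have hcut : α.cutSign o ((K ∪ L) \ insert a s) =
      α.cutSign o (K \ {a}) * α.cutSign o (L \ s) := by
    rw [hsign, cutSign, Finset.prod_union]
    · rfl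
    · exact hKL.mono Finset.sdiff_subset Finset.sdiff_subset
  have hfilter_a : ∀ p ∈ ({a} : Finset M) \ K,
      (K ∪ L).filter (fun q => α.Inside q p) = K.filter fun q => α.Inside q p := fun p hp => by
    rw [Finset.filter_union, Finset.filter_false_of_mem (s := L), Finset.union_empty]
    intro q hq hqp
    rw [Finset.mem_sdiff, Finset.mem_singleton] at hp
    rw [hp.1] at hqp
    obtain ⟨x, hx, h1⟩ := hL2 q hq
    linarith [h1.time_le.1, hsa x hx, hqp.2, (α.time_spec (hL1.subset q hq)).2.1]
  have hfilter_s : ∀ p ∈ s \ L,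
      (K ∪ L).filter (fun q => α.Inside q p) = L.filter fun q => α.Inside q p := fun p hp => by
    rw [Finset.filter_union, Finset.filter_false_of_mem (s := K), Finset.empty_union]
    intro q hq hqp
    rw [Finset.mem_sdiff] at hp
    linarith [(hK2 q hq).time_le.2, hsa p hp.1, hqp.1, (α.time_spec (hK1.subset q hq)).2.1]
  have hca : ∀ p ∈ ({a} : Finset M) \ K, p ∈ α.crossings := fun p hp => by
    rw [Finset.mem_sdiff, Finset.mem_singleton] at hp
    rw [hp.1]; exact ha
  have hcs : ∀ p ∈ s \ L, p ∈ α.crossings := fun p hp => hs p (Finset.mem_sdiff.1 hp).1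
  rw [nestedTerm, nestedTerm, nestedTerm, hcut, hsdiff, smul_mul_smul_comm,
    Algebra.TensorProduct.tmul_mul_tmul, orderedProd_union hK1.subset hL1.subset,
    orderedProd_union hca hcs, Int.cast_mul]
  · congr 3
    · exact orderedProd_congr hca fun p hp => by rw [hfilter_a p hp]
    · exact orderedProd_congr hcs fun p hp => by rw [hfilter_s p hp]
  · intro p hp q hq
    rw [Finset.mem_sdiff, Finset.mem_singleton] at hp
    rw [hp.1]
    exact hta.trans (hsa q (Finset.mem_sdiff.1 hq).1)
  · intro p hp q hq
    exact (α.time_spec (hK1.subset p hp)).2.1.trans (hlt p hp q hq)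

/-- The product of the comultiplications of the outer loops of a simple cut. -/
theorem orderedProd_tensorDelta (hH : α.IsDisjointCut H) :
    α.orderedProd (fun p => (α.outerLoop p).tensorDelta R o) H =
      ∑ K ∈ α.cutsBelow H, α.nestedTerm o R H K := by
  classical
  -- Splitting off the crossing with the least first time puts its factor on the left, as the
  -- noncommutative product requires.
  induction H using Finset.induction_on_min_value α.time₁ with
  | empty =>
    have h1 : α.cutsBelow ∅ = {∅} := by
      ext K
      rw [mem_cutsBelow, Finset.mem_singleton]
      constructor
      · rintro ⟨-, h⟩
        refine Finset.eq_empty_of_forall_notMem fun q hq => ?_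
        obtain ⟨p, hp, -⟩ := h q hq
        simp at hp
      · rintro rfl
        exact ⟨isDisjointCut_empty, by simp⟩
    rw [h1, Finset.sum_singleton, nestedTerm, Finset.sdiff_self, orderedProd_empty,
      orderedProd_empty, orderedProd_empty, cutSign, Finset.prod_empty, Int.cast_one, one_smul,
      Algebra.TensorProduct.one_def]
  | insert a s has hmin ih =>
    have ha := hH.subset a (Finset.mem_insert_self a s)
    have hs := hH.mono (Finset.subset_insert a s)
    have hap : ∀ x ∈ s, α.Apart a x := fun x hx => hH.disjoint a (Finset.mem_insert_self a s) x
      (Finset.mem_insert_of_mem hx) fun h => has (h ▸ hx)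
    have hlt : ∀ p ∈ ({a} : Finset M), ∀ q ∈ s, α.time₁ p < α.time₁ q := fun p hp q hq => by
      rw [Finset.mem_singleton.1 hp]
      exact lt_of_le_of_ne (hmin q hq)
        (time_ne ha (hs.subset q hq) fun h => has (h ▸ hq)).1
    rw [← sum_cutsBelow_insert hap hmin ha hs.subset, Finset.insert_eq,
      orderedProd_union (by simpa using ha) hs.subset hlt, ih hs, orderedProd_singleton ha,
      tensorDelta_outerLoop o R ha, Finset.sum_mul_sum]
    refine Finset.sum_congr rfl fun K hK => Finset.sum_congr rfl fun L hL => ?_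
    rw [nestedTerm_mul o R hap hmin ha hs.subset hK hL, Finset.insert_eq]

end

end PointedLoop

end Expansion

section Coassociativity

variable {M : Type*} [TopologicalSpace M] [ChartedSpace (EuclideanHalfSpace 2) M]

namespace PointedLoop

variable {α : PointedLoop M} {H K L : Finset M}

/-! ### Iterated cuts -/

theorem not_apart_self_or_inside_self {p : M} (hp : p ∈ α.crossings) :
    ¬ (α.Apart p p ∨ α.Inside p p) := by
  have := (α.time_spec hp).2.1
  rintro ((h | h) | h)
  · linarith
  · linarith
  · exact lt_irrefl _ h.1

-- An element p of H not in K is apart from crossings below other elements of H and encloses the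
-- crossings below p itself. Both kinds of removal leave p a crossing.
open Classical in
theorem isDisjointCut_rootLoop_sdiff (hH : α.IsDisjointCut H) (hK : K ∈ α.cutsBelow H) :
    (α.rootLoop K).IsDisjointCut (H \ K) := by
  obtain ⟨hK1, hK2⟩ := mem_cutsBelow.1 hK
  refine (isDisjointCut_rootLoop_iff hK1).2 ⟨hH.mono Finset.sdiff_subset, fun p hp q hq => ?_⟩
  obtain ⟨hp, hpK⟩ := Finset.mem_sdiff.1 hp
  obtain ⟨p', hp', h1⟩ := hK2 q hq
  by_cases hpp : p = p'
  · subst hpp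
    exact Or.inr (h1.resolve_left fun h => hpK (h ▸ hq))
  · exact Or.inl (Apart.of_below (hH.disjoint p hp p' hp' hpp) (Or.inl rfl) h1)

open Classical in
theorem sdiff_union_filter (hH : α.IsDisjointCut H) (hK : K ∈ α.cutsBelow H) :
    (H \ K) ∪ K.filter (fun q => ∀ p ∈ H \ K, ¬ α.Inside q p) = H := by
  obtain ⟨hK1, hK2⟩ := mem_cutsBelow.1 hK
  ext q
  rw [Finset.mem_union, Finset.mem_sdiff, Finset.mem_filter]
  constructor
  · rintro (⟨hq, -⟩ | ⟨hq, h1⟩)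
    · exact hq
    · obtain ⟨p, hp, h2⟩ := hK2 q hq
      by_cases hpK : p ∈ K
      · rwa [hK1.eq_of_below hpK hq h2]
      · rcases h2 with rfl | h2
        · exact hp
        · exact absurd h2 (h1 p (Finset.mem_sdiff.2 ⟨hp, hpK⟩))
  · intro hq
    by_cases hqK : q ∈ K
    · refine Or.inr ⟨hqK, fun p hp hqp => ?_⟩
      obtain ⟨hp, hpK⟩ := Finset.mem_sdiff.1 hp
      exact hpK (hH.eq_of_below hp hq (Or.inr hqp) ▸ hqK)
    · exact Or.inl ⟨hq, hqK⟩

open Classical in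
theorem isDisjointCut_union_filter (hK : α.IsDisjointCut K)
    (hL : (α.rootLoop K).IsDisjointCut L) :
    α.IsDisjointCut (L ∪ K.filter fun q => ∀ p ∈ L, ¬ α.Inside q p) := by
  obtain ⟨hL1, hL2⟩ := (isDisjointCut_rootLoop_iff hK).1 hL
  refine ⟨fun p hp => ?_, fun p hp q hq hpq => ?_⟩
  · exact (Finset.mem_union.1 hp).elim (hL1.subset p) fun h =>
      hK.subset p (Finset.mem_filter.1 h).1
  · rcases Finset.mem_union.1 hp with hp | hp <;> rcases Finset.mem_union.1 hq with hq | hq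
    · exact hL1.disjoint p hp q hq hpq
    · obtain ⟨hq1, hq2⟩ := Finset.mem_filter.1 hq
      exact (hL2 p hp q hq1).resolve_right (hq2 p hp)
    · obtain ⟨hp1, hp2⟩ := Finset.mem_filter.1 hp
      exact ((hL2 q hq p hp1).resolve_right (hp2 q hq)).symm
    · exact hK.disjoint p (Finset.mem_filter.1 hp).1 q (Finset.mem_filter.1 hq).1 hpq

open Classical in
theorem mem_cutsBelow_union_filter (hK : α.IsDisjointCut K) :
    K ∈ α.cutsBelow (L ∪ K.filter fun q => ∀ p ∈ L, ¬ α.Inside q p) := by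
  refine mem_cutsBelow.2 ⟨hK, fun q hq => ?_⟩
  by_cases h : ∀ p ∈ L, ¬ α.Inside q p
  · exact ⟨q, Finset.mem_union_right _ (Finset.mem_filter.2 ⟨hq, h⟩), Or.inl rfl⟩
  · push Not at h
    obtain ⟨p, hp, h⟩ := h
    exact ⟨p, Finset.mem_union_left _ hp, Or.inr h⟩

open Classical in
theorem union_filter_sdiff (hK : α.IsDisjointCut K) (hL : (α.rootLoop K).IsDisjointCut L) :
    (L ∪ K.filter fun q => ∀ p ∈ L, ¬ α.Inside q p) \ K = L := by
  obtain ⟨hL1, hL2⟩ := (isDisjointCut_rootLoop_iff hK).1 hL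
  rw [Finset.union_sdiff_distrib, Finset.sdiff_eq_empty_iff_subset.2 (Finset.filter_subset _ _),
    Finset.union_empty, Finset.sdiff_eq_self_iff_disjoint]
  exact Finset.disjoint_left.2 fun p hp hpK =>
    not_apart_self_or_inside_self (hL1.subset p hp) (hL2 p hp p hpK)

open Classical in
/-- Nested pairs of cuts are the same as cuts followed by cuts of the root loop. -/
theorem sum_cutsBelow_eq {A : Type*} [AddCommMonoid A] (f : Finset M → Finset M → A)
    (g : Finset M → Finset M → A)
    (hfg : ∀ H K, α.IsDisjointCut H → K ∈ α.cutsBelow H → f H K = g K (H \ K)) :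
    ∑ H ∈ α.simpleCuts, ∑ K ∈ α.cutsBelow H, f H K =
      ∑ K ∈ α.simpleCuts, ∑ L ∈ (α.rootLoop K).simpleCuts, g K L := by
  rw [Finset.sum_sigma', Finset.sum_sigma']
  -- From (K, L) the outer cut is recovered by adding to L those crossings of K which lie inside no
  -- element of L.
  refine Finset.sum_bij' (fun x _ => ⟨x.2, x.1 \ x.2⟩)
    (fun y _ => ⟨y.2 ∪ y.1.filter fun q => ∀ p ∈ y.2, ¬ α.Inside q p, y.1⟩) ?_ ?_ ?_ ?_ ?_
  · rintro ⟨H, K⟩ hx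
    rw [Finset.mem_sigma, mem_simpleCuts_iff] at hx
    rw [Finset.mem_sigma, mem_simpleCuts_iff, mem_simpleCuts_iff]
    exact ⟨(mem_cutsBelow.1 hx.2).1, isDisjointCut_rootLoop_sdiff hx.1 hx.2⟩
  · rintro ⟨K, L⟩ hy
    rw [Finset.mem_sigma, mem_simpleCuts_iff, mem_simpleCuts_iff] at hy
    rw [Finset.mem_sigma, mem_simpleCuts_iff]
    exact ⟨isDisjointCut_union_filter hy.1 hy.2, mem_cutsBelow_union_filter hy.1⟩
  · rintro ⟨H, K⟩ hx
    rw [Finset.mem_sigma, mem_simpleCuts_iff] at hx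
    simp only [sdiff_union_filter hx.1 hx.2]
  · rintro ⟨K, L⟩ hy
    rw [Finset.mem_sigma, mem_simpleCuts_iff, mem_simpleCuts_iff] at hy
    simp only [union_filter_sdiff hy.1 hy.2]
  · rintro ⟨H, K⟩ hx
    rw [Finset.mem_sigma, mem_simpleCuts_iff] at hx
    exact hfg H K hx.1 hx.2

open Classical in
theorem isotopyClass_root_root_sdiff (hH : α.IsDisjointCut H) (hK : K ∈ α.cutsBelow H) :
    ((α.rootLoop K).rootLoop (H \ K)).isotopyClass = (α.rootLoop H).isotopyClass := by
  have h1 := isotopyClass_root_root (mem_cutsBelow.1 hK).1 (isDisjointCut_rootLoop_sdiff hH hK)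
    (by rwa [sdiff_union_filter hH hK])
  rwa [sdiff_union_filter hH hK] at h1

-- Each factor is an outer loop taken in the root loop of K, and equals the root loop taken in the
-- outer loop. This identifies the middle factors of the two iterated comultiplications.
open Classical in
theorem tensorLeft_rootLoop_sdiff (R : Type*) [CommRing R] (hH : α.IsDisjointCut H)
    (hK : K ∈ α.cutsBelow H) : (α.rootLoop K).tensorLeft R (H \ K) =
      α.orderedProd (fun p => tensorGen R
        ((α.outerLoop p).rootLoop (K.filter fun q => α.Inside q p)).isotopyClass) (H \ K) := by
  have hK1 := (mem_cutsBelow.1 hK).1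
  have hHK := isDisjointCut_rootLoop_sdiff hH hK
  rw [tensorLeft_eq R hHK, (timesEmbed_rootLoop hK1).orderedProd_eq hHK.subset]
  have hsub : ∀ p ∈ H \ K, p ∈ α.crossings := fun p hp =>
    hH.subset p (Finset.mem_sdiff.1 hp).1
  refine orderedProd_congr hsub fun p hp => ?_
  rw [isotopyClass_outer_root hK1 (hHK.subset p hp) ((isDisjointCut_outerLoop_iff
    (hsub p hp)).2 ⟨hK1.mono (Finset.filter_subset _ _), fun q hq => (Finset.mem_filter.1 hq).2⟩)]

-- Both sides are the product of the signs over H ∪ K.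
open Classical in
theorem cutSign_mul_sdiff [IsManifold (𝓡∂ 2) ∞ M] (o : SurfaceOrientation M) :
    α.cutSign o H * α.cutSign o (K \ H) = α.cutSign o K * α.cutSign o (H \ K) := by
  have h : ∀ A B : Finset M, α.cutSign o A * α.cutSign o (B \ A) = α.cutSign o (A ∪ B) := by
    intro A B
    rw [cutSign, cutSign, ← Finset.prod_union Finset.disjoint_sdiff,
      Finset.union_sdiff_self_eq_union]
    rfl
  rw [h, h, Finset.union_comm]

end PointedLoop

end Coassociativity

/-! ### Hopf algebra axioms -/

section HopfAxioms

open TensorProduct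

variable {R : Type*} [CommRing R] {A B : Type*} [Ring A] [Algebra R A] [Ring B] [Algebra R B]

theorem isCoassociative_iff {Δ : A →ₐ[R] A ⊗[R] A} : IsCoassociative Δ ↔
    (Algebra.TensorProduct.assoc R R R A A A).toAlgHom.comp
      ((Algebra.TensorProduct.map Δ (AlgHom.id R A)).comp Δ) =
        (Algebra.TensorProduct.map (AlgHom.id R A) Δ).comp Δ := by
  rw [IsCoassociative, ← AlgHom.toLinearMap_injective.eq_iff]
  rfl

theorem isCounit_iff {Δ : A →ₐ[R] A ⊗[R] A} {ε : A →ₐ[R] R} : IsCounit Δ ε ↔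
    (Algebra.TensorProduct.map ε (AlgHom.id R A)).comp Δ = Algebra.TensorProduct.includeRight ∧
      (Algebra.TensorProduct.map (AlgHom.id R A) ε).comp Δ =
        (Algebra.TensorProduct.includeLeft : A →ₐ[R] A ⊗[R] R) := by
  rw [IsCounit, ← AlgHom.toLinearMap_injective.eq_iff, ← AlgHom.toLinearMap_injective.eq_iff]
  rfl

/-- A left and a right inverse of the identity for the convolution product coincide. -/
theorem isAntipode_of_left_right {Δ : A →ₐ[R] A ⊗[R] A} {ε : A →ₐ[R] R}
    (hΔ : IsCoassociative Δ) (hε : IsCounit Δ ε) {s t : A →ₗ[R] A}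
    (ht : LinearMap.mul' R A ∘ₗ t.rTensor A ∘ₗ Δ.toLinearMap =
      Algebra.linearMap R A ∘ₗ ε.toLinearMap)
    (hs : LinearMap.mul' R A ∘ₗ s.lTensor A ∘ₗ Δ.toLinearMap =
      Algebra.linearMap R A ∘ₗ ε.toLinearMap) : IsAntipode Δ ε s := by
  -- The coalgebra structure makes linear endomorphisms a monoid under convolution, where a left and
  -- a right inverse agree.
  let _ : Coalgebra R A :=
    { comul := Δ.toLinearMap
      counit := ε.toLinearMap
      coassoc := hΔ
      rTensor_counit_comp_comul := hε.1
      lTensor_counit_comp_comul := hε.2 }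
  have h1 : WithConv.toConv t * WithConv.toConv (LinearMap.id : A →ₗ[R] A) = 1 :=
    congrArg WithConv.toConv ht
  have h2 : WithConv.toConv (LinearMap.id : A →ₗ[R] A) * WithConv.toConv s = 1 :=
    congrArg WithConv.toConv hs
  have h3 : t = s := WithConv.toConv_injective (left_inv_eq_right_inv h1 h2)
  exact ⟨h3 ▸ ht, hs⟩

theorem mul'_lTensor_tmul_mul {s : A →ₗ[R] A} (hs : ∀ a b, s (a * b) = s b * s a) (x y : A)
    (Y : A ⊗[R] A) : LinearMap.mul' R A (s.lTensor A ((x ⊗ₜ y) * Y)) =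
      x * LinearMap.mul' R A (s.lTensor A Y) * s y := by
  induction Y using TensorProduct.induction_on with
  | zero => simp
  | tmul a b => simp [hs, mul_assoc]
  | add Y Z hY hZ => simp only [mul_add, map_add, hY, hZ, add_mul]

theorem mul'_rTensor_mul_tmul {s : A →ₗ[R] A} (hs : ∀ a b, s (a * b) = s b * s a) (x y : A)
    (X : A ⊗[R] A) : LinearMap.mul' R A (s.rTensor A (X * (x ⊗ₜ y))) =
      s x * LinearMap.mul' R A (s.rTensor A X) * y := by
  induction X using TensorProduct.induction_on with
  | zero => simp
  | tmul a b => simp [hs, mul_assoc]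
  | add Y Z hY hZ => simp only [mul_add, map_add, hY, hZ, add_mul]

/-- As `s` reverses products, the contribution of Y is enclosed between that of X. If it is a
scalar, it can be pulled out, so the antipode identity passes to products from generators. -/
theorem mul'_lTensor_mul {s : A →ₗ[R] A} (hs : ∀ a b, s (a * b) = s b * s a) {Y : A ⊗[R] A} {c : R}
    (hY : LinearMap.mul' R A (s.lTensor A Y) = algebraMap R A c) (X : A ⊗[R] A) :
    LinearMap.mul' R A (s.lTensor A (X * Y)) =
      LinearMap.mul' R A (s.lTensor A X) * algebraMap R A c := by
  induction X using TensorProduct.induction_on with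
  | zero => simp
  | tmul a b =>
    rw [mul'_lTensor_tmul_mul hs, hY, mul_assoc, Algebra.commutes c (s b), ← mul_assoc]
    simp
  | add Y Z hY hZ => simp only [map_add, hY, hZ, add_mul]

theorem mul'_rTensor_mul {s : A →ₗ[R] A} (hs : ∀ a b, s (a * b) = s b * s a) {X : A ⊗[R] A} {c : R}
    (hX : LinearMap.mul' R A (s.rTensor A X) = algebraMap R A c) (Y : A ⊗[R] A) :
    LinearMap.mul' R A (s.rTensor A (X * Y)) =
      algebraMap R A c * LinearMap.mul' R A (s.rTensor A Y) := by
  induction Y using TensorProduct.induction_on with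
  | zero => simp
  | tmul a b =>
    rw [mul'_rTensor_mul_tmul hs, hX, ← Algebra.commutes c (s a), mul_assoc]
    simp
  | add Y Z hY hZ => simp only [map_add, hY, hZ, mul_add]

/-! ### Hopf algebra axioms on a quotient -/

section Quotient

variable {π : A →ₐ[R] B} {Δ : A →ₐ[R] A ⊗[R] A} {Δ' : B →ₐ[R] B ⊗[R] B}

theorem IsCoassociative.of_surjective (hπ : Function.Surjective π)
    (h : ∀ a, Δ' (π a) = Algebra.TensorProduct.map π π (Δ a))
    (hΔ : IsCoassociative Δ) : IsCoassociative Δ' := by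
  refine LinearMap.ext fun b => ?_
  obtain ⟨a, rfl⟩ := hπ b
  have h1 : ∀ X : A ⊗[R] A, TensorProduct.assoc R B B B (Δ'.toLinearMap.rTensor B
      (Algebra.TensorProduct.map π π X)) = Algebra.TensorProduct.map π
        (Algebra.TensorProduct.map π π) (TensorProduct.assoc R A A A (Δ.toLinearMap.rTensor A X)) := by
    intro X
    induction X using TensorProduct.induction_on with
    | zero => simp
    | add X Y hX hY => simp only [map_add, hX, hY]
    | tmul x y =>
      simp only [Algebra.TensorProduct.map_tmul, LinearMap.rTensor_tmul, AlgHom.toLinearMap_apply, h]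
      induction Δ x using TensorProduct.induction_on with
      | zero => simp
      | add X Y hX hY => simp only [map_add, TensorProduct.add_tmul, hX, hY]
      | tmul u v => simp
  have h2 : ∀ X : A ⊗[R] A, Δ'.toLinearMap.lTensor B (Algebra.TensorProduct.map π π X) =
      Algebra.TensorProduct.map π (Algebra.TensorProduct.map π π)
        (Δ.toLinearMap.lTensor A X) := by
    intro X
    induction X using TensorProduct.induction_on with
    | zero => simp
    | add X Y hX hY => simp only [map_add, hX, hY]
    | tmul x y => simp [h]
  have h3 := LinearMap.congr_fun hΔ a
  simp only [LinearMap.comp_apply, AlgHom.toLinearMap_apply, LinearEquiv.coe_coe] at h3 ⊢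
  rw [h, h1, h2, h3]

theorem IsCounit.of_surjective (hπ : Function.Surjective π)
    (h : ∀ a, Δ' (π a) = Algebra.TensorProduct.map π π (Δ a))
    {ε : A →ₐ[R] R} {ε' : B →ₐ[R] R} (hε : ∀ a, ε' (π a) = ε a)
    (hΔ : IsCounit Δ ε) : IsCounit Δ' ε' := by
  constructor <;> refine LinearMap.ext fun b => ?_
  · obtain ⟨a, rfl⟩ := hπ b
    have h1 : ∀ X : A ⊗[R] A, ε'.toLinearMap.rTensor B (Algebra.TensorProduct.map π π X) =
        π.toLinearMap.lTensor R (ε.toLinearMap.rTensor A X) := by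
      intro X
      induction X using TensorProduct.induction_on with
      | zero => simp
      | add X Y hX hY => simp only [map_add, hX, hY]
      | tmul x y => simp [hε]
    have h3 := LinearMap.congr_fun hΔ.1 a
    simp only [LinearMap.comp_apply, AlgHom.toLinearMap_apply] at h3 ⊢
    rw [h, h1, h3]
    simp
  · obtain ⟨a, rfl⟩ := hπ b
    have h1 : ∀ X : A ⊗[R] A, ε'.toLinearMap.lTensor B (Algebra.TensorProduct.map π π X) =
        π.toLinearMap.rTensor R (ε.toLinearMap.lTensor A X) := by
      intro X
      induction X using TensorProduct.induction_on with
      | zero => simp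
      | add X Y hX hY => simp only [map_add, hX, hY]
      | tmul x y => simp [hε]
    have h3 := LinearMap.congr_fun hΔ.2 a
    simp only [LinearMap.comp_apply, AlgHom.toLinearMap_apply] at h3 ⊢
    rw [h, h1, h3]
    simp

theorem IsAntipode.of_surjective (hπ : Function.Surjective π)
    (h : ∀ a, Δ' (π a) = Algebra.TensorProduct.map π π (Δ a))
    {ε : A →ₐ[R] R} {ε' : B →ₐ[R] R} (hε : ∀ a, ε' (π a) = ε a)
    {s : A →ₗ[R] A} {s' : B →ₗ[R] B} (hs : ∀ a, s' (π a) = π (s a)) (hΔ : IsAntipode Δ ε s) :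
    IsAntipode Δ' ε' s' := by
  constructor <;> refine LinearMap.ext fun b => ?_
  · obtain ⟨a, rfl⟩ := hπ b
    have h1 : ∀ X : A ⊗[R] A, LinearMap.mul' R B (s'.rTensor B (Algebra.TensorProduct.map π π X)) =
        π (LinearMap.mul' R A (s.rTensor A X)) := by
      intro X
      induction X using TensorProduct.induction_on with
      | zero => simp
      | add X Y hX hY => simp only [map_add, hX, hY]
      | tmul x y => simp [hs]
    have h3 := LinearMap.congr_fun hΔ.1 a
    simp only [LinearMap.comp_apply, AlgHom.toLinearMap_apply] at h3 ⊢
    rw [h, h1, h3, hε]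
    simp
  · obtain ⟨a, rfl⟩ := hπ b
    have h1 : ∀ X : A ⊗[R] A, LinearMap.mul' R B (s'.lTensor B (Algebra.TensorProduct.map π π X)) =
        π (LinearMap.mul' R A (s.lTensor A X)) := by
      intro X
      induction X using TensorProduct.induction_on with
      | zero => simp
      | add X Y hX hY => simp only [map_add, hX, hY]
      | tmul x y => simp [hs]
    have h3 := LinearMap.congr_fun hΔ.2 a
    simp only [LinearMap.comp_apply, AlgHom.toLinearMap_apply] at h3 ⊢
    rw [h, h1, h3, hε]
    simp

end Quotient

/-- Definition of a function by recursion on a measure. -/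
theorem exists_eq_of_measure {X T : Type*} [Zero T] (n : X → ℕ) (Φ : X → (X → T) → T)
    (hΦ : ∀ x f f', (∀ y, n y < n x → f y = f' y) → Φ x f = Φ x f') :
    ∃ f : X → T, ∀ x, f x = Φ x f := by
  classical
  have hwf : WellFounded fun y x : X => n y < n x := (measure n).wf
  refine ⟨hwf.fix fun x f => Φ x fun y => if h : n y < n x then f y h else 0, fun x => ?_⟩
  rw [hwf.fix_eq]
  exact hΦ _ _ _ fun y hy => dif_pos hy

end HopfAxioms

section HopfAlgebra

variable {M : Type*} [TopologicalSpace M] [ChartedSpace (EuclideanHalfSpace 2) M]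

/-! ### Maps on the algebras of loops -/

section Lift

variable {R : Type*} [CommRing R]

theorem loopModule_linearMap_ext {B : Type*} [AddCommMonoid B] [Module R B]
    {f g : LoopModule M R →ₗ[R] B}
    (h : ∀ x : LoopClass M, f (Finsupp.single x 1) = g (Finsupp.single x 1)) : f = g :=
  Finsupp.lhom_ext' fun x => LinearMap.ext_ring (h x)

theorem tensorLoops_algHom_ext {B : Type*} [Semiring B] [Algebra R B]
    {f g : TensorLoops M R →ₐ[R] B} (h : ∀ x, f (tensorGen R x) = g (tensorGen R x)) : f = g :=
  TensorAlgebra.hom_ext (loopModule_linearMap_ext h)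

theorem symLoops_algHom_ext {B : Type*} [CommSemiring B] [Algebra R B]
    {f g : SymLoops M R →ₐ[R] B} (h : ∀ x, f (symGen R x) = g (symGen R x)) : f = g :=
  SymmetricAlgebra.algHom_ext (loopModule_linearMap_ext h)

/-- The algebra homomorphism on `T(𝓛)` with given values on isotopy classes. -/
def tensorLift {B : Type*} [Semiring B] [Algebra R B] (v : LoopClass M → B) :
    TensorLoops M R →ₐ[R] B := TensorAlgebra.lift R (Finsupp.linearCombination R v)

/-- The algebra homomorphism on `S(𝓛)` with given values on isotopy classes. -/
def symLift {B : Type*} [CommSemiring B] [Algebra R B] (v : LoopClass M → B) :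
    SymLoops M R →ₐ[R] B := SymmetricAlgebra.lift (Finsupp.linearCombination R v)

theorem tensorLift_gen {B : Type*} [Semiring B] [Algebra R B] (v : LoopClass M → B)
    (x : LoopClass M) : tensorLift v (tensorGen R x) = v x := by
  rw [tensorLift, tensorGen, TensorAlgebra.lift_ι_apply, Finsupp.linearCombination_single, one_smul]

theorem symLift_gen {B : Type*} [CommSemiring B] [Algebra R B] (v : LoopClass M → B)
    (x : LoopClass M) : symLift v (symGen R x) = v x := by
  rw [symLift, symGen, SymmetricAlgebra.lift_ι_apply, Finsupp.linearCombination_single, one_smul]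

theorem algebraMapInv_tensorGen (x : LoopClass M) :
    TensorAlgebra.algebraMapInv (tensorGen R x) = 0 := by
  simp [TensorAlgebra.algebraMapInv, tensorGen]

theorem algebraMapInv_symGen (x : LoopClass M) :
    SymmetricAlgebra.algebraMapInv (symGen R x) = 0 := SymmetricAlgebra.algebraMapInv_ι _

theorem algHom_tensorGen (x : LoopClass M) :
    SymmetricAlgebra.algHom R (LoopModule M R) (tensorGen R x) = symGen R x := rfl

theorem algebraMapInv_algHom (a : TensorLoops M R) :
    SymmetricAlgebra.algebraMapInv (SymmetricAlgebra.algHom R (LoopModule M R) a) =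
      TensorAlgebra.algebraMapInv a := by
  have : SymmetricAlgebra.algebraMapInv.comp (SymmetricAlgebra.algHom R (LoopModule M R)) =
      TensorAlgebra.algebraMapInv := tensorLoops_algHom_ext fun x => by
    rw [AlgHom.comp_apply, algHom_tensorGen, algebraMapInv_symGen, algebraMapInv_tensorGen]
  exact AlgHom.congr_fun this a

end Lift

theorem LoopClass.exists_rep (x : LoopClass M) : ∃ α : PointedLoop M, α.isotopyClass = x :=
  Quot.exists_rep x

section

variable (R : Type*) [CommRing R]

namespace PointedLoop

theorem empty_mem_simpleCuts (α : PointedLoop M) : ∅ ∈ α.simpleCuts :=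
  mem_simpleCuts_iff.2 isDisjointCut_empty

theorem tensorLeft_empty (α : PointedLoop M) : α.tensorLeft R ∅ = 1 := by
  rw [tensorLeft_eq R isDisjointCut_empty, orderedProd_empty]

theorem algebraMapInv_tensorLeft (α : PointedLoop M) {H : Finset M} (hH : α.IsDisjointCut H)
    (hne : H ≠ ∅) : TensorAlgebra.algebraMapInv (α.tensorLeft R H) = 0 := by
  rw [tensorLeft_eq R hH, map_orderedProd]
  obtain ⟨p, hp⟩ := Finset.nonempty_iff_ne_empty.2 hne
  rw [orderedProd_eq_prod hH.subset]
  exact Finset.prod_eq_zero hp (algebraMapInv_tensorGen _)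

end PointedLoop

end

variable [IsManifold (𝓡∂ 2) ∞ M] (o : SurfaceOrientation M) (R : Type*) [CommRing R]

/-! ### The bialgebra structure of the tensor algebra -/

/-- The comultiplication of `T(𝓛)`. -/
def tensorComul : TensorLoops M R →ₐ[R] TensorLoops M R ⊗[R] TensorLoops M R :=
  tensorLift (LoopClass.tensorDelta R o)

theorem tensorComul_gen (α : PointedLoop M) :
    tensorComul o R (tensorGen R α.isotopyClass) = α.tensorDelta R o :=
  tensorLift_gen (LoopClass.tensorDelta R o) _

namespace PointedLoop

theorem tensorDelta_eq (α : PointedLoop M) : α.tensorDelta R o =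
    tensorGen R α.isotopyClass ⊗ₜ[R] 1 + ∑ H ∈ α.simpleCuts, ((α.cutSign o H : ℤ) : R) •
      (α.tensorLeft R H ⊗ₜ[R] tensorGen R (α.rootLoop H).isotopyClass) := by
  rw [tensorDelta]
  congr 1
  refine Finset.sum_congr rfl fun H hH => ?_
  rw [(mem_simpleCuts_iff.1 hH).rootClass_eq]

theorem cutSign_empty (α : PointedLoop M) : α.cutSign o ∅ = 1 := Finset.prod_empty

theorem tensorComul_tensorLeft (α : PointedLoop M) {H : Finset M} (hH : α.IsDisjointCut H) :
    tensorComul o R (α.tensorLeft R H) = ∑ K ∈ α.cutsBelow H, α.nestedTerm o R H K := by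
  rw [tensorLeft_eq R hH, map_orderedProd, ← orderedProd_tensorDelta o R hH]
  exact orderedProd_congr hH.subset fun p _ => tensorComul_gen o R _

end PointedLoop

-- On a generator both iterated comultiplications contain the terms of Δ(α) ⊗ 1. The remaining sums
-- run over nested pairs of cuts and over successive cuts, which correspond bijectively.
open PointedLoop in
theorem isCoassociative_tensorComul : IsCoassociative (tensorComul (M := M) o R) := by
  classical
  rw [isCoassociative_iff]
  refine tensorLoops_algHom_ext fun x => ?_
  obtain ⟨α, rfl⟩ := x.exists_rep
  simp only [AlgHom.comp_apply, tensorComul_gen]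
  have hL : ∀ H ∈ α.simpleCuts, Algebra.TensorProduct.assoc R R R (TensorLoops M R)
      (TensorLoops M R) (TensorLoops M R)
        (((α.cutSign o H : ℤ) : R) • (tensorComul o R (α.tensorLeft R H) ⊗ₜ[R]
          tensorGen R (α.rootLoop H).isotopyClass)) =
      ∑ K ∈ α.cutsBelow H, ((α.cutSign o H * α.cutSign o (K \ H) : ℤ) : R) •
        (α.tensorLeft R K ⊗ₜ[R] ((α.rootLoop K).tensorLeft R (H \ K) ⊗ₜ[R]
          tensorGen R (α.rootLoop H).isotopyClass)) := by
    intro H hH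
    have hH' := mem_simpleCuts_iff.1 hH
    rw [tensorComul_tensorLeft o R α hH', TensorProduct.sum_tmul, Finset.smul_sum, map_sum]
    refine Finset.sum_congr rfl fun K hK => ?_
    rw [nestedTerm, ← tensorLeft_rootLoop_sdiff R hH' hK,
      ← tensorLeft_eq R (mem_cutsBelow.1 hK).1, ← TensorProduct.smul_tmul', smul_smul, map_smul,
      Algebra.TensorProduct.assoc_tmul, Int.cast_mul]
  have hR : ∀ K ∈ α.simpleCuts, ((α.cutSign o K : ℤ) : R) • (α.tensorLeft R K ⊗ₜ[R]
      (α.rootLoop K).tensorDelta R o) =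
      ((α.cutSign o K : ℤ) : R) • (α.tensorLeft R K ⊗ₜ[R]
        (tensorGen R (α.rootLoop K).isotopyClass ⊗ₜ[R] 1)) +
      ∑ L ∈ (α.rootLoop K).simpleCuts, ((α.cutSign o K * α.cutSign o L : ℤ) : R) •
        (α.tensorLeft R K ⊗ₜ[R] ((α.rootLoop K).tensorLeft R L ⊗ₜ[R]
          tensorGen R ((α.rootLoop K).rootLoop L).isotopyClass)) := by
    intro K hK
    rw [tensorDelta_eq, TensorProduct.tmul_add, smul_add, TensorProduct.tmul_sum, Finset.smul_sum]
    congr 1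
    refine Finset.sum_congr rfl fun L hL => ?_
    rw [TensorProduct.tmul_smul, smul_smul, cutSign_rootLoop o (mem_simpleCuts_iff.1 hK)
      (mem_simpleCuts_iff.1 hL), Int.cast_mul]
  have hsum := sum_cutsBelow_eq (α := α)
    (fun H K => ((α.cutSign o H * α.cutSign o (K \ H) : ℤ) : R) •
        (α.tensorLeft R K ⊗ₜ[R] ((α.rootLoop K).tensorLeft R (H \ K) ⊗ₜ[R]
          tensorGen R (α.rootLoop H).isotopyClass)))
    (fun K L => ((α.cutSign o K * α.cutSign o L : ℤ) : R) •
        (α.tensorLeft R K ⊗ₜ[R] ((α.rootLoop K).tensorLeft R L ⊗ₜ[R]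
          tensorGen R ((α.rootLoop K).rootLoop L).isotopyClass)))
    fun H K hH hK => by
      rw [cutSign_mul_sdiff, isotopyClass_root_root_sdiff hH hK]
  rw [tensorDelta_eq]
  simp only [map_add, map_sum, map_smul, Algebra.TensorProduct.map_tmul, map_one, tensorComul_gen,
    AlgHom.id_apply]
  rw [Finset.sum_congr rfl hR, Finset.sum_add_distrib, ← hsum, ← add_assoc]
  congr 1
  · rw [tensorDelta_eq, TensorProduct.add_tmul, map_add, TensorProduct.sum_tmul, map_sum]
    congr 1
  · refine Finset.sum_congr rfl fun H hH => ?_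
    rw [← hL H hH, map_smul]
    rfl

-- The augmentation kills every generator. On the left this leaves the empty cut, and on the right
-- it leaves α ⊗ 1.
open PointedLoop in
theorem isCounit_tensorComul :
    IsCounit (tensorComul (M := M) o R) TensorAlgebra.algebraMapInv := by
  rw [isCounit_iff]
  constructor <;> refine tensorLoops_algHom_ext fun x => ?_ <;>
    obtain ⟨α, rfl⟩ := x.exists_rep <;>
    simp only [AlgHom.comp_apply, tensorComul_gen, tensorDelta_eq, map_add, map_sum, map_smul,
      Algebra.TensorProduct.map_tmul, map_one, AlgHom.id_apply, algebraMapInv_tensorGen,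
      TensorProduct.zero_tmul, TensorProduct.tmul_zero, smul_zero, Finset.sum_const_zero, add_zero,
      zero_add, Algebra.TensorProduct.includeRight_apply, Algebra.TensorProduct.includeLeft_apply]
  rw [Finset.sum_eq_single_of_mem ∅ α.empty_mem_simpleCuts]
  · rw [cutSign_empty, Int.cast_one, one_smul, tensorLeft_empty, map_one,
      isotopyClass_rootLoop_empty]
  · intro H hH hne
    rw [algebraMapInv_tensorLeft R α (mem_simpleCuts_iff.1 hH) hne, TensorProduct.zero_tmul,
      smul_zero]

end HopfAlgebra

section Antipode

variable {M : Type*} [TopologicalSpace M] [ChartedSpace (EuclideanHalfSpace 2) M]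

/-! ### The antipode of the tensor algebra -/

section

variable {R : Type*} [CommRing R]

/-- The algebra antihomomorphism of `T(𝓛)` with given values on isotopy classes. -/
def antiLift (f : LoopClass M → TensorLoops M R) : TensorLoops M R →ₗ[R] TensorLoops M R :=
  (MulOpposite.opLinearEquiv R).symm.toLinearMap ∘ₗ
    (tensorLift fun x => MulOpposite.op (f x)).toLinearMap

theorem antiLift_apply (f : LoopClass M → TensorLoops M R) (a : TensorLoops M R) :
    antiLift f a = MulOpposite.unop (tensorLift (fun x => MulOpposite.op (f x)) a) := rfl

theorem antiLift_gen (f : LoopClass M → TensorLoops M R) (x : LoopClass M) :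
    antiLift f (tensorGen R x) = f x := by
  rw [antiLift_apply, tensorLift_gen, MulOpposite.unop_op]

theorem antiLift_mul (f : LoopClass M → TensorLoops M R) (a b : TensorLoops M R) :
    antiLift f (a * b) = antiLift f b * antiLift f a := by
  rw [antiLift_apply, map_mul, MulOpposite.unop_mul, antiLift_apply, antiLift_apply]

theorem antiLift_algebraMap (f : LoopClass M → TensorLoops M R) (r : R) :
    antiLift f (algebraMap R _ r) = algebraMap R _ r := by
  rw [antiLift_apply, AlgHom.commutes, MulOpposite.algebraMap_apply, MulOpposite.unop_op]

theorem antiLift_one (f : LoopClass M → TensorLoops M R) : antiLift f 1 = 1 := by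
  rw [antiLift_apply, map_one, MulOpposite.unop_one]

theorem antiLift_tensorLeft (f : LoopClass M → TensorLoops M R) (α : PointedLoop M) {H : Finset M}
    (hH : α.IsDisjointCut H) : antiLift f (α.tensorLeft R H) =
      MulOpposite.unop (α.orderedProd (fun p => MulOpposite.op (f (α.outerLoop p).isotopyClass))
        H) := by
  rw [antiLift_apply, PointedLoop.tensorLeft_eq R hH, PointedLoop.map_orderedProd,
    PointedLoop.orderedProd_congr hH.subset fun p _ => tensorLift_gen _ _]

theorem symLeft_empty (α : PointedLoop M) : α.symLeft R ∅ = 1 := Finset.prod_empty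

/-- For an antihomomorphism the identity is multiplicative as soon as its values are scalars.
Vanishing on generators therefore suffices. -/
theorem mul'_lTensor_antiLift {Δ : TensorLoops M R →ₐ[R] TensorLoops M R ⊗[R] TensorLoops M R}
    {f : LoopClass M → TensorLoops M R}
    (h : ∀ x, LinearMap.mul' R _ ((antiLift f).lTensor _ (Δ (tensorGen R x))) = 0) :
    LinearMap.mul' R _ ∘ₗ (antiLift f).lTensor _ ∘ₗ Δ.toLinearMap =
      Algebra.linearMap R _ ∘ₗ (TensorAlgebra.algebraMapInv (M := LoopModule M R)).toLinearMap := by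
  refine LinearMap.ext fun a => ?_
  change LinearMap.mul' R _ ((antiLift f).lTensor _ (Δ a)) =
    algebraMap R _ (TensorAlgebra.algebraMapInv a)
  induction a using TensorAlgebra.induction with
  | algebraMap r =>
    rw [AlgHom.commutes, AlgHom.commutes, Algebra.TensorProduct.algebraMap_apply,
      LinearMap.lTensor_tmul, LinearMap.mul'_apply, antiLift_one, mul_one]
    rfl
  | ι v =>
    have : (LinearMap.mul' R _ ∘ₗ (antiLift f).lTensor _ ∘ₗ Δ.toLinearMap) ∘ₗ TensorAlgebra.ι R =
        (Algebra.linearMap R _ ∘ₗ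
          (TensorAlgebra.algebraMapInv (M := LoopModule M R)).toLinearMap) ∘ₗ TensorAlgebra.ι R :=
      loopModule_linearMap_ext fun x => by
        refine (h x).trans ?_
        change 0 = algebraMap R _ (TensorAlgebra.algebraMapInv (tensorGen R x))
        rw [algebraMapInv_tensorGen, map_zero]
    exact LinearMap.congr_fun this v
  | mul a b ha hb =>
    rw [map_mul, mul'_lTensor_mul (antiLift_mul f) hb, ha, map_mul, map_mul]
  | add a b ha hb => simp only [map_add, ha, hb]

theorem mul'_rTensor_antiLift {Δ : TensorLoops M R →ₐ[R] TensorLoops M R ⊗[R] TensorLoops M R}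
    {f : LoopClass M → TensorLoops M R}
    (h : ∀ x, LinearMap.mul' R _ ((antiLift f).rTensor _ (Δ (tensorGen R x))) = 0) :
    LinearMap.mul' R _ ∘ₗ (antiLift f).rTensor _ ∘ₗ Δ.toLinearMap =
      Algebra.linearMap R _ ∘ₗ (TensorAlgebra.algebraMapInv (M := LoopModule M R)).toLinearMap := by
  refine LinearMap.ext fun a => ?_
  change LinearMap.mul' R _ ((antiLift f).rTensor _ (Δ a)) =
    algebraMap R _ (TensorAlgebra.algebraMapInv a)
  induction a using TensorAlgebra.induction with
  | algebraMap r =>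
    rw [AlgHom.commutes, AlgHom.commutes, Algebra.TensorProduct.algebraMap_apply,
      LinearMap.rTensor_tmul, LinearMap.mul'_apply, antiLift_algebraMap, mul_one]
    rfl
  | ι v =>
    have : (LinearMap.mul' R _ ∘ₗ (antiLift f).rTensor _ ∘ₗ Δ.toLinearMap) ∘ₗ TensorAlgebra.ι R =
        (Algebra.linearMap R _ ∘ₗ
          (TensorAlgebra.algebraMapInv (M := LoopModule M R)).toLinearMap) ∘ₗ TensorAlgebra.ι R :=
      loopModule_linearMap_ext fun x => by
        refine (h x).trans ?_
        change 0 = algebraMap R _ (TensorAlgebra.algebraMapInv (tensorGen R x))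
        rw [algebraMapInv_tensorGen, map_zero]
    exact LinearMap.congr_fun this v
  | mul a b ha hb =>
    rw [map_mul, mul'_rTensor_mul (antiLift_mul f) ha, hb, map_mul, map_mul]
  | add a b ha hb => simp only [map_add, ha, hb]

end

variable [IsManifold (𝓡∂ 2) ∞ M] (o : SurfaceOrientation M) (R : Type*) [CommRing R]

-- Each antipode equation expresses the value on α through loops with fewer crossings: root loops of
-- nonempty cuts for one equation, outer loops for the other. The two recursive solutions must
-- coincide.
open Classical in
theorem exists_isAntipode_tensorComul : ∃ f : LoopClass M → TensorLoops M R,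
    IsAntipode (tensorComul o R) TensorAlgebra.algebraMapInv (antiLift f) := by
  -- The recursion runs over isotopy classes, so its formulas use chosen representatives; the number
  -- of crossings depends only on the class.
  choose rep hrep using LoopClass.exists_rep (M := M)
  have hnum : ∀ x, (rep x).numCrossings = LoopClass.numCrossings o x := fun x => by
    conv_rhs => rw [← hrep x]
    rfl
  have hroot : ∀ x, ∀ H ∈ (rep x).simpleCuts.erase ∅,
      LoopClass.numCrossings o ((rep x).rootLoop H).isotopyClass < LoopClass.numCrossings o x := by
    intro x H hH
    rw [Finset.mem_erase, PointedLoop.mem_simpleCuts_iff] at hH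
    exact (PointedLoop.numCrossings_rootLoop_lt hH.2
      (Finset.nonempty_iff_ne_empty.2 hH.1)).trans_eq (hnum x)
  have houter : ∀ x, ∀ p ∈ (rep x).crossings,
      LoopClass.numCrossings o ((rep x).outerLoop p).isotopyClass < LoopClass.numCrossings o x := by
    intro x p hp
    exact (PointedLoop.numCrossings_outerLoop_lt hp).trans_eq (hnum x)
  obtain ⟨f, hf⟩ := exists_eq_of_measure (LoopClass.numCrossings o)
    (fun x f => -tensorGen R x - ∑ H ∈ (rep x).simpleCuts.erase ∅,
      (((rep x).cutSign o H : ℤ) : R) •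
        ((rep x).tensorLeft R H * f ((rep x).rootLoop H).isotopyClass))
    fun x f f' h => by
      refine congrArg _ (Finset.sum_congr rfl fun H hH => ?_)
      rw [h _ (hroot x H hH)]
  -- This solves the equation for the left inverse, where the antihomomorphism reverses l̃_H; the
  -- reversed product is written in the opposite algebra.
  obtain ⟨f', hf'⟩ := exists_eq_of_measure (LoopClass.numCrossings o)
    (fun x f => -tensorGen R x - ∑ H ∈ (rep x).simpleCuts.erase ∅,
      (((rep x).cutSign o H : ℤ) : R) • (MulOpposite.unop ((rep x).orderedProd
        (fun p => MulOpposite.op (f ((rep x).outerLoop p).isotopyClass)) H) *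
          tensorGen R ((rep x).rootLoop H).isotopyClass))
    fun x f f' h => by
      refine congrArg _ (Finset.sum_congr rfl fun H hH => ?_)
      rw [Finset.mem_erase, PointedLoop.mem_simpleCuts_iff] at hH
      rw [PointedLoop.orderedProd_congr hH.2.subset fun p hp => by
        rw [h _ (houter x p (hH.2.subset p hp))]]
  refine ⟨f, isAntipode_of_left_right (isCoassociative_tensorComul o R) (isCounit_tensorComul o R)
    (t := antiLift f') (mul'_rTensor_antiLift fun x => ?_) (mul'_lTensor_antiLift fun x => ?_)⟩
  · have h1 := hf' x
    conv_lhs => rw [← hrep x]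
    rw [tensorComul_gen, PointedLoop.tensorDelta_eq, hrep,
      ← Finset.add_sum_erase _ _ (rep x).empty_mem_simpleCuts]
    simp only [map_add, map_sum, map_smul, LinearMap.rTensor_tmul, LinearMap.mul'_apply, mul_one,
      antiLift_gen, PointedLoop.cutSign_empty, Int.cast_one, one_smul, PointedLoop.tensorLeft_empty,
      antiLift_one, one_mul, PointedLoop.isotopyClass_rootLoop_empty, hrep]
    rw [Finset.sum_congr rfl fun H hH => by
      rw [antiLift_tensorLeft f' (rep x) (PointedLoop.mem_simpleCuts_iff.1
        (Finset.mem_of_mem_erase hH))], h1]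
    abel
  · have h1 := hf x
    conv_lhs => rw [← hrep x]
    rw [tensorComul_gen, PointedLoop.tensorDelta_eq, hrep,
      ← Finset.add_sum_erase _ _ (rep x).empty_mem_simpleCuts]
    simp only [map_add, map_sum, map_smul, LinearMap.lTensor_tmul, LinearMap.mul'_apply, mul_one,
      antiLift_gen, PointedLoop.cutSign_empty, Int.cast_one, one_smul, PointedLoop.tensorLeft_empty,
      antiLift_one, one_mul, PointedLoop.isotopyClass_rootLoop_empty, hrep]
    rw [h1]
    abel

/-! ### The symmetric algebra -/

/-- The projection of the tensor algebra onto the symmetric algebra. -/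
def symProj : TensorLoops M R →ₐ[R] SymLoops M R := SymmetricAlgebra.algHom R (LoopModule M R)

/-- The comultiplication of `S(𝓛)`. -/
def symComul : SymLoops M R →ₐ[R] SymLoops M R ⊗[R] SymLoops M R :=
  symLift fun x => Algebra.TensorProduct.map (symProj R) (symProj R) (LoopClass.tensorDelta R o x)

theorem symComul_symProj (a : TensorLoops M R) : symComul o R (symProj R a) =
    Algebra.TensorProduct.map (symProj R) (symProj R) (tensorComul o R a) := by
  have : (symComul o R).comp (symProj R) =
      (Algebra.TensorProduct.map (symProj R) (symProj R)).comp (tensorComul o R) :=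
    tensorLoops_algHom_ext fun x => by
      rw [AlgHom.comp_apply, AlgHom.comp_apply, symProj, algHom_tensorGen, symComul, symLift_gen,
        tensorComul, tensorLift_gen]
      rfl
  exact AlgHom.congr_fun this a

theorem symComul_gen (α : PointedLoop M) :
    symComul o R (symGen R α.isotopyClass) = α.symDelta R o := by
  rw [← algHom_tensorGen]
  refine (symComul_symProj o R _).trans ?_
  rw [tensorComul_gen, PointedLoop.tensorDelta, PointedLoop.symDelta, map_add, map_sum]
  congr 1
  refine Finset.sum_congr rfl fun H hH => ?_
  rw [map_smul, Algebra.TensorProduct.map_tmul,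
    PointedLoop.symLeft_eq R (PointedLoop.mem_simpleCuts_iff.1 hH)]
  rfl

/-- The target is commutative, so the antihomomorphism of the tensor algebra induces a homomorphism
of the symmetric algebra. -/
theorem exists_isAntipode_symComul : ∃ s : SymLoops M R →ₐ[R] SymLoops M R,
    IsAntipode (symComul o R) SymmetricAlgebra.algebraMapInv s.toLinearMap := by
  obtain ⟨f, hf⟩ := exists_isAntipode_tensorComul o R
  refine ⟨symLift fun x => symProj R (f x), IsAntipode.of_surjective
    (SymmetricAlgebra.algHom_surjective R (LoopModule M R)) (symComul_symProj o R) algebraMapInv_algHom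
    (s := antiLift f) (fun a => ?_) hf⟩
  change symLift _ (symProj R a) = symProj R (antiLift f a)
  induction a using TensorAlgebra.induction with
  | algebraMap r => rw [AlgHom.commutes, AlgHom.commutes, antiLift_algebraMap, AlgHom.commutes]
  | ι v =>
    have : ((symLift fun x => symProj R (f x)).toLinearMap ∘ₗ (symProj R).toLinearMap) ∘ₗ
        TensorAlgebra.ι R = ((symProj R).toLinearMap ∘ₗ antiLift f) ∘ₗ TensorAlgebra.ι R :=
      loopModule_linearMap_ext fun x => by
        change symLift _ (symGen R x) = symProj R (antiLift f (tensorGen R x))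
        rw [symLift_gen, antiLift_gen]
    exact LinearMap.congr_fun this v
  | mul a b ha hb => rw [map_mul, map_mul, ha, hb, antiLift_mul, map_mul, mul_comm]
  | add a b ha hb => simp only [map_add, ha, hb]

variable {R}

/-- The right antipode identity on a generator contains s(α) from the empty cut and α from α ⊗ 1.
Solving it for s(α) gives the inductive formula. -/
theorem symAntipodeValue_of_isAntipode {s : SymLoops M R →ₐ[R] SymLoops M R}
    (hs : IsAntipode (symComul o R) SymmetricAlgebra.algebraMapInv s.toLinearMap)
    (α : PointedLoop M) : s (symGen R α.isotopyClass) = α.symAntipodeValue R o s := by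
  classical
  have h1 := LinearMap.congr_fun hs.2 (symGen R α.isotopyClass)
  change LinearMap.mul' R _ (s.toLinearMap.lTensor _ (symComul o R (symGen R α.isotopyClass))) =
    algebraMap R _ (SymmetricAlgebra.algebraMapInv (symGen R α.isotopyClass)) at h1
  rw [symComul_gen, algebraMapInv_symGen, map_zero, PointedLoop.symDelta,
    ← Finset.add_sum_erase _ _ α.empty_mem_simpleCuts] at h1
  simp only [map_add, map_sum, map_smul, LinearMap.lTensor_tmul, LinearMap.mul'_apply, mul_one,
    AlgHom.toLinearMap_apply, map_one, PointedLoop.cutSign_empty, Int.cast_one, one_smul,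
    symLeft_empty, one_mul, PointedLoop.isDisjointCut_empty.rootClass_eq,
    PointedLoop.isotopyClass_rootLoop_empty] at h1
  rw [PointedLoop.symAntipodeValue]
  convert! eq_neg_of_add_eq_zero_left (a := s (symGen R α.isotopyClass)) (b := symGen R
    α.isotopyClass + ∑ H ∈ α.simpleCuts.erase ∅, ((α.cutSign o H : ℤ) : R) •
      (α.symLeft R H * s (symGen R (α.rootClass H)))) ?_ using 1
  · rw [neg_add']
  · rw [← h1]; abel

/-- The formula refers only to root loops of nonempty cuts, which have fewer crossings; induction
determines all values on generators. -/
theorem symAntipode_unique {s s' : SymLoops M R →ₐ[R] SymLoops M R}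
    (hs : ∀ α : PointedLoop M, s (symGen R α.isotopyClass) = α.symAntipodeValue R o s)
    (hs' : ∀ α : PointedLoop M, s' (symGen R α.isotopyClass) = α.symAntipodeValue R o s') :
    s' = s := by
  classical
  have key : ∀ (n : ℕ) (α : PointedLoop M), α.numCrossings = n →
      s' (symGen R α.isotopyClass) = s (symGen R α.isotopyClass) := by
    intro n
    induction n using Nat.strong_induction_on with
    | _ n ih =>
      rintro α rfl
      rw [hs, hs', PointedLoop.symAntipodeValue, PointedLoop.symAntipodeValue]
      refine congrArg _ (Finset.sum_congr rfl fun H hH => ?_)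
      rw [Finset.mem_erase, PointedLoop.mem_simpleCuts_iff] at hH
      rw [hH.2.rootClass_eq, ih _ (PointedLoop.numCrossings_rootLoop_lt hH.2
        (Finset.nonempty_iff_ne_empty.2 hH.1)) _ rfl]
  refine symLoops_algHom_ext fun x => ?_
  obtain ⟨α, rfl⟩ := x.exists_rep
  exact key _ α rfl

end Antipode

end LoopHopf

end

/-! ### The main theorem -/

open LoopHopf in
theorem mainTheorem4 {R : Type*} [CommRing R] {M : Type*} [TopologicalSpace M] [T2Space M]
    [SecondCountableTopology M] [ChartedSpace (EuclideanHalfSpace 2) M] [IsManifold (𝓡∂ 2) ∞ M]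
    (o : SurfaceOrientation M) :
    -- the loops associated with the faces of simple cuts exist and are unique up to isotopy
    (∀ α : PointedLoop M, ∀ H ∈ α.simpleCuts,
      ((∃ β, α.IsRootLoop H β) ∧ ∀ β, α.IsRootLoop H β → β.isotopyClass = α.rootClass H) ∧
      ∀ p ∈ H, (∃ β, α.IsOuterLoop H p β) ∧
        ∀ β, α.IsOuterLoop H p β → β.isotopyClass = α.outerClass H p) ∧
    -- the symmetric algebra
    (∃ Δ : SymLoops M R →ₐ[R] SymLoops M R ⊗[R] SymLoops M R,
      (∀ α : PointedLoop M, Δ (symGen R α.isotopyClass) = α.symDelta R o) ∧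
      (∀ Δ' : SymLoops M R →ₐ[R] SymLoops M R ⊗[R] SymLoops M R,
        (∀ α : PointedLoop M, Δ' (symGen R α.isotopyClass) = α.symDelta R o) → Δ' = Δ) ∧
      IsCoassociative Δ ∧
      IsCounit Δ SymmetricAlgebra.algebraMapInv ∧
      ∃ s : SymLoops M R →ₐ[R] SymLoops M R,
        (∀ α : PointedLoop M, s (symGen R α.isotopyClass) = α.symAntipodeValue R o s) ∧
        (∀ s' : SymLoops M R →ₐ[R] SymLoops M R,
          (∀ α : PointedLoop M, s' (symGen R α.isotopyClass) = α.symAntipodeValue R o s') →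
            s' = s) ∧
        IsAntipode Δ SymmetricAlgebra.algebraMapInv s.toLinearMap) ∧
    -- the tensor algebra
    (∃ Δ : TensorLoops M R →ₐ[R] TensorLoops M R ⊗[R] TensorLoops M R,
      (∀ α : PointedLoop M, Δ (tensorGen R α.isotopyClass) = α.tensorDelta R o) ∧
      (∀ Δ' : TensorLoops M R →ₐ[R] TensorLoops M R ⊗[R] TensorLoops M R,
        (∀ α : PointedLoop M, Δ' (tensorGen R α.isotopyClass) = α.tensorDelta R o) → Δ' = Δ) ∧
      IsCoassociative Δ ∧
      IsCounit Δ TensorAlgebra.algebraMapInv ∧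
      ∃ s : TensorLoops M R →ₗ[R] TensorLoops M R,
        IsAntipode Δ TensorAlgebra.algebraMapInv s) := by
  refine ⟨fun α H hH => ?_, ⟨symComul o R, symComul_gen o R, fun Δ' h => ?_,
    IsCoassociative.of_surjective (SymmetricAlgebra.algHom_surjective R (LoopModule M R))
      (symComul_symProj o R) (isCoassociative_tensorComul o R),
    IsCounit.of_surjective (SymmetricAlgebra.algHom_surjective R (LoopModule M R))
      (symComul_symProj o R) algebraMapInv_algHom (isCounit_tensorComul o R), ?_⟩,
    ⟨tensorComul o R, tensorComul_gen o R, fun Δ' h => ?_, isCoassociative_tensorComul o R,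
      isCounit_tensorComul o R, ?_⟩⟩
  · have hH' := PointedLoop.mem_simpleCuts_iff.1 hH
    refine ⟨⟨⟨_, hH'.isRootLoop_rootLoop⟩, fun β hβ => ?_⟩, fun p hp =>
      ⟨⟨_, hH'.isOuterLoop_outerLoop hp⟩, fun β hβ => ?_⟩⟩
    · rw [hH'.rootClass_eq, hH'.isotopyClass_of_isRootLoop hβ]
    · rw [hH'.outerClass_eq hp, hH'.isotopyClass_of_isOuterLoop hp hβ]
  · refine symLoops_algHom_ext fun x => ?_
    obtain ⟨α, rfl⟩ := x.exists_rep
    rw [h, symComul_gen]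
  · obtain ⟨s, hs⟩ := exists_isAntipode_symComul o R
    have hs' := symAntipodeValue_of_isAntipode o hs
    exact ⟨s, hs', fun s' h => symAntipode_unique o hs' h, hs⟩
  · refine tensorLoops_algHom_ext fun x => ?_
    obtain ⟨α, rfl⟩ := x.exists_rep
    rw [h, tensorComul_gen]
  · obtain ⟨f, hf⟩ := exists_isAntipode_tensorComul o R
    exact ⟨antiLift f, hf⟩
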